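/- Let $k$ be a field, let $R=\bigoplus_{d\ge 0}R_d$ be a commutative Noetherian $\mathbb N$-graded connected ($R_0=k$) $k$-algebra, and let $R_+=\bigoplus_{d>0}R_d$, so that $k=R/R_+$. Let $\Theta$ be a group acting on $R$ by graded $k$-algebra automorphisms, and let $R\rtimes\Theta$ be the skew group algebra. A graded $R\rtimes\Theta$-module is a graded $R$-module $M=\bigoplus_{d\ge0}M_d$ with a degree-preserving $\Theta$-action such that $g(rm)=g(r)g(m)$. Let $M$ be such a module, finitely generated over $R$. Let $\mathrm{Groth}(k(\Theta))$ be the Grothendieck ring of finite-dimensional $k(\Theta)$-modules (relations from short exact sequences, product $\otimes_k$). For a graded $k(\Theta)$-module $N$ with finite-dimensional components put $[N](t)=\sum_d[N_d]\,t^d\in\mathrm{Groth}(k(\Theta))[[t]]$. The group $\Theta$ acts on the graded spaces $\mathrm{Tor}_i^R(M,k)=\bigoplus_j \mathrm{Tor}_i^R(M,k)_j$, which are the homology of $P\otimes_R k$ for a resolution $P$ of $M$ by graded free $R\rtimes\Theta$-modules. Let $\mathrm{hd}_R(M)=\max\{i:\mathrm{Tor}_i^R(M,k)\ne0\}\in\mathbb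 N\cup\{\infty\}$ (and $0$ if $M=0$), and let $\mathrm{mindeg}(U)=\min\{d:U_d\ne0\}$. An equivariant resolution of $M$ is an exact sequence $\cdots\to F_1\to F_0\to M\to0$ of graded $R\rtimes\Theta$-modules and degree-preserving $R$-linear $\Theta$-equivariant maps, in which each $F_i$ is graded free of finite rank over $R$; its length is the largest $i$ with $F_i\neq 0$ (and $0$ if there is none). (i) $M$ has an equivariant resolution with $\mathrm{mindeg}(F_{i+1})>\mathrm{mindeg}(F_i)$ for all $i$ with $F_{i+1}\ne0$. All $R_d$, $M_d$ and $\mathrm{Tor}_i^R(M,k)_j$ are finite-dimensional over $k$, and for each $j$ only finitely many $\mathrm{Tor}_i^R(M,k)_j$ are nonzero, so that $\sum_{i\ge0}(-1)^i[\mathrm{Tor}_i^R(M,k)](t)$ is a well-defined element of $\mathrm{Groth}(k(\Theta))[[t]]$. (ii) If $k(\Theta)$ is semisimple, that is, if $\Theta$ is finite and $|\Theta|$ is invertible in $k$, then the resolution in (i) can in addition be chosen minimal as an $R$-resolution: the maps $F_{i+1}\to F_i$ have image in $R_+F_i$, and each $F_i$ has the smallest rank among the $i$-th terms of all resolutions of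 $M$ by finitely generated free $R$-modules. (iii) If $\mathrm{hd}_R(M)$ is finite, the resolution in (i), and under the hypothesis of (ii) the one in (ii), can in addition be chosen of length $\mathrm{hd}_R(M)$. (iv) In $\mathrm{Groth}(k(\Theta))[[t]]$ the series $[R](t)$ is invertible, and $$\sum_{i\ge0}(-1)^i[\mathrm{Tor}_i^R(M,k)](t)=\frac{[M](t)}{[R](t)}.$$ Suppose moreover that $\Theta$ is finite, and let $S$ be a simple $k(\Theta)$-module. (v) For each of the three series $[R](t)$, $[M](t)$ and $\sum_{i\ge0}(-1)^i[\mathrm{Tor}_i^R(M,k)](t)$, the power series in $t$ counting the multiplicity of $[S]$ as a composition factor is the expansion of a rational function in $\mathbb Q(t)$. (vi) The rational functions so obtained from $[M](t)$ and $[R](t)$ have a pole at $t=1$ of order at most the Krull dimension of $R$. -/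

import Mathlib

open CategoryTheory

universe u

noncomputable section

/-! ### The Grothendieck ring of finite-dimensional `k(Θ)`-modules -/

section Grothendieck

variable (k Θ : Type u) [Field k] [Group Θ]

/-- The ring with one generator for each isomorphism class of finite-dimensional `k(Θ)`-modules,
with sum given by formal sums and with product induced by the tensor product over `k`. -/
abbrev FreeRepRing : Type (u + 1) := MonoidAlgebra ℤ (Skeleton (FDRep k Θ))

variable {k Θ} in
/-- The generator attached to a finite-dimensional representation. -/
def FreeRepRing.gen (V : FDRep k Θ) : FreeRepRing k Θ :=
  MonoidAlgebra.of ℤ (Skeleton (FDRep k Θ)) (toSkeleton V)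

/-- The relations `[M'] - [M] + [M''] = 0`, one for each short exact sequence
`0 → M' → M → M'' → 0` of finite-dimensional representations. -/
def grothendieckRelations : Set (FreeRepRing k Θ) :=
  {x | ∃ (M' M M'' : FDRep k Θ) (f : M' ⟶ M) (g : M ⟶ M''),
    Function.Injective f ∧ Function.Exact f g ∧ Function.Surjective g ∧
      x = FreeRepRing.gen M' - FreeRepRing.gen M + FreeRepRing.gen M''}

/-- The Grothendieck ring of finite-dimensional `k(Θ)`-modules. -/
abbrev GrothendieckRing : Type (u + 1) :=
  FreeRepRing k Θ ⧸ Ideal.span (grothendieckRelations k Θ)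

variable {k Θ}

/-- The class `[V]` of a finite-dimensional representation in the Grothendieck ring. -/
def grothendieckClass (V : FDRep k Θ) : GrothendieckRing k Θ :=
  Ideal.Quotient.mk _ (FreeRepRing.gen V)

open Classical in
/-- The class `[V]` of a representation `V` which is finite-dimensional
(the value is `0` if `V` is infinite-dimensional). -/
def repClass (V : Rep.{u} k Θ) : GrothendieckRing k Θ :=
  if _h : Module.Finite k V then grothendieckClass (FDRep.of V.ρ) else 0

/-- `m : Groth(k(Θ)) → ℤ` is the composition multiplicity of the simple module `S`: its value at
`[V]` is the number of factors isomorphic to `S` in any composition series of `V`. -/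
def IsCompositionMultiplicity (S : Type u) [AddCommGroup S] [Module (MonoidAlgebra k Θ) S]
    (m : GrothendieckRing k Θ →+ ℤ) : Prop :=
  ∀ (V : FDRep k Θ)
    (s : CompositionSeries (Submodule (MonoidAlgebra k Θ) (Representation.asModule V.ρ))),
    s.head = ⊥ → s.last = ⊤ →
      m (grothendieckClass V) =
        Nat.card {i : Fin s.length //
          Nonempty ((s i.succ ⧸ (s i.castSucc).submoduleOf (s i.succ))
            ≃ₗ[MonoidAlgebra k Θ] S)}

/-- The series in `ℚ⟦t⟧` obtained by applying an additive function `m` to the coefficients. -/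
def coefficientSeries (m : GrothendieckRing k Θ →+ ℤ) (f : PowerSeries (GrothendieckRing k Θ)) :
    PowerSeries ℚ :=
  PowerSeries.mk fun n => (m (PowerSeries.coeff n f) : ℚ)

end Grothendieck

/-- The power series `f` is the expansion at `t = 0` of the rational function `r`. -/
def IsExpansionOf (f : PowerSeries ℚ) (r : RatFunc ℚ) : Prop :=
  (f : LaurentSeries ℚ) = (r : LaurentSeries ℚ)

/-- The order of the pole of the rational function `r` at `t = a` (zero if `r` is regular there). -/
def poleOrder (r : RatFunc ℚ) (a : ℚ) : ℕ := r.denom.rootMultiplicity a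

/-! ### Auxiliary facts on gradings -/

theorem isInternal_of_projections {k V : Type*} [Field k] [AddCommGroup V] [Module k V]
    (gr : ℕ → Submodule k V) (p : ℕ → V →ₗ[k] V)
    (h1 : ∀ j, ∀ v ∈ gr j, p j v = v) (h2 : ∀ i j, i ≠ j → ∀ v ∈ gr j, p i v = 0)
    (htop : ∀ v, v ∈ ⨆ j, gr j) : DirectSum.IsInternal gr := by
  rw [DirectSum.isInternal_submodule_iff_iSupIndep_and_iSup_eq_top]
  refine ⟨?_, eq_top_iff.2 fun v _ => htop v⟩
  intro j
  rw [Submodule.disjoint_def]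
  intro v hv hv'
  have hle : (⨆ i, ⨆ (_ : i ≠ j), gr i) ≤ LinearMap.ker (p j) :=
    iSup₂_le fun i hi w hw => h2 j i hi.symm w hw
  rw [← h1 j v hv]
  exact hle hv'

theorem exists_projections {k V : Type*} [Field k] [AddCommGroup V] [Module k V]
    {gr : ℕ → Submodule k V} (h : DirectSum.IsInternal gr) :
    ∃ p : ℕ → V →ₗ[k] V, (∀ j v, p j v ∈ gr j) ∧ (∀ j, ∀ v ∈ gr j, p j v = v) ∧
      (∀ i j, i ≠ j → ∀ v ∈ gr j, p i v = 0) ∧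
      ∀ v, ∃ s : Finset ℕ, v = ∑ j ∈ s, p j v := by
  classical
  let _ := h.chooseDecomposition
  refine ⟨fun j => (gr j).subtype ∘ₗ DirectSum.component k ℕ (fun i => gr i) j ∘ₗ
    (DirectSum.decomposeLinearEquiv gr).toLinearMap, ?_, ?_, ?_, ?_⟩
  · intro j v
    exact Subtype.prop _
  · intro j v hv
    exact DirectSum.decompose_of_mem_same gr hv
  · intro i j hij v hv
    exact DirectSum.decompose_of_mem_ne gr hv hij.symm
  · intro v
    exact ⟨_, (DirectSum.sum_support_decompose gr v).symm⟩

/-! ### Graded `R ⋊ Θ`-modules -/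

/-- The group `Θ` acts on the graded algebra `R = ⨁ 𝒜 d` by grading preserving maps. -/
class GradedGroupAction {k R : Type u} [Field k] [CommRing R] [Algebra k R]
    (𝒜 : ℕ → Submodule k R) (Θ : Type u) [Group Θ] [MulSemiringAction Θ R] : Prop where
  smul_mem : ∀ (g : Θ) {d : ℕ} {r : R}, r ∈ 𝒜 d → g • r ∈ 𝒜 d

/-- An `ℕ`-graded module over the skew group algebra `R ⋊ Θ`, that is a graded `R`-module with a
compatible action of `Θ`: one has `g (r m) = g(r) g(m)`, and `Θ` preserves the grading. -/
structure GradedSkewModule {k R : Type u} [Field k] [CommRing R] [Algebra k R]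
    (𝒜 : ℕ → Submodule k R) (Θ : Type u) [Group Θ] [MulSemiringAction Θ R] where
  carrier : Type u
  [addCommGroup : AddCommGroup carrier]
  [moduleBase : Module k carrier]
  [moduleRing : Module R carrier]
  [isScalarTower : IsScalarTower k R carrier]
  ρ : Representation k Θ carrier
  gr : ℕ → Submodule k carrier
  isInternal : DirectSum.IsInternal gr
  smul_mem : ∀ {i j : ℕ} {r : R} {m : carrier}, r ∈ 𝒜 i → m ∈ gr j → r • m ∈ gr (i + j)
  ρ_smul : ∀ (g : Θ) (r : R) (m : carrier), ρ g (r • m) = (g • r) • ρ g m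
  ρ_mem : ∀ (g : Θ) {d : ℕ} {m : carrier}, m ∈ gr d → ρ g m ∈ gr d

namespace GradedSkewModule

variable {k R : Type u} [Field k] [CommRing R] [Algebra k R] {𝒜 : ℕ → Submodule k R}
  {Θ : Type u} [Group Θ] [MulSemiringAction Θ R]

instance : CoeSort (GradedSkewModule 𝒜 Θ) (Type u) := ⟨carrier⟩

attribute [instance] addCommGroup moduleBase moduleRing isScalarTower

/-- The ring `R` as a graded `R ⋊ Θ`-module. -/
def self (𝒜 : ℕ → Submodule k R) (Θ : Type u) [Group Θ] [MulSemiringAction Θ R] [GradedAlgebra 𝒜]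
    [SMulCommClass Θ k R] [GradedGroupAction 𝒜 Θ] : GradedSkewModule 𝒜 Θ where
  carrier := R
  ρ := Representation.ofDistribMulAction k Θ R
  gr := 𝒜
  isInternal := DirectSum.Decomposition.isInternal 𝒜
  smul_mem hr hm := SetLike.mul_mem_graded hr hm
  ρ_smul g r m := smul_mul' g r m
  ρ_mem g _ _ hm := GradedGroupAction.smul_mem g hm

/-- The action of `Θ` on the homogeneous component of degree `d`. -/
def pieceRep (M : GradedSkewModule 𝒜 Θ) (d : ℕ) : Representation k Θ (M.gr d) :=
  M.ρ.subrepresentation (M.gr d) fun g _ hm => M.ρ_mem g hm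

/-- The homogeneous component of degree `d`, as a representation of `Θ`. -/
def piece (M : GradedSkewModule 𝒜 Θ) (d : ℕ) : Rep.{u} k Θ := Rep.of (M.pieceRep d)

/-- The series `[M](t) = ∑ [M_d] t^d`. -/
def series (M : GradedSkewModule 𝒜 Θ) : PowerSeries (GrothendieckRing k Θ) :=
  PowerSeries.mk fun d => repClass (M.piece d)

/-- The least degree of a nonzero homogeneous component (`⊤` for the zero module). -/
def mindeg (M : GradedSkewModule 𝒜 Θ) : ℕ∞ := ⨅ (d : ℕ) (_ : M.gr d ≠ ⊥), (d : ℕ∞)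

/-- `M` is a graded free `R`-module: it has an `R`-basis of homogeneous elements. -/
def IsGradedFree (M : GradedSkewModule 𝒜 Θ) : Prop :=
  ∃ (ι : Type u) (b : Module.Basis ι R M), ∀ i, ∃ d, b i ∈ M.gr d

/-- Morphisms: `R`-linear, grading preserving, `Θ`-equivariant maps. -/
structure Hom (M N : GradedSkewModule 𝒜 Θ) where
  toLin : M →ₗ[R] N
  map_gr : ∀ {d : ℕ} {m : M}, m ∈ M.gr d → toLin m ∈ N.gr d
  map_ρ : ∀ (g : Θ) (m : M), toLin (M.ρ g m) = N.ρ g (toLin m)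

/-! #### The functor `- ⊗_R k`, where `k = R / R₊`, as the quotient by `R₊ M` -/

section Reduction

variable [GradedAlgebra 𝒜]

/-- The submodule `R₊ M`. -/
def plus (M : GradedSkewModule 𝒜 Θ) : Submodule R M :=
  (HomogeneousIdeal.irrelevant 𝒜).toIdeal • (⊤ : Submodule R M)

theorem map_mem_plus {M N : GradedSkewModule 𝒜 Θ} (f : M →ₗ[R] N) {m : M} (hm : m ∈ M.plus) :
    f m ∈ N.plus := by
  have h : M.plus.map f ≤ N.plus := by
    rw [plus, plus, Submodule.map_smul'']
    exact Submodule.smul_mono le_rfl le_top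
  exact h ⟨m, hm, rfl⟩

theorem smul_mem_irrelevant [GradedGroupAction 𝒜 Θ] (g : Θ) {r : R}
    (hr : r ∈ (HomogeneousIdeal.irrelevant 𝒜).toIdeal) :
    g • r ∈ (HomogeneousIdeal.irrelevant 𝒜).toIdeal := by
  rw [HomogeneousIdeal.irrelevant_eq_span] at hr ⊢
  induction hr using Submodule.span_induction with
  | mem x hx =>
    obtain ⟨i, hi⟩ := Set.mem_iUnion.1 hx
    obtain ⟨hi0, hxi⟩ := Set.mem_iUnion.1 hi
    exact Ideal.subset_span
      (Set.mem_iUnion.2 ⟨i, Set.mem_iUnion.2 ⟨hi0, GradedGroupAction.smul_mem g hxi⟩⟩)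
  | zero => simp
  | add x y _ _ hx hy => rw [smul_add]; exact add_mem hx hy
  | smul a x _ hx => rw [smul_eq_mul, smul_mul']; exact Ideal.mul_mem_left _ _ hx

theorem ρ_mem_plus [GradedGroupAction 𝒜 Θ] (M : GradedSkewModule 𝒜 Θ) (g : Θ) {m : M}
    (hm : m ∈ M.plus) : M.ρ g m ∈ M.plus := by
  refine Submodule.smul_induction_on hm ?_ ?_
  · intro r hr n _
    rw [M.ρ_smul]
    exact Submodule.smul_mem_smul (smul_mem_irrelevant g hr) trivial
  · intro x y hx hy
    rw [map_add]
    exact add_mem hx hy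

/-- The intersection of `R₊ M` with the component of degree `d`. -/
def plusPiece (M : GradedSkewModule 𝒜 Θ) (d : ℕ) : Submodule k (M.gr d) :=
  (M.plus.restrictScalars k).submoduleOf (M.gr d)

variable [GradedGroupAction 𝒜 Θ]

/-- The component of degree `d` of `M ⊗_R k = M / R₊ M`, with its action of `Θ`. -/
def tensorPiece (M : GradedSkewModule 𝒜 Θ) (d : ℕ) : Rep.{u} k Θ :=
  Rep.of ((M.pieceRep d).quotient (M.plusPiece d) fun g _ hm => M.ρ_mem_plus g hm)

/-- The map induced by a morphism on the component of degree `d` of `- ⊗_R k`. -/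
def Hom.tensorMap {M N : GradedSkewModule 𝒜 Θ} (f : Hom M N) (d : ℕ) :
    M.tensorPiece d ⟶ N.tensorPiece d :=
  Rep.ofHom <| LinearMap.intertwiningMap_of_isIntertwiningMap _ _
    (Submodule.mapQ (M.plusPiece d) (N.plusPiece d)
      ((f.toLin.restrictScalars k).restrict fun _ hm => f.map_gr hm)
      fun _ hm => map_mem_plus f.toLin hm) <| by
    intro g v
    induction v using Submodule.Quotient.induction_on with
    | H v =>
      refine congrArg (Submodule.Quotient.mk (p := N.plusPiece d)) (Subtype.ext ?_)
      exact f.map_ρ g v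

end Reduction

/-! #### Resolutions -/

/-- A `Θ`-equivariant graded free `R`-resolution
`⋯ → F₂ → F₁ → F₀ → M → 0`: each `F i` is a graded `R ⋊ Θ`-module which is graded free over `R`,
and the maps are grading preserving, `R`-linear and `Θ`-equivariant. -/
structure Resolution (M : GradedSkewModule 𝒜 Θ) where
  F : ℕ → GradedSkewModule 𝒜 Θ
  d : ∀ i, Hom (F (i + 1)) (F i)
  ε : Hom (F 0) M
  free : ∀ i, (F i).IsGradedFree
  exact : ∀ i, Function.Exact (d (i + 1)).toLin (d i).toLin
  exact_zero : Function.Exact (d 0).toLin ε.toLin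
  surjective : Function.Surjective ε.toLin

namespace Resolution

variable {M : GradedSkewModule 𝒜 Θ}

/-- All terms are finitely generated over `R`. -/
def IsFinite (P : Resolution M) : Prop := ∀ i, Module.Finite R (P.F i)

/-- `mindeg (F (i+1)) > mindeg (F i)`, as long as `F (i+1) ≠ 0`. -/
def HasIncreasingMindeg (P : Resolution M) : Prop :=
  ∀ i, Nontrivial (P.F (i + 1)) → (P.F i).mindeg < (P.F (i + 1)).mindeg

/-- The length of a resolution: the largest `i` such that `F i ≠ 0`, or `⊤` if there are infinitely
many such `i` (and `0` if there is none). -/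
def length (P : Resolution M) : ℕ∞ := ⨆ (i : ℕ) (_ : Nontrivial (P.F i)), (i : ℕ∞)

/-- A resolution with finitely generated terms is minimal as an `R`-resolution if the ranks of its
terms are simultaneously the smallest possible ones among all resolutions of `M` by finitely
generated free `R`-modules, equivalently all the differentials have entries in `R₊`.
Both properties are required here. -/
def IsMinimal [GradedAlgebra 𝒜] (P : Resolution M) : Prop :=
  (∀ i (x : P.F (i + 1)), (P.d i).toLin x ∈ (P.F i).plus) ∧
  ∀ (G : ℕ → ModuleCat.{u} R) (δ : ∀ i, G (i + 1) →ₗ[R] G i) (η : G 0 →ₗ[R] M),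
    (∀ i, Module.Free R (G i)) → (∀ i, Module.Finite R (G i)) →
    (∀ i, Function.Exact (δ (i + 1)) (δ i)) → Function.Exact (δ 0) η → Function.Surjective η →
      ∀ i, Module.finrank R (P.F i) ≤ Module.finrank R (G i)

variable [GradedAlgebra 𝒜] [GradedGroupAction 𝒜 Θ]

/-- The strand of internal degree `j` of the complex `F ⊗_R k`, a complex of representations. -/
def tensorComplex (P : Resolution M) (j : ℕ) : ChainComplex (Rep.{u} k Θ) ℕ :=
  ChainComplex.of (fun i => (P.F i).tensorPiece j) (fun i => (P.d i).tensorMap j) <| by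
    intro i
    ext v
    induction v using Submodule.Quotient.induction_on with
    | H v =>
      have h : (P.d i).toLin ((P.d (i + 1)).toLin v.1) = 0 := (P.exact i).apply_apply_eq_zero v.1
      refine (Submodule.Quotient.mk_eq_zero ((P.F i).plusPiece j)).2 ?_
      change (P.d i).toLin ((P.d (i + 1)).toLin v.1) ∈ (P.F i).plus
      rw [h]
      exact zero_mem _

end Resolution

/-! #### The standard resolution by free `R ⋊ Θ`-modules, and `Tor` -/

section Kernel

theorem Hom.kernel_isInternal {M N : GradedSkewModule 𝒜 Θ} (f : Hom M N) :
    DirectSum.IsInternal fun d =>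
      (M.gr d).submoduleOf ((LinearMap.ker f.toLin).restrictScalars k) := by
  obtain ⟨p, hp, h1, h2, h3⟩ := exists_projections M.isInternal
  obtain ⟨q, hq, q1, q2, q3⟩ := exists_projections N.isInternal
  have comm : ∀ j v, f.toLin (p j v) = q j (f.toLin v) := by
    intro j v
    obtain ⟨s, hs⟩ := h3 v
    by_cases hj : j ∈ s
    · conv_rhs => rw [hs, map_sum, map_sum]
      rw [Finset.sum_eq_single j]
      · exact (q1 j _ (f.map_gr (hp j v))).symm
      · intro i _ hij
        exact q2 j i hij.symm _ (f.map_gr (hp i v))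
      · exact fun h => absurd hj h
    · have : p j v = 0 := by
        rw [hs, map_sum]
        exact Finset.sum_eq_zero fun i hi =>
          h2 j i (fun h => hj (h ▸ hi)) _ (hp i v)
      rw [this, map_zero]
      conv_rhs => rw [hs, map_sum, map_sum]
      exact (Finset.sum_eq_zero fun i hi =>
          q2 j i (fun h => hj (h ▸ hi)) _ (f.map_gr (hp i v))).symm
  have hker : ∀ j, ∀ v ∈ (LinearMap.ker f.toLin).restrictScalars k,
      p j v ∈ (LinearMap.ker f.toLin).restrictScalars k := by
    intro j v hv
    change f.toLin (p j v) = 0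
    rw [comm, show f.toLin v = 0 from hv, map_zero]
  refine isInternal_of_projections _ (fun j => (p j).restrict (hker j)) ?_ ?_ ?_
  · intro j v hv
    exact Subtype.ext (h1 j v.1 hv)
  · intro i j hij v hv
    exact Subtype.ext (h2 i j hij v.1 hv)
  · intro v
    obtain ⟨s, hs⟩ := h3 v.1
    have : v = ∑ j ∈ s, (p j).restrict (hker j) v := by
      apply Subtype.ext
      rw [AddSubmonoidClass.coe_finsetSum]
      exact hs
    rw [this]
    refine sum_mem fun j _ => Submodule.mem_iSup_of_mem (p := fun d =>
      (M.gr d).submoduleOf ((LinearMap.ker f.toLin).restrictScalars k)) j ?_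
    exact hp j v.1

/-- The kernel of a morphism. -/
def Hom.kernel {M N : GradedSkewModule 𝒜 Θ} (f : Hom M N) : GradedSkewModule 𝒜 Θ where
  carrier := LinearMap.ker f.toLin
  moduleBase := Submodule.module ((LinearMap.ker f.toLin).restrictScalars k)
  isScalarTower := ⟨fun a r m => Subtype.ext (smul_assoc a r m.1)⟩
  ρ := M.ρ.subrepresentation ((LinearMap.ker f.toLin).restrictScalars k) fun g m hm => by
    change f.toLin (M.ρ g m) = 0
    rw [f.map_ρ, show f.toLin m = 0 from hm, map_zero]
  gr d := (M.gr d).submoduleOf ((LinearMap.ker f.toLin).restrictScalars k)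
  isInternal := f.kernel_isInternal
  smul_mem := by
    intro i j r m hr hm
    exact M.smul_mem (m := m.1) hr hm
  ρ_smul g r m := Subtype.ext (M.ρ_smul g r m.1)
  ρ_mem g _ _ hm := M.ρ_mem g hm

/-- The inclusion of the kernel. -/
def Hom.kernelι {M N : GradedSkewModule 𝒜 Θ} (f : Hom M N) : Hom f.kernel M where
  toLin := (LinearMap.ker f.toLin).subtype
  map_gr hm := hm
  map_ρ _ _ := rfl

/-- Composition of morphisms. -/
def Hom.comp {L M N : GradedSkewModule 𝒜 Θ} (g : Hom M N) (f : Hom L M) : Hom L N where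
  toLin := g.toLin ∘ₗ f.toLin
  map_gr hm := g.map_gr (f.map_gr hm)
  map_ρ a m := by simp [f.map_ρ, g.map_ρ]

end Kernel

section Standard

set_option linter.unusedSectionVars false

variable [GradedAlgebra 𝒜] [SMulCommClass Θ k R] [GradedGroupAction 𝒜 Θ]

/-- The homogeneous elements of `M` (each with its degree). -/
abbrev Homog (M : GradedSkewModule 𝒜 Θ) : Type u := Σ d : ℕ, M.gr d

/-- The component of degree `j` of `R` shifted by `a`, that is `R_{j-a}`. -/
def shift (𝒜 : ℕ → Submodule k R) (a j : ℕ) : Submodule k R := if a ≤ j then 𝒜 (j - a) else ⊥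

/-- The projection of `R` to `R_{j-a}`. -/
def shiftProj (𝒜 : ℕ → Submodule k R) [GradedAlgebra 𝒜] (a j : ℕ) : R →ₗ[k] R :=
  if a ≤ j then GradedAlgebra.proj 𝒜 (j - a) else 0

theorem shiftProj_of_mem {a j : ℕ} {r : R} (hr : r ∈ shift 𝒜 a j) : shiftProj 𝒜 a j r = r := by
  unfold shift at hr
  unfold shiftProj
  split_ifs at hr ⊢ with h
  · exact DirectSum.decompose_of_mem_same 𝒜 hr
  · simpa using hr.symm

theorem shiftProj_of_mem_ne {a i j : ℕ} (hij : i ≠ j) {r : R} (hr : r ∈ shift 𝒜 a j) :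
    shiftProj 𝒜 a i r = 0 := by
  unfold shift at hr
  unfold shiftProj
  by_cases hi : a ≤ i
  · rw [if_pos hi]
    by_cases hj : a ≤ j
    · rw [if_pos hj] at hr
      exact DirectSum.decompose_of_mem_ne 𝒜 hr (by omega)
    · rw [if_neg hj] at hr
      rw [(Submodule.mem_bot k).1 hr, map_zero]
  · rw [if_neg hi, LinearMap.zero_apply]

theorem mem_shift_add {a i : ℕ} {r : R} (hr : r ∈ 𝒜 i) : r ∈ shift 𝒜 a (i + a) := by
  unfold shift
  rw [if_pos (Nat.le_add_left a i), Nat.add_sub_cancel]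
  exact hr

theorem mul_mem_shift {a i j : ℕ} {r s : R} (hr : r ∈ 𝒜 i) (hs : s ∈ shift 𝒜 a j) :
    r * s ∈ shift 𝒜 a (i + j) := by
  unfold shift at hs ⊢
  split_ifs at hs with h
  · rw [if_pos (by omega), show i + j - a = i + (j - a) by omega]
    exact SetLike.mul_mem_graded hr hs
  · rw [(Submodule.mem_bot k).1 hs, mul_zero]
    exact zero_mem _

theorem smul_mem_shift (g : Θ) {a j : ℕ} {s : R} (hs : s ∈ shift 𝒜 a j) :
    g • s ∈ shift 𝒜 a j := by
  unfold shift at hs ⊢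
  split_ifs at hs ⊢ with h
  · exact GradedGroupAction.smul_mem g hs
  · rw [(Submodule.mem_bot k).1 hs, smul_zero]
    exact zero_mem _

/-- The action of `Θ` on the free cover: `h (r t_g e_x) = h(r) t_{hg} e_x`. -/
def freeCoverRep (M : GradedSkewModule 𝒜 Θ) : Representation k Θ ((Θ × M.Homog) →₀ R) where
  toFun h := Finsupp.lsum k fun x =>
    Finsupp.lsingle (h * x.1, x.2) ∘ₗ DistribSMul.toLinearMap k R h
  map_one' := by
    ext x r : 2
    simp
  map_mul' a b := by
    ext x r : 2
    simp [mul_smul, mul_assoc]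

theorem freeCoverRep_single (M : GradedSkewModule 𝒜 Θ) (h : Θ) (x : Θ × M.Homog) (r : R) :
    M.freeCoverRep h (Finsupp.single x r) = Finsupp.single (h * x.1, x.2) (h • r) := by
  simp [freeCoverRep]

theorem freeCoverRep_apply (M : GradedSkewModule 𝒜 Θ) (h : Θ) (f : (Θ × M.Homog) →₀ R)
    (x : Θ × M.Homog) : M.freeCoverRep h f x = h • f (h⁻¹ * x.1, x.2) := by
  classical
  induction f using Finsupp.induction_linear with
  | zero => simp
  | add f g hf hg => simp [hf, hg]
  | single y r =>
    rw [freeCoverRep_single, Finsupp.single_apply, Finsupp.single_apply]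
    by_cases hy : y = (h⁻¹ * x.1, x.2)
    · rw [if_pos hy, if_pos (by rw [hy]; simp)]
    · rw [if_neg hy, if_neg, smul_zero]
      rintro rfl
      exact hy (by simp)

/-- The component of degree `j` of the free cover. -/
def freeCoverGr (M : GradedSkewModule 𝒜 Θ) (j : ℕ) : Submodule k ((Θ × M.Homog) →₀ R) where
  carrier := {f | ∀ x : Θ × M.Homog, f x ∈ shift 𝒜 x.2.1 j}
  add_mem' hf hg x := add_mem (hf x) (hg x)
  zero_mem' _ := zero_mem _
  smul_mem' c _ hf x := Submodule.smul_mem _ c (hf x)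

theorem single_mem_freeCoverGr (M : GradedSkewModule 𝒜 Θ) {j : ℕ} {x : Θ × M.Homog} {r : R}
    (hr : r ∈ shift 𝒜 x.2.1 j) : Finsupp.single x r ∈ M.freeCoverGr j := by
  classical
  intro y
  rw [Finsupp.single_apply]
  split_ifs with h
  · exact h ▸ hr
  · exact zero_mem _

theorem freeCover_isInternal (M : GradedSkewModule 𝒜 Θ) :
    DirectSum.IsInternal M.freeCoverGr := by
  classical
  let p : ℕ → ((Θ × M.Homog) →₀ R) →ₗ[k] ((Θ × M.Homog) →₀ R) := fun j =>
    Finsupp.lsum k fun x => Finsupp.lsingle x ∘ₗ shiftProj 𝒜 x.2.1 j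
  have hp : ∀ j f x, p j f x = shiftProj 𝒜 x.2.1 j (f x) := by
    intro j f x
    induction f using Finsupp.induction_linear with
    | zero => simp
    | add f g hf hg => rw [map_add, Finsupp.add_apply, hf, hg, Finsupp.add_apply, map_add]
    | single y r =>
      have : p j (Finsupp.single y r) = Finsupp.single y (shiftProj 𝒜 y.2.1 j r) := by simp [p]
      rw [this, Finsupp.single_apply, Finsupp.single_apply]
      split_ifs with h
      · rw [h]
      · rw [map_zero]
  refine isInternal_of_projections _ p ?_ ?_ ?_
  · intro j f hf
    ext x
    rw [hp, shiftProj_of_mem (hf x)]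
  · intro i j hij f hf
    ext x
    rw [hp, shiftProj_of_mem_ne hij (hf x), Finsupp.zero_apply]
  · intro f
    induction f using Finsupp.induction_linear with
    | zero => exact zero_mem _
    | add f g hf hg => exact add_mem hf hg
    | single x r =>
      rw [← DirectSum.sum_support_decompose 𝒜 r, ← Finsupp.singleAddHom_apply, map_sum]
      exact sum_mem fun i _ => Submodule.mem_iSup_of_mem (i + x.2.1)
        (M.single_mem_freeCoverGr (mem_shift_add (Subtype.prop _)))

/-- The free `R ⋊ Θ`-module on the set of homogeneous elements of `M`. Its `R`-basis consists of the
elements `t_g e_x` with `g ∈ Θ` and `x` a homogeneous element of `M`; such an element has the degree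
of `x`, and `h (r t_g e_x) = h(r) t_{hg} e_x`. -/
def freeCover (M : GradedSkewModule 𝒜 Θ) : GradedSkewModule 𝒜 Θ where
  carrier := (Θ × M.Homog) →₀ R
  ρ := M.freeCoverRep
  gr := M.freeCoverGr
  isInternal := M.freeCover_isInternal
  smul_mem hr hm x := mul_mem_shift hr (hm x)
  ρ_smul g r f := by
    ext x
    rw [freeCoverRep_apply, Finsupp.smul_apply, Finsupp.smul_apply, freeCoverRep_apply,
      smul_eq_mul, smul_eq_mul, smul_mul']
  ρ_mem g _ f hf x := by
    rw [freeCoverRep_apply]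
    exact smul_mem_shift g (hf (g⁻¹ * x.1, x.2))

/-- The surjection `r t_g e_x ↦ r g(x)` from the free cover. -/
def freeCoverπ (M : GradedSkewModule 𝒜 Θ) : Hom M.freeCover M where
  toLin := Finsupp.linearCombination R fun x : Θ × M.Homog => M.ρ x.1 x.2.2
  map_gr := by
    intro d f hf
    change (Θ × M.Homog) →₀ R at f
    change Finsupp.linearCombination R (fun x : Θ × M.Homog => M.ρ x.1 x.2.2) f ∈ M.gr d
    rw [Finsupp.linearCombination_apply]
    refine sum_mem fun x _ => ?_
    have hx : f x ∈ shift 𝒜 x.2.1 d := hf x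
    unfold shift at hx
    split_ifs at hx with h
    · have := M.smul_mem hx (M.ρ_mem x.1 x.2.2.2)
      rwa [Nat.sub_add_cancel h] at this
    · dsimp only
      rw [(Submodule.mem_bot k).1 hx, zero_smul]
      exact zero_mem _
  map_ρ := by
    intro g f
    change Finsupp.linearCombination R (fun x : Θ × M.Homog => M.ρ x.1 x.2.2)
        (M.freeCoverRep g f) =
      M.ρ g (Finsupp.linearCombination R (fun x : Θ × M.Homog => M.ρ x.1 x.2.2) f)
    change (Θ × M.Homog) →₀ R at f
    induction f using Finsupp.induction_linear with
    | zero => simp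
    | add f g hf hg => simp only [map_add, hf, hg]
    | single x r =>
      rw [freeCoverRep_single, Finsupp.linearCombination_single, Finsupp.linearCombination_single,
        M.ρ_smul, map_mul]
      rfl

theorem freeCoverπ_surjective (M : GradedSkewModule 𝒜 Θ) :
    Function.Surjective M.freeCoverπ.toLin := by
  rw [← LinearMap.range_eq_top, eq_top_iff]
  intro m _
  obtain ⟨p, hp, -, -, h3⟩ := exists_projections M.isInternal
  obtain ⟨s, hs⟩ := h3 m
  rw [hs]
  refine sum_mem fun j _ => ⟨Finsupp.single ((1 : Θ), ⟨j, p j m, hp j m⟩) (1 : R), ?_⟩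
  change Finsupp.linearCombination R (fun x : Θ × M.Homog => M.ρ x.1 x.2.2) _ = _
  rw [Finsupp.linearCombination_single]
  simp

theorem freeCover_isGradedFree (M : GradedSkewModule 𝒜 Θ) : M.freeCover.IsGradedFree := by
  refine ⟨Θ × M.Homog, Finsupp.basisSingleOne, fun x => ⟨x.2.1, ?_⟩⟩
  change (Finsupp.basisSingleOne : Module.Basis (Θ × M.Homog) R _) x ∈ M.freeCoverGr x.2.1
  rw [Finsupp.coe_basisSingleOne]
  refine M.single_mem_freeCoverGr ?_
  have := mem_shift_add (𝒜 := 𝒜) (a := x.2.1) (SetLike.one_mem_graded 𝒜)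
  rwa [zero_add] at this

/-- The syzygies of `M` in its standard resolution. -/
def stdSyzygy (M : GradedSkewModule 𝒜 Θ) : ℕ → GradedSkewModule 𝒜 Θ
  | 0 => M
  | i + 1 => (M.stdSyzygy i).freeCoverπ.kernel

/-- The standard resolution of `M` by free graded `R ⋊ Θ`-modules: each term is the free cover of
the kernel of the previous map. -/
def stdResolution (M : GradedSkewModule 𝒜 Θ) : Resolution M where
  F i := (M.stdSyzygy i).freeCover
  d i := (M.stdSyzygy i).freeCoverπ.kernelι.comp (M.stdSyzygy (i + 1)).freeCoverπ
  ε := M.freeCoverπ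
  free i := (M.stdSyzygy i).freeCover_isGradedFree
  exact i := by
    intro y
    constructor
    · intro hy
      have hy' : (M.stdSyzygy (i + 1)).freeCoverπ.toLin y = 0 := Subtype.ext hy
      obtain ⟨z, hz⟩ := (M.stdSyzygy (i + 2)).freeCoverπ_surjective ⟨y, hy'⟩
      exact ⟨z, congrArg Subtype.val hz⟩
    · rintro ⟨z, rfl⟩
      exact congrArg Subtype.val ((M.stdSyzygy (i + 2)).freeCoverπ.toLin z).2
  exact_zero := by
    intro y
    constructor
    · intro hy
      obtain ⟨z, hz⟩ := (M.stdSyzygy 1).freeCoverπ_surjective ⟨y, hy⟩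
      exact ⟨z, congrArg Subtype.val hz⟩
    · rintro ⟨z, rfl⟩
      exact ((M.stdSyzygy 1).freeCoverπ.toLin z).2
  surjective := M.freeCoverπ_surjective

/-- The representation `Tor_i^R(M, k)_j` of `Θ`: the homology in homological degree `i` and internal
degree `j` of `P ⊗_R k`, where `P` is the standard resolution of `M` by free graded
`R ⋊ Θ`-modules. -/
def tor (M : GradedSkewModule 𝒜 Θ) (i j : ℕ) : Rep.{u} k Θ :=
  (M.stdResolution.tensorComplex j).homology i

/-- The homological dimension `hd_R(M)`: the largest `i` with `Tor_i^R(M, k) ≠ 0`, or `⊤` if there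
are infinitely many such `i` (and `0` if there is none). -/
def hd (M : GradedSkewModule 𝒜 Θ) : ℕ∞ := ⨆ (i : ℕ) (_ : ∃ j, Nontrivial (M.tor i j)), (i : ℕ∞)

/-- The series `∑ i, (-1)^i [Tor_i^R(M, k)](t)`, whose coefficient of `t^j` is
`∑ i, (-1)^i [Tor_i^R(M, k)_j]`, a sum which has to have finite support. -/
def torSeries (M : GradedSkewModule 𝒜 Θ) : PowerSeries (GrothendieckRing k Θ) :=
  PowerSeries.mk fun j => ∑ᶠ i : ℕ, (-1) ^ i * repClass (M.tor i j)

end Standard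

end GradedSkewModule

end

/-! The resolutions are built from one kind of cover. A finitely generated `M` is generated over `R`
by a finite-dimensional graded `Θ`-stable subspace `V`, and `R ⊗ V → M` is an equivariant surjection
from a graded free module (`exists_cover`). Since `R_0 = k`, the lowest component of `R ⊗ V` is that
of `1 ⊗ V`, where the map is the inclusion of `V` in `M`. Hence the kernel starts in a strictly
higher degree. Iterating, mindeg increases and `F_i` vanishes below degree `i`, so `Tor_i` vanishes
there too and all alternating sums are finite in each degree. If `k(Θ)` is semisimple, Maschke's
theorem lets `V` be a complement of `R₊M`; then the kernels lie in `R₊F` and the resolution is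
minimal.

`Tor` is defined by the standard resolution, whose terms are free over `R ⋊ Θ`. It therefore maps
equivariantly to every equivariant resolution. A homotopy inverse that is only `R`-linear shows that
this map is bijective on homology modulo `R₊` (`nonempty_tor_iso`). If `hd = h` is finite, the
vanishing of `Tor_{h+1}` makes the `h`-th syzygy graded free: without the group, minimal covers
always exist, and Nakayama kills the first term after the cover of that syzygy. Covering graded free
modules by themselves then stops the resolution at length `h`, semisimple or not.

For induced modules `[R ⊗ V] = [R][V]`, and `V` is the reduction modulo `R₊`. Taking Euler
characteristics along the resolution, before and after reduction, gives `torSeries * [R] = [M]`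
(`torSeries_mul_series`); `[R]` is invertible because its constant term is `[k] = 1`.

For finite `Θ`, composition multiplicity descends to the Grothendieck ring by Jordan–Hölder and
exactness of `⊗`. Prime avoidance and orbit products give at most `dim R` invariant homogeneous
parameters. Multiplication by them is equivariant, so the Hilbert–Serre argument runs in the
Grothendieck ring with denominator `∏ (1 - t^{e_i})`, which bounds the pole at `1`
(`series_mul_prod_mem_range`). Division by `[R]` is subtler, since multiplicities are additive but
not multiplicative. As the Grothendieck ring is a finitely generated abelian group, Cayley–Hamilton
shows that the numerator of `[R]` divides an integral polynomial (`exists_int_multiple`), which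
serves as denominator for the `Tor` series. -/

set_option linter.unusedSectionVars false

noncomputable section

/-! ### Classes of representations in the Grothendieck ring -/

section GrothendieckClasses

variable {k Θ : Type u} [Field k] [Group Θ]

/-- The morphism in `FDRep` given by an equivariant linear map. -/
def FDRep.homOfEquivariant {U V : Type u} [AddCommGroup U] [Module k U] [AddCommGroup V] [Module k V]
    [Module.Finite k U] [Module.Finite k V] {ρU : Representation k Θ U} {ρV : Representation k Θ V}
    (f : U →ₗ[k] V) (hf : ∀ g u, f (ρU g u) = ρV g (f u)) : FDRep.of ρU ⟶ FDRep.of ρV :=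
  ⟨FGModuleCat.ofHom f, fun g => by
    ext x
    exact hf g x⟩

/-- The defining relation for unbundled linear maps. Every later identity between classes, apart
from those on products and the unit, comes from here; only the middle term has to be assumed
finite-dimensional. -/
theorem repClass_of_exact {U V W : Type u} [AddCommGroup U] [Module k U] [AddCommGroup V]
    [Module k V] [AddCommGroup W] [Module k W] [Module.Finite k V] {ρU : Representation k Θ U}
    {ρV : Representation k Θ V} {ρW : Representation k Θ W} (f : U →ₗ[k] V) (g : V →ₗ[k] W)
    (hf : ∀ a u, f (ρU a u) = ρV a (f u)) (hg : ∀ a v, g (ρV a v) = ρW a (g v))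
    (inj : Function.Injective f) (ex : ∀ v, g v = 0 → ∃ u, f u = v) (zero : ∀ u, g (f u) = 0)
    (surj : Function.Surjective g) :
    repClass (Rep.of ρV) = repClass (Rep.of ρU) + repClass (Rep.of ρW) := by
  have hU : Module.Finite k U := Module.Finite.of_injective f inj
  have hW : Module.Finite k W := Module.Finite.of_surjective g surj
  have hV : Module.Finite k V := inferInstance
  rw [repClass, repClass, repClass, dif_pos hU, dif_pos hV, dif_pos hW]
  have key : FreeRepRing.gen (FDRep.of ρU) - FreeRepRing.gen (FDRep.of ρV) +
      FreeRepRing.gen (FDRep.of ρW) ∈ Ideal.span (grothendieckRelations k Θ) := by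
    refine Ideal.subset_span ⟨_, _, _, FDRep.homOfEquivariant f hf, FDRep.homOfEquivariant g hg,
      inj, fun v => ⟨ex v, ?_⟩, surj, rfl⟩
    rintro ⟨u, rfl⟩
    exact zero u
  rw [← Ideal.Quotient.eq_zero_iff_mem, map_add, map_sub] at key
  change grothendieckClass (FDRep.of ρV) = grothendieckClass (FDRep.of ρU) +
    grothendieckClass (FDRep.of ρW)
  rw [← sub_eq_zero, ← neg_eq_zero, ← key]
  simp only [grothendieckClass]
  abel

theorem repClass_of_subsingleton {V : Type u} [AddCommGroup V] [Module k V] [Subsingleton V]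
    (ρ : Representation k Θ V) : repClass (Rep.of ρ) = 0 := by
  -- The sequence with all three terms `V = 0` is exact and gives `c = c + c`.
  have := repClass_of_exact (ρU := ρ) (ρV := ρ) (ρW := ρ) 0 0 (by simp) (by simp)
    (fun _ _ _ => Subsingleton.elim _ _) (fun v _ => ⟨0, Subsingleton.elim _ _⟩) (by simp)
    (fun v => ⟨0, Subsingleton.elim _ _⟩)
  simpa using this

theorem repClass_congr {U V : Type u} [AddCommGroup U] [Module k U] [AddCommGroup V]
    [Module k V] [Module.Finite k V] {ρU : Representation k Θ U}
    {ρV : Representation k Θ V} (f : U →ₗ[k] V) (hf : ∀ a u, f (ρU a u) = ρV a (f u))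
    (bij : Function.Bijective f) : repClass (Rep.of ρU) = repClass (Rep.of ρV) := by
  have := repClass_of_exact (ρU := ρU) (ρV := ρV) (ρW := (1 : Representation k Θ PUnit.{u+1})) f 0 hf
    (by simp) bij.1 (fun v _ => bij.2 v) (by simp) (fun v => ⟨0, rfl⟩)
  rw [this, repClass_of_subsingleton (1 : Representation k Θ PUnit.{u+1}), add_zero]

theorem repClass_eq_of_iso {V W : Rep.{u} k Θ} (e : V ≅ W) : repClass V = repClass W := by
  by_cases h : Module.Finite k W
  · exact repClass_congr (ρU := V.ρ) (ρV := W.ρ) e.hom.hom.toLinearMap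
      (fun a u => Rep.hom_comm_apply e.hom a u) (Representation.equivOfIso e).toLinearEquiv.bijective
  -- In infinite dimension both sides take the default value `0`.
  · have h' : ¬ Module.Finite k V := fun h' =>
      h (Module.Finite.equiv (Representation.equivOfIso e).toLinearEquiv)
    rw [repClass, repClass, dif_neg h, dif_neg h']

open MonoidalCategory in
theorem FreeRepRing.gen_tensor (V W : FDRep k Θ) :
    FreeRepRing.gen (V ⊗ W) = FreeRepRing.gen V * FreeRepRing.gen W := by
  rw [FreeRepRing.gen, FreeRepRing.gen, FreeRepRing.gen, ← map_mul, Skeleton.toSkeleton_tensorObj]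

open MonoidalCategory in
theorem repClass_tprod {V W : Type u} [AddCommGroup V] [Module k V] [AddCommGroup W] [Module k W]
    [hV : Module.Finite k V] [hW : Module.Finite k W] (ρ : Representation k Θ V)
    (σ : Representation k Θ W) :
    repClass (Rep.of (ρ.tprod σ)) = repClass (Rep.of ρ) * repClass (Rep.of σ) := by
  have h : Module.Finite k (TensorProduct k V W) := inferInstance
  rw [repClass, repClass, repClass, dif_pos h, dif_pos hV, dif_pos hW]
  change Ideal.Quotient.mk _ (FreeRepRing.gen _) = Ideal.Quotient.mk _ (FreeRepRing.gen _) *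
    Ideal.Quotient.mk _ (FreeRepRing.gen _)
  rw [← map_mul, ← FreeRepRing.gen_tensor]
  rfl

theorem repClass_trivial : repClass (Rep.of (Representation.trivial k Θ k)) = 1 := by
  have h : Module.Finite k k := inferInstance
  rw [repClass, dif_pos h, grothendieckClass, FreeRepRing.gen]
  rw [← map_one (Ideal.Quotient.mk _), ← map_one (MonoidAlgebra.of ℤ (Skeleton (FDRep k Θ)))]
  rfl

/-- Additivity over a finite decomposition into equivariant direct summands. -/
theorem repClass_eq_sum {ι : Type*} [DecidableEq ι] {A : ι → Type u} [∀ i, AddCommGroup (A i)]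
    [∀ i, Module k (A i)] (σ : ∀ i, Representation k Θ (A i)) (s : Finset ι) :
    ∀ {V : Type u} [AddCommGroup V] [Module k V] [Module.Finite k V] (ρ : Representation k Θ V)
      (p : ∀ i, V →ₗ[k] A i) (j : ∀ i, A i →ₗ[k] V),
      (∀ i a v, p i (ρ a v) = σ i a (p i v)) → (∀ i ∈ s, ∀ x, p i (j i x) = x) →
      (∀ i ∈ s, ∀ i' ∈ s, i ≠ i' → ∀ x, p i (j i' x) = 0) →
      (∀ v, (∀ i ∈ s, p i v = 0) → v = 0) →
      repClass (Rep.of ρ) = ∑ i ∈ s, repClass (Rep.of (σ i)) := by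
  induction s using Finset.induction with
  | empty =>
    intro V _ _ _ ρ p j _ _ _ h
    have : Subsingleton V := ⟨fun a b => by rw [h a (by simp), h b (by simp)]⟩
    rw [repClass_of_subsingleton, Finset.sum_empty]
  | insert a s ha ih =>
    intro V _ _ _ ρ p j h1 h2 h3 h4
    have hst : ∀ g, ∀ v ∈ LinearMap.ker (p a), ρ g v ∈ LinearMap.ker (p a) := fun g v hv => by
      rw [LinearMap.mem_ker] at hv ⊢
      rw [h1, hv, map_zero]
    rw [Finset.sum_insert ha, add_comm, ← ih (ρ.subrepresentation (LinearMap.ker (p a)) hst)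
      (fun i => p i ∘ₗ (LinearMap.ker (p a)).subtype)
      -- The section lands in `ker (p a)` only by orthogonality, which is known for indices in `s`;
      -- the others play no role and get `0`.
      (fun i => if h : i ∈ s then (j i).codRestrict _ fun x => h3 a (Finset.mem_insert_self a s) i
        (Finset.mem_insert_of_mem h) (fun h' => ha (h' ▸ h)) x else 0)]
    · refine repClass_of_exact (LinearMap.ker (p a)).subtype (p a) (fun _ _ => rfl) (h1 a)
        Subtype.val_injective (fun v hv => ⟨⟨v, hv⟩, rfl⟩) (fun u => u.2) fun x =>
        ⟨j a x, h2 a (Finset.mem_insert_self a s) x⟩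
    · intro i g v
      exact h1 i g v.1
    · intro i hi x
      simp only [dif_pos hi]
      exact h2 i (Finset.mem_insert_of_mem hi) x
    · intro i hi i' hi' hne x
      simp only [dif_pos hi']
      exact h3 i (Finset.mem_insert_of_mem hi) i' (Finset.mem_insert_of_mem hi') hne x
    · intro v hv
      refine Subtype.ext (h4 v.1 fun i hi => ?_)
      rcases Finset.mem_insert.1 hi with rfl | hi
      · exact v.2
      · exact hv i hi

/-- The class of a stable subspace. -/
def subClass {V : Type u} [AddCommGroup V] [Module k V] (ρ : Representation k Θ V)
    (N : Submodule k V) (h : ∀ g, ∀ v ∈ N, ρ g v ∈ N) : GrothendieckRing k Θ :=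
  repClass (Rep.of (ρ.subrepresentation N h))

end GrothendieckClasses

/-! ### Homology of complexes of representations -/

section RepHomology

variable {k Θ : Type u} [Field k] [Group Θ]

/-- A short complex of representations whose middle homology is described by an equivariant
surjection `π` from the cycles, with kernel the boundaries. -/
def Rep.leftHomologyData (S : ShortComplex (Rep.{u} k Θ)) {N H : Type u} [AddCommGroup N] [Module k N]
    [AddCommGroup H] [Module k H] (ρN : Representation k Θ N) (ρH : Representation k Θ H)
    (i : Rep.of ρN ⟶ S.X₂) (π : Rep.of ρN ⟶ Rep.of ρH)
    (hi : Function.Injective i.hom) (hπ : Function.Surjective π.hom)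
    (wi : i ≫ S.g = 0) (ex : ∀ x, S.g.hom x = 0 → ∃ n, i.hom n = x)
    (hker : ∀ n, π.hom n = 0 ↔ ∃ y, S.f.hom y = i.hom n) : S.LeftHomologyData := by
  have hg : ∀ n, S.g.hom (i.hom n) = 0 := fun n =>
    congrArg (fun f : Rep.of ρN ⟶ S.X₃ => f.hom n) wi
  have hmono : Mono i := (Rep.mono_iff_injective i).2 hi
  have hepi : Epi π := (Rep.epi_iff_surjective π).2 hπ
  have hexact : (ShortComplex.mk i S.g wi).Exact := by
    rw [← ShortComplex.exact_map_iff_of_faithful _ (forget₂ (Rep.{u} k Θ) (ModuleCat.{u} k)),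
      ShortComplex.moduleCat_exact_iff]
    intro x hx
    exact ex x hx
  let hi' := hexact.fIsKernel
  let l := hi'.lift (Limits.KernelFork.ofι S.f S.zero)
  have hl : l ≫ i = S.f := hi'.fac (Limits.KernelFork.ofι S.f S.zero) Limits.WalkingParallelPair.zero
  have hl' : ∀ y, i.hom (l.hom y) = S.f.hom y := fun y =>
    congrArg (fun f : S.X₁ ⟶ S.X₂ => f.hom y) hl
  have wπ : l ≫ π = 0 := by
    ext y
    exact (hker _).2 ⟨y, (hl' y).symm⟩
  have hexact' : (ShortComplex.mk l π wπ).Exact := by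
    rw [← ShortComplex.exact_map_iff_of_faithful _ (forget₂ (Rep.{u} k Θ) (ModuleCat.{u} k)),
      ShortComplex.moduleCat_exact_iff]
    intro x hx
    obtain ⟨y, hy⟩ := (hker x).1 hx
    exact ⟨y, hi ((hl' y).trans hy)⟩
  exact
    { K := Rep.of ρN
      H := Rep.of ρH
      i := i
      π := π
      wi := wi
      hi := hi'
      wπ := wπ
      hπ := hexact'.gIsCokernel }

/-- The isomorphism given by a bijective equivariant linear map. -/
def Rep.isoOfBijective {V W : Type u} [AddCommGroup V] [Module k V] [AddCommGroup W] [Module k W]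
    {ρ : Representation k Θ V} {σ : Representation k Θ W} (f : V →ₗ[k] W)
    (hf : ∀ g v, f (ρ g v) = σ g (f v)) (bij : Function.Bijective f) : Rep.of ρ ≅ Rep.of σ :=
  Rep.mkIso (Representation.Equiv.mk (LinearEquiv.ofBijective f bij) fun g => LinearMap.ext (hf g))

end RepHomology

/-! ### Comparison of projective resolutions modulo an ideal -/

theorem exists_dependent_seq {α : ℕ → Type*} (G : ∀ i, α i → Prop)
    (r : ∀ i, α i → α (i + 1) → Prop) (a : α 0) (h0 : G 0 a)
    (hs : ∀ i a, G i a → ∃ b, r i a b ∧ G (i + 1) b) :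
    ∃ s : ∀ i, α i, s 0 = a ∧ ∀ i, r i (s i) (s (i + 1)) := by
  choose f hf using hs
  let s : ∀ i, {x : α i // G i x} := fun i => Nat.rec (motive := fun i => {x : α i // G i x})
    ⟨a, h0⟩ (fun i x => ⟨f i x.1 x.2, (hf i x.1 x.2).2⟩) i
  exact ⟨fun i => (s i).1, rfl, fun i => (hf i (s i).1 (s i).2).1⟩

section Comparison

variable {R : Type*} [CommRing R]

theorem Module.Projective.exists_lift_of_mem_range {P A B : Type*} [AddCommGroup P] [Module R P]
    [AddCommGroup A] [Module R A] [AddCommGroup B] [Module R B] [Module.Projective R P]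
    (g : A →ₗ[R] B) (f : P →ₗ[R] B) (h : ∀ x, f x ∈ LinearMap.range g) :
    ∃ l : P →ₗ[R] A, ∀ x, g (l x) = f x := by
  obtain ⟨l, hl⟩ := Module.projective_lifting_property g.rangeRestrict
    (f.codRestrict (LinearMap.range g) h) g.surjective_rangeRestrict
  exact ⟨l, fun x => congrArg Subtype.val (LinearMap.congr_fun hl x)⟩

variable {X Y : ℕ → Type*} [∀ i, AddCommGroup (X i)] [∀ i, Module R (X i)]
  [∀ i, AddCommGroup (Y i)] [∀ i, Module R (Y i)] {N : Type*} [AddCommGroup N] [Module R N]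
  {dX : ∀ i, X (i + 1) →ₗ[R] X i} {eX : X 0 →ₗ[R] N}
  {dY : ∀ i, Y (i + 1) →ₗ[R] Y i} {eY : Y 0 →ₗ[R] N}

/-- The comparison theorem. The recursion carries the property that the current map sends boundaries
into the range of the next differential of `Y`, which is exactly what projectivity needs to lift
once more. -/
theorem exists_chainMap [∀ i, Module.Projective R (X i)] (hX : ∀ i x, dX i (dX (i + 1) x) = 0)
    (hX0 : ∀ x, eX (dX 0 x) = 0) (hY : ∀ i, Function.Exact (dY (i + 1)) (dY i))
    (hY0 : Function.Exact (dY 0) eY) (sY : Function.Surjective eY) :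
    ∃ φ : ∀ i, X i →ₗ[R] Y i, (∀ x, eY (φ 0 x) = eX x) ∧
      ∀ i x, dY i (φ (i + 1) x) = φ i (dX i x) := by
  obtain ⟨φ₀, h0⟩ := Module.Projective.exists_lift_of_mem_range eY eX fun x => sY _
  obtain ⟨φ, rfl, hφ⟩ := exists_dependent_seq (α := fun i => X i →ₗ[R] Y i)
    (fun i f => ∀ x, f (dX i x) ∈ LinearMap.range (dY i))
    (fun i f f' => ∀ x, dY i (f' x) = f (dX i x)) φ₀
    (fun x => (hY0 _).1 (by rw [h0, hX0])) fun i f hf => by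
      obtain ⟨f', hf'⟩ := Module.Projective.exists_lift_of_mem_range (dY i) (f ∘ₗ dX i) hf
      exact ⟨f', hf', fun x => (hY i _).1 (by rw [hf', LinearMap.comp_apply, hX, map_zero])⟩
  exact ⟨φ, h0, hφ⟩

/-- A chain map covering zero is null-homotopic. The recursion only has to remember that `dY ∘ h`
and `f` agree on boundaries, so that the next difference `f - h ∘ d` consists of cycles. -/
theorem exists_homotopy [∀ i, Module.Projective R (X i)] (hX : ∀ i x, dX i (dX (i + 1) x) = 0)
    (hY : ∀ i, Function.Exact (dY (i + 1)) (dY i)) (hY0 : Function.Exact (dY 0) eY)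
    (f : ∀ i, X i →ₗ[R] Y i) (hf0 : ∀ x, eY (f 0 x) = 0)
    (hf : ∀ i x, dY i (f (i + 1) x) = f i (dX i x)) :
    ∃ h : ∀ i, X i →ₗ[R] Y (i + 1), (∀ x, f 0 x = dY 0 (h 0 x)) ∧
      ∀ i x, f (i + 1) x = dY (i + 1) (h (i + 1) x) + h i (dX i x) := by
  obtain ⟨h₀, h0⟩ := Module.Projective.exists_lift_of_mem_range (dY 0) (f 0)
    fun x => (hY0 _).1 (hf0 x)
  obtain ⟨h, rfl, hh⟩ := exists_dependent_seq (α := fun i => X i →ₗ[R] Y (i + 1))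
    (fun i h => ∀ x, dY i (h (dX i x)) = f i (dX i x))
    (fun i h h' => ∀ x, f (i + 1) x = dY (i + 1) (h' x) + h (dX i x)) h₀
    (fun x => h0 _) fun i h hh => by
      obtain ⟨h', hh'⟩ := Module.Projective.exists_lift_of_mem_range (dY (i + 1))
        (f (i + 1) - h ∘ₗ dX i) fun x => (hY i _).1 (by
          rw [LinearMap.sub_apply, map_sub, hf, LinearMap.comp_apply, hh, sub_self])
      have e : ∀ x, f (i + 1) x = dY (i + 1) (h' x) + h (dX i x) := fun x => by
        rw [hh', LinearMap.sub_apply, LinearMap.comp_apply, sub_add_cancel]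
      refine ⟨h', e, fun x => ?_⟩
      rw [hh', LinearMap.sub_apply, LinearMap.comp_apply, hX, map_zero, sub_zero]
  exact ⟨h, fun x => (h0 x).symm, hh⟩

/-- The outgoing differential, which is zero in degree `0`. -/
def dFrom (dX : ∀ i, X (i + 1) →ₗ[R] X i) : ∀ i, X i →ₗ[R] X (i - 1)
  | 0 => 0
  | i + 1 => dX i

/-- The elements of `X i` that are cycles modulo `J`. -/
def cyclesMod (J : Ideal R) (dX : ∀ i, X (i + 1) →ₗ[R] X i) (i : ℕ) : Submodule R (X i) :=
  (J • (⊤ : Submodule R (X (i - 1)))).comap (dFrom dX i)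

/-- The elements of `X i` that are boundaries modulo `J`. -/
def boundariesMod (J : Ideal R) (dX : ∀ i, X (i + 1) →ₗ[R] X i) (i : ℕ) : Submodule R (X i) :=
  J • (⊤ : Submodule R (X i)) ⊔ LinearMap.range (dX i)

theorem LinearMap.map_mem_smul_top {A B : Type*} [AddCommGroup A] [Module R A] [AddCommGroup B]
    [Module R B] (J : Ideal R) (f : A →ₗ[R] B) {x : A} (hx : x ∈ J • (⊤ : Submodule R A)) :
    f x ∈ J • (⊤ : Submodule R B) := by
  have h : (J • (⊤ : Submodule R A)).map f ≤ J • ⊤ := by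
    rw [Submodule.map_smul'']
    exact Submodule.smul_mono le_rfl le_top
  exact h ⟨x, hx, rfl⟩

variable (J : Ideal R)

theorem mem_cyclesMod_zero (x : X 0) : x ∈ cyclesMod J dX 0 :=
  zero_mem (J • (⊤ : Submodule R (X 0)))

theorem mem_cyclesMod_succ {i : ℕ} {x : X (i + 1)} :
    x ∈ cyclesMod J dX (i + 1) ↔ dX i x ∈ J • (⊤ : Submodule R (X i)) := Iff.rfl

theorem map_mem_cyclesMod (φ : ∀ i, X i →ₗ[R] Y i) (hφ : ∀ i x, dY i (φ (i + 1) x) = φ i (dX i x))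
    {i : ℕ} {x : X i} (hx : x ∈ cyclesMod J dX i) : φ i x ∈ cyclesMod J dY i := by
  cases i with
  | zero => exact mem_cyclesMod_zero J _
  | succ i =>
    rw [mem_cyclesMod_succ, hφ]
    exact LinearMap.map_mem_smul_top J _ hx

theorem map_mem_boundariesMod (φ : ∀ i, X i →ₗ[R] Y i)
    (hφ : ∀ i x, dY i (φ (i + 1) x) = φ i (dX i x))
    {i : ℕ} {x : X i} (hx : x ∈ boundariesMod J dX i) : φ i x ∈ boundariesMod J dY i := by
  obtain ⟨a, ha, b, ⟨c, rfl⟩, rfl⟩ := Submodule.mem_sup.1 hx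
  rw [map_add, ← hφ]
  exact Submodule.add_mem_sup (LinearMap.map_mem_smul_top J _ ha) ⟨_, rfl⟩

theorem boundariesMod_le_cyclesMod (hX : ∀ i x, dX i (dX (i + 1) x) = 0) (i : ℕ) :
    boundariesMod J dX i ≤ cyclesMod J dX i := by
  refine sup_le (fun x hx => LinearMap.map_mem_smul_top J _ hx) ?_
  rintro _ ⟨x, rfl⟩
  cases i with
  | zero => exact mem_cyclesMod_zero J _
  | succ i =>
    rw [mem_cyclesMod_succ, hX]
    exact zero_mem _

/-- A null-homotopic map sends cycles modulo `J` to boundaries modulo `J`. -/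
theorem homotopy_mem_boundariesMod (f : ∀ i, X i →ₗ[R] Y i) (h : ∀ i, X i →ₗ[R] Y (i + 1))
    (h0 : ∀ x, f 0 x = dY 0 (h 0 x))
    (hs : ∀ i x, f (i + 1) x = dY (i + 1) (h (i + 1) x) + h i (dX i x)) {i : ℕ} {x : X i}
    (hx : x ∈ cyclesMod J dX i) : f i x ∈ boundariesMod J dY i := by
  cases i with
  | zero => exact h0 x ▸ Submodule.mem_sup_right ⟨_, rfl⟩
  | succ i =>
    rw [hs]
    exact add_mem (Submodule.mem_sup_right ⟨_, rfl⟩)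
      (Submodule.mem_sup_left (LinearMap.map_mem_smul_top J _ hx))

/-- A chain map between projective resolutions over the identity has an inverse up to homotopy. -/
theorem exists_inverse_modulo [∀ i, Module.Projective R (X i)] [∀ i, Module.Projective R (Y i)]
    (hX : ∀ i, Function.Exact (dX (i + 1)) (dX i)) (hX0 : Function.Exact (dX 0) eX)
    (sX : Function.Surjective eX)
    (hY : ∀ i, Function.Exact (dY (i + 1)) (dY i)) (hY0 : Function.Exact (dY 0) eY)
    (φ : ∀ i, X i →ₗ[R] Y i) (hφ0 : ∀ x, eY (φ 0 x) = eX x)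
    (hφ : ∀ i x, dY i (φ (i + 1) x) = φ i (dX i x)) :
    ∃ ψ : ∀ i, Y i →ₗ[R] X i, (∀ i x, dX i (ψ (i + 1) x) = ψ i (dY i x)) ∧
      (∀ i, ∀ x ∈ cyclesMod J dX i, ψ i (φ i x) - x ∈ boundariesMod J dX i) ∧
      (∀ i, ∀ y ∈ cyclesMod J dY i, φ i (ψ i y) - y ∈ boundariesMod J dY i) := by
  obtain ⟨ψ, hψ0, hψ⟩ := exists_chainMap (fun i x => (hY i).apply_apply_eq_zero x)
    (fun x => hY0.apply_apply_eq_zero x) hX hX0 sX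
  obtain ⟨h, h0, hs⟩ := exists_homotopy (fun i x => (hX i).apply_apply_eq_zero x) hX hX0
    (fun i => ψ i ∘ₗ φ i - LinearMap.id) (fun x => by simp [hψ0, hφ0])
    (fun i x => by simp [hψ, hφ])
  obtain ⟨h', h0', hs'⟩ := exists_homotopy (fun i x => (hY i).apply_apply_eq_zero x) hY hY0
    (fun i => φ i ∘ₗ ψ i - LinearMap.id) (fun x => by simp [hψ0, hφ0])
    (fun i x => by simp [hψ, hφ])
  exact ⟨ψ, hψ,
    fun i x hx => homotopy_mem_boundariesMod J (fun i => ψ i ∘ₗ φ i - LinearMap.id) h h0 hs hx,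
    fun i x hx => homotopy_mem_boundariesMod J (fun i => φ i ∘ₗ ψ i - LinearMap.id) h' h0' hs' hx⟩

/-- Vanishing of homology modulo `J` does not depend on the projective resolution. -/
theorem cyclesMod_le_boundariesMod [∀ i, Module.Projective R (X i)]
    [∀ i, Module.Projective R (Y i)]
    (hX : ∀ i, Function.Exact (dX (i + 1)) (dX i)) (hX0 : Function.Exact (dX 0) eX)
    (sX : Function.Surjective eX)
    (hY : ∀ i, Function.Exact (dY (i + 1)) (dY i)) (hY0 : Function.Exact (dY 0) eY)
    (sY : Function.Surjective eY) {i : ℕ}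
    (h : cyclesMod J dX i ≤ boundariesMod J dX i) : cyclesMod J dY i ≤ boundariesMod J dY i := by
  obtain ⟨φ, hφ0, hφ⟩ := exists_chainMap (dX := dY) (eX := eY) (dY := dX) (eY := eX)
    (fun i x => (hY i).apply_apply_eq_zero x) (fun x => hY0.apply_apply_eq_zero x) hX hX0 sX
  obtain ⟨ψ, hψ, h1, -⟩ := exists_inverse_modulo J hY hY0 sY hX hX0 φ hφ0 hφ
  intro y hy
  have := map_mem_boundariesMod J ψ hψ (h (map_mem_cyclesMod J φ hφ hy))
  rw [← sub_sub_cancel (ψ i (φ i y)) y]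
  exact sub_mem this (h1 i y hy)

/-- The terms of a minimal resolution have the smallest possible ranks. -/
theorem finrank_le_of_minimal [Nontrivial (R ⧸ J)] [∀ i, Module.Free R (X i)]
    [∀ i, Module.Free R (Y i)] [∀ i, Module.Finite R (Y i)]
    (hX : ∀ i, Function.Exact (dX (i + 1)) (dX i)) (hX0 : Function.Exact (dX 0) eX)
    (sX : Function.Surjective eX)
    (hY : ∀ i, Function.Exact (dY (i + 1)) (dY i)) (hY0 : Function.Exact (dY 0) eY)
    (sY : Function.Surjective eY)
    (hmin : ∀ i x, dX i x ∈ J • (⊤ : Submodule R (X i))) (i : ℕ) :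
    Module.finrank R (X i) ≤ Module.finrank R (Y i) := by
  have : Nontrivial R := (Ideal.Quotient.mk_surjective (I := J)).nontrivial
  obtain ⟨φ, hφ0, hφ⟩ := exists_chainMap
    (fun i x => (hX i).apply_apply_eq_zero x) (fun x => hX0.apply_apply_eq_zero x) hY hY0 sY
  obtain ⟨ψ, hψ, h1, -⟩ := exists_inverse_modulo J hX hX0 sX hY hY0 φ hφ0 hφ
  -- Minimality makes every element a cycle modulo `J` and puts all boundaries in `J X`, so `ψ ∘ φ`
  -- is the identity modulo `J`. Thus `X i` modulo `J` is a direct summand of `Y i` modulo `J`, and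
  -- ranks may be compared over `R ⧸ J`.
  have key : ∀ x, ψ i (φ i x) - x ∈ J • (⊤ : Submodule R (X i)) := fun x => by
    have hx : x ∈ cyclesMod J dX i := by
      cases i with
      | zero => exact mem_cyclesMod_zero J _
      | succ i => exact hmin i x
    refine (sup_le le_rfl ?_ : boundariesMod J dX i ≤ _) (h1 i x hx)
    rintro _ ⟨y, rfl⟩
    exact hmin i y
  have hz : ∀ x ∈ J • (⊤ : Submodule R (X i)), ∀ a : R ⧸ J, a ⊗ₜ[R] x = 0 := fun x hx a => by
    refine Submodule.smul_induction_on hx (fun r hr n _ => ?_) fun x y hx hy => ?_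
    · rw [← TensorProduct.smul_tmul, Algebra.smul_def, Ideal.Quotient.algebraMap_eq,
        Ideal.Quotient.eq_zero_iff_mem.2 hr, zero_mul, TensorProduct.zero_tmul]
    · rw [TensorProduct.tmul_add, hx, hy, add_zero]
  have hinj : Function.Injective ((φ i).baseChange (R ⧸ J)) := by
    refine Function.LeftInverse.injective (g := (ψ i).baseChange (R ⧸ J)) fun t => ?_
    induction t with
    | zero => simp
    | add x y hx hy => rw [map_add, map_add, hx, hy]
    | tmul a x =>
      rw [LinearMap.baseChange_tmul, LinearMap.baseChange_tmul, ← sub_eq_zero,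
        ← TensorProduct.tmul_sub]
      exact hz _ (key x) a
  rw [← Module.finrank_baseChange (R := R ⧸ J) (S := R) (M' := X i),
    ← Module.finrank_baseChange (R := R ⧸ J) (S := R) (M' := Y i)]
  exact LinearMap.finrank_le_finrank_of_injective hinj

end Comparison

/-- Allows the homology to be read off from any `Z` that surjects onto the cycles, without `Z` being
a subobject. In the application `Z` lives in `F_i` itself and not in its reduction modulo `R₊`. -/
theorem Rep.nonempty_homologyIso {k Θ : Type u} [Field k] [Group Θ] (S : ShortComplex (Rep.{u} k Θ))
    {Z H : Type u} [AddCommGroup Z] [Module k Z]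
    [AddCommGroup H] [Module k H] (ρZ : Representation k Θ Z) (ρH : Representation k Θ H)
    (q : Z →ₗ[k] S.X₂) (hq : ∀ g z, q (ρZ g z) = S.X₂.ρ g (q z))
    (π : Z →ₗ[k] H) (hπ : ∀ g z, π (ρZ g z) = ρH g (π z)) (surj : Function.Surjective π)
    (hcyc : ∀ z, S.g.hom (q z) = 0) (ex : ∀ x, S.g.hom x = 0 → ∃ z, q z = x)
    (hker : ∀ z, π z = 0 ↔ ∃ y, S.f.hom y = q z) : Nonempty (S.homology ≅ Rep.of ρH) := by
  have hst : ∀ g, ∀ x ∈ LinearMap.ker S.g.hom.toLinearMap,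
      S.X₂.ρ g x ∈ LinearMap.ker S.g.hom.toLinearMap := fun g x hx =>
    (Rep.hom_comm_apply S.g g x).trans ((congrArg (S.X₃.ρ g) hx).trans (map_zero _))
  let N := LinearMap.ker S.g.hom.toLinearMap
  let q' : Z →ₗ[k] N := q.codRestrict N hcyc
  obtain ⟨s, hs⟩ := q'.exists_rightInverse_of_surjective
    (LinearMap.range_eq_top.2 fun x => (ex x.1 x.2).imp fun z hz => Subtype.ext hz)
  have hs' : ∀ x, q' (s x) = x := fun x => LinearMap.congr_fun hs x
  have hπq : ∀ z z', q' z = q' z' → π z = π z' := by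
    intro z z' h
    rw [← sub_eq_zero, ← map_sub, hker]
    have : q z = q z' := congrArg Subtype.val h
    exact ⟨0, by rw [map_zero, map_sub, this, sub_self]⟩
  let ρN := S.X₂.ρ.subrepresentation N hst
  let i : Rep.of ρN ⟶ S.X₂ := Rep.ofHom (ρ := ρN) (σ := S.X₂.ρ) ⟨N.subtype, fun g => rfl⟩
  -- The section `s` is only `k`-linear, but `π ∘ s` is equivariant, because `π` depends only on the
  -- image under `q`.
  let p : Rep.of ρN ⟶ Rep.of ρH := Rep.ofHom ⟨π ∘ₗ s, fun g => by
    ext x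
    change π (s (ρN g x)) = ρH g (π (s x))
    rw [← hπ]
    refine hπq _ _ ?_
    rw [hs']
    refine Subtype.ext ?_
    change S.X₂.ρ g x.1 = q (ρZ g (s x))
    rw [hq]
    exact congrArg (S.X₂.ρ g) (congrArg Subtype.val (hs' x)).symm⟩
  refine ⟨(Rep.leftHomologyData S ρN ρH i p Subtype.val_injective ?_ ?_ ?_ ?_).homologyIso⟩
  · intro h
    obtain ⟨z, rfl⟩ := surj h
    exact ⟨q' z, hπq _ _ (hs' _)⟩
  · ext x
    exact x.2
  · exact fun x hx => ⟨⟨x, hx⟩, rfl⟩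
  · intro x
    refine (hker (s x)).trans ?_
    have : q (s x) = x.1 := congrArg Subtype.val (hs' x)
    rw [this]
    rfl

/-- Graded linear maps commute with the projections to homogeneous components. -/
theorem map_projection {k V W : Type*} [Field k] [AddCommGroup V] [Module k V] [AddCommGroup W]
    [Module k W] {gV : ℕ → Submodule k V} {gW : ℕ → Submodule k W} {p : ℕ → V →ₗ[k] V}
    {q : ℕ → W →ₗ[k] W} (f : V →ₗ[k] W) (hf : ∀ d, ∀ v ∈ gV d, f v ∈ gW d)
    (hp : ∀ j v, p j v ∈ gV j) (hsum : ∀ v, ∃ s : Finset ℕ, v = ∑ j ∈ s, p j v)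
    (p1 : ∀ j, ∀ v ∈ gV j, p j v = v) (p2 : ∀ i j, i ≠ j → ∀ v ∈ gV j, p i v = 0)
    (q1 : ∀ j, ∀ w ∈ gW j, q j w = w) (q2 : ∀ i j, i ≠ j → ∀ w ∈ gW j, q i w = 0)
    (j : ℕ) (v : V) : f (p j v) = q j (f v) := by
  classical
  obtain ⟨s, hs⟩ := hsum v
  have h : ∀ i, q j (f (p i v)) = if i = j then f (p j v) else 0 := by
    intro i
    split_ifs with hij
    · subst hij
      exact q1 _ _ (hf _ _ (hp i v))
    · exact q2 _ _ (Ne.symm hij) _ (hf _ _ (hp i v))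
  have h' : ∀ i, p j (p i v) = if i = j then p j v else 0 := by
    intro i
    split_ifs with hij
    · subst hij
      exact p1 _ _ (hp i v)
    · exact p2 _ _ (Ne.symm hij) _ (hp i v)
  conv_rhs => rw [hs, map_sum, map_sum, Finset.sum_congr rfl fun i _ => h i]
  conv_lhs => rw [hs, map_sum, Finset.sum_congr rfl fun i _ => h' i]
  rw [Finset.sum_ite_eq', Finset.sum_ite_eq']
  split_ifs <;> simp

/-! ### Graded submodules and the graded Nakayama lemma -/

namespace GradedSkewModule

variable {k R : Type u} [Field k] [CommRing R] [Algebra k R] {𝒜 : ℕ → Submodule k R}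
  {Θ : Type u} [Group Θ] [MulSemiringAction Θ R]

section Projections

variable (M : GradedSkewModule 𝒜 Θ)

/-- The projection to the homogeneous component of degree `j`. -/
def proj : ℕ → M →ₗ[k] M := (exists_projections M.isInternal).choose

theorem proj_mem (j : ℕ) (v : M) : M.proj j v ∈ M.gr j :=
  (exists_projections M.isInternal).choose_spec.1 j v

variable {M}

theorem proj_of_mem {j : ℕ} {v : M} (hv : v ∈ M.gr j) : M.proj j v = v :=
  (exists_projections M.isInternal).choose_spec.2.1 j v hv

theorem proj_of_mem_ne {i j : ℕ} (hij : i ≠ j) {v : M} (hv : v ∈ M.gr j) : M.proj i v = 0 :=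
  (exists_projections M.isInternal).choose_spec.2.2.1 i j hij v hv

theorem exists_eq_sum_proj (v : M) : ∃ s : Finset ℕ, v = ∑ j ∈ s, M.proj j v :=
  (exists_projections M.isInternal).choose_spec.2.2.2 v

theorem eq_zero_of_proj {v : M} (h : ∀ j, M.proj j v = 0) : v = 0 := by
  obtain ⟨s, hs⟩ := exists_eq_sum_proj v
  rw [hs]
  exact Finset.sum_eq_zero fun j _ => h j

theorem Hom.map_proj {M N : GradedSkewModule 𝒜 Θ} (f : Hom M N) (j : ℕ) (v : M) :
    f.toLin (M.proj j v) = N.proj j (f.toLin v) :=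
  map_projection (f.toLin.restrictScalars k) (fun _ _ hm => f.map_gr hm) M.proj_mem
    exists_eq_sum_proj (fun _ _ => proj_of_mem) (fun _ _ h _ => proj_of_mem_ne h)
    (fun _ _ => proj_of_mem) (fun _ _ h _ => proj_of_mem_ne h) j v

/-- The `R`-submodule `N` is graded. -/
def IsGradedSub (N : Submodule R M) : Prop := ∀ v ∈ N, ∀ j, M.proj j v ∈ N

theorem proj_mem_of_homogeneous {N : Submodule R M} {v : M} (hv : v ∈ N) {d : ℕ} (hd : v ∈ M.gr d)
    (j : ℕ) : M.proj j v ∈ N := by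
  by_cases h : j = d
  · subst h
    rwa [proj_of_mem hd]
  · rw [proj_of_mem_ne h hd]
    exact zero_mem _

theorem isGradedSub_top : IsGradedSub (⊤ : Submodule R M) := fun _ _ _ => trivial

theorem isGradedSub_bot : IsGradedSub (⊥ : Submodule R M) := fun v hv j => by
  rw [(Submodule.mem_bot R).1 hv, map_zero]
  exact zero_mem _

theorem IsGradedSub.sup {N N' : Submodule R M} (h : IsGradedSub N) (h' : IsGradedSub N') :
    IsGradedSub (N ⊔ N') := by
  intro v hv j
  obtain ⟨a, ha, b, hb, rfl⟩ := Submodule.mem_sup.1 hv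
  rw [map_add]
  exact Submodule.add_mem_sup (h a ha j) (h' b hb j)

theorem IsGradedSub.comap {M N : GradedSkewModule 𝒜 Θ} (f : Hom M N) {L : Submodule R N}
    (h : IsGradedSub L) : IsGradedSub (L.comap f.toLin) := fun v hv j => by
  rw [Submodule.mem_comap, f.map_proj]
  exact h _ hv j

theorem IsGradedSub.range {M N : GradedSkewModule 𝒜 Θ} (f : Hom M N) :
    IsGradedSub (LinearMap.range f.toLin) := by
  rintro _ ⟨v, rfl⟩ j
  exact ⟨M.proj j v, f.map_proj j v⟩

variable [GradedAlgebra 𝒜]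

theorem isGradedSub_smul_top (I : Ideal R) (hI : I.IsHomogeneous 𝒜) :
    IsGradedSub (I • (⊤ : Submodule R M)) := by
  classical
  intro v hv j
  refine Submodule.smul_induction_on hv ?_ ?_
  · intro r hr m _
    obtain ⟨s, hs⟩ := exists_eq_sum_proj m
    rw [hs, ← DirectSum.sum_support_decompose 𝒜 r, Finset.sum_smul, map_sum]
    refine sum_mem fun i _ => ?_
    rw [Finset.smul_sum, map_sum]
    refine sum_mem fun a _ => ?_
    exact proj_mem_of_homogeneous (Submodule.smul_mem_smul (hI i hr) Submodule.mem_top)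
      (M.smul_mem (Subtype.prop _) (M.proj_mem a m)) j
  · intro x y hx hy
    rw [map_add]
    exact add_mem hx hy

theorem isGradedSub_plus : IsGradedSub M.plus :=
  isGradedSub_smul_top _ (HomogeneousIdeal.irrelevant 𝒜).isHomogeneous

/-- Graded Nakayama lemma. -/
theorem eq_bot_of_le_plus {N : Submodule R M} (hN : IsGradedSub N)
    (h : N ≤ (HomogeneousIdeal.irrelevant 𝒜).toIdeal • N) : N = ⊥ := by
  classical
  have key : ∀ d, ∀ v ∈ N, v ∈ M.gr d → v = 0 := by
    intro d
    induction d using Nat.strong_induction_on with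
    | _ d ih =>
      intro v hv hd
      have hz : ∀ x ∈ (HomogeneousIdeal.irrelevant 𝒜).toIdeal • N, M.proj d x = 0 := by
        intro x hx
        refine Submodule.smul_induction_on hx ?_ ?_
        · intro r hr m hm
          obtain ⟨s, hs⟩ := exists_eq_sum_proj m
          rw [hs, ← DirectSum.sum_support_decompose 𝒜 r, Finset.sum_smul, map_sum]
          refine Finset.sum_eq_zero fun i _ => ?_
          rw [Finset.smul_sum, map_sum]
          refine Finset.sum_eq_zero fun a _ => ?_
          -- Elements of `R₊` have no component of degree `0`. The other components multiply
          -- elements of `N` of degree below `d`, which vanish by induction.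
          by_cases hi : i = 0
          · subst hi
            have : (DirectSum.decompose 𝒜 r 0 : R) = 0 := hr
            rw [this, zero_smul, map_zero]
          · have hmem := M.smul_mem (Subtype.prop (DirectSum.decompose 𝒜 r i)) (M.proj_mem a m)
            by_cases hd' : d = i + a
            · rw [ih a (by omega) _ (hN m hm a) (M.proj_mem a m), smul_zero, map_zero]
            · exact proj_of_mem_ne hd' hmem
        · intro x y hx hy
          rw [map_add, hx, hy, add_zero]
      rw [← proj_of_mem hd]
      exact hz v (h hv)
  rw [eq_bot_iff]
  intro v hv
  exact (Submodule.mem_bot R).2 (eq_zero_of_proj fun j => key j _ (hN v hv j) (M.proj_mem j v))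

end Projections

end GradedSkewModule

/-! ### Homology of a resolution modulo `R₊` -/

namespace GradedSkewModule

variable {k R : Type u} [Field k] [CommRing R] [Algebra k R] {𝒜 : ℕ → Submodule k R}
  {Θ : Type u} [Group Θ] [MulSemiringAction Θ R]

theorem IsGradedFree.free {M : GradedSkewModule 𝒜 Θ} (h : M.IsGradedFree) : Module.Free R M := by
  obtain ⟨ι, b, -⟩ := h
  exact Module.Free.of_basis b

namespace Resolution

variable {M : GradedSkewModule 𝒜 Θ} (P : Resolution M)

instance (i : ℕ) : Module.Free R (P.F i) := (P.free i).free

variable [GradedAlgebra 𝒜]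

/-- The cycles modulo `R₊`. -/
def cyc (i : ℕ) : Submodule R (P.F i) :=
  cyclesMod (X := fun i => P.F i) (HomogeneousIdeal.irrelevant 𝒜).toIdeal
    (fun i => (P.d i).toLin) i

/-- The boundaries modulo `R₊`. -/
def bdry (i : ℕ) : Submodule R (P.F i) :=
  boundariesMod (X := fun i => P.F i) (HomogeneousIdeal.irrelevant 𝒜).toIdeal
    (fun i => (P.d i).toLin) i

theorem mem_cyc_succ {i : ℕ} {x : P.F (i + 1)} :
    x ∈ P.cyc (i + 1) ↔ (P.d i).toLin x ∈ (P.F i).plus := Iff.rfl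

theorem mem_cyc_zero (x : P.F 0) : x ∈ P.cyc 0 := 
  mem_cyclesMod_zero (X := fun i => P.F i) _ _

theorem bdry_le_cyc (i : ℕ) : P.bdry i ≤ P.cyc i :=
  boundariesMod_le_cyclesMod (X := fun i => P.F i) _ (fun i x => (P.exact i).apply_apply_eq_zero x) i

theorem isGradedSub_cyc (i : ℕ) : IsGradedSub (P.cyc i) := by
  cases i with
  | zero => exact fun v _ j => P.mem_cyc_zero _
  | succ i => exact isGradedSub_plus.comap (P.d i)

theorem isGradedSub_bdry (i : ℕ) : IsGradedSub (P.bdry i) :=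
  isGradedSub_plus.sup (IsGradedSub.range (P.d i))

theorem mem_bdry {i : ℕ} {x : P.F i} :
    x ∈ P.bdry i ↔ ∃ y, x - (P.d i).toLin y ∈ (P.F i).plus := by
  constructor
  · intro h
    obtain ⟨a, ha, _, ⟨y, rfl⟩, rfl⟩ := Submodule.mem_sup.1 h
    exact ⟨y, by rwa [add_sub_cancel_right]⟩
  · rintro ⟨y, hy⟩
    rw [← sub_add_cancel x ((P.d i).toLin y)]
    exact Submodule.add_mem_sup hy ⟨y, rfl⟩

variable [GradedGroupAction 𝒜 Θ]

theorem ρ_mem_cyc (i : ℕ) (g : Θ) {x : P.F i} (hx : x ∈ P.cyc i) : (P.F i).ρ g x ∈ P.cyc i := by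
  cases i with
  | zero => exact P.mem_cyc_zero _
  | succ i =>
    rw [mem_cyc_succ, (P.d i).map_ρ]
    exact (P.F i).ρ_mem_plus g hx

theorem ρ_mem_bdry (i : ℕ) (g : Θ) {x : P.F i} (hx : x ∈ P.bdry i) :
    (P.F i).ρ g x ∈ P.bdry i := by
  rw [mem_bdry] at hx ⊢
  obtain ⟨y, hy⟩ := hx
  exact ⟨(P.F (i + 1)).ρ g y, by
    rw [(P.d i).map_ρ, ← map_sub]
    exact (P.F i).ρ_mem_plus g hy⟩

/-- The cycles modulo `R₊` of degree `j`. -/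
def cycPiece (i j : ℕ) : Submodule k (P.F i) := (P.cyc i).restrictScalars k ⊓ (P.F i).gr j

theorem ρ_mem_cycPiece (i j : ℕ) (g : Θ) : ∀ x ∈ P.cycPiece i j, (P.F i).ρ g x ∈ P.cycPiece i j :=
  fun _ hx => ⟨P.ρ_mem_cyc i g hx.1, (P.F i).ρ_mem g hx.2⟩

/-- The action of `Θ` on the cycles modulo `R₊` of degree `j`. -/
def cycRep (i j : ℕ) : Representation k Θ (P.cycPiece i j) :=
  (P.F i).ρ.subrepresentation (P.cycPiece i j) (P.ρ_mem_cycPiece i j)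

/-- The boundaries modulo `R₊`, inside the cycles of degree `j`. -/
def bdryPiece (i j : ℕ) : Submodule k (P.cycPiece i j) :=
  ((P.bdry i).restrictScalars k).submoduleOf (P.cycPiece i j)

/-- The homology of `P ⊗ k` in homological degree `i` and internal degree `j`. -/
def homRep (i j : ℕ) : Representation k Θ (P.cycPiece i j ⧸ P.bdryPiece i j) :=
  (P.cycRep i j).quotient (P.bdryPiece i j) fun g _ hx => P.ρ_mem_bdry i g hx

/-- Replaces the categorical homology by a quotient of submodules of `F_i`, on which chain maps and
homotopies that are merely `R`-linear can be evaluated. -/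
theorem nonempty_homologyIso (i j : ℕ) :
    Nonempty ((P.tensorComplex j).homology i ≅ Rep.of (P.homRep i j)) := by
  obtain ⟨n, hn⟩ : ∃ n, (ComplexShape.down ℕ).next i = n := ⟨_, rfl⟩
  let e := ShortComplex.homologyMapIso ((P.tensorComplex j).isoSc' (i + 1) i n
    (ChainComplex.prev ℕ i) hn)
  suffices h : Nonempty (((P.tensorComplex j).sc' (i + 1) i n).homology ≅ Rep.of (P.homRep i j)) from
    h.map fun e' => e ≪≫ e'
  have hf : ((P.tensorComplex j).sc' (i + 1) i n).f = (P.d i).tensorMap j :=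
    ChainComplex.of_d (fun i => (P.F i).tensorPiece j) (fun i => (P.d i).tensorMap j) i
  let q : P.cycPiece i j →ₗ[k] (P.F i).gr j ⧸ (P.F i).plusPiece j :=
    ((P.F i).plusPiece j).mkQ ∘ₗ Submodule.inclusion inf_le_right
  refine Rep.nonempty_homologyIso ((P.tensorComplex j).sc' (i + 1) i n) (P.cycRep i j)
    (P.homRep i j) q (fun g z => rfl) (P.bdryPiece i j).mkQ (fun g z => rfl)
    (Submodule.mkQ_surjective _) ?_ ?_ ?_
  · intro z
    cases i with
    | zero =>
      have : n = 0 := hn.symm.trans ChainComplex.next_nat_zero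
      subst this
      have hg : ((P.tensorComplex j).sc' (0 + 1) 0 0).g = 0 :=
        (P.tensorComplex j).shape 0 0 (by simp)
      rw [hg]
      rfl
    | succ i =>
      have : n = i := hn.symm.trans (ChainComplex.next_nat_succ i)
      subst this
      have hg : ((P.tensorComplex j).sc' (n + 1 + 1) (n + 1) n).g = (P.d n).tensorMap j :=
        ChainComplex.of_d (fun i => (P.F i).tensorPiece j) (fun i => (P.d i).tensorMap j) n
      rw [hg]
      exact (Submodule.Quotient.mk_eq_zero ((P.F n).plusPiece j)).2 z.2.1
  · intro x hx
    induction x using Submodule.Quotient.induction_on with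
    | H v =>
      refine ⟨⟨v.1, ?_, v.2⟩, rfl⟩
      cases i with
      | zero => exact P.mem_cyc_zero _
      | succ i =>
        have : n = i := hn.symm.trans (ChainComplex.next_nat_succ i)
        subst this
        have hg : ((P.tensorComplex j).sc' (n + 1 + 1) (n + 1) n).g = (P.d n).tensorMap j :=
          ChainComplex.of_d (fun i => (P.F i).tensorPiece j) (fun i => (P.d i).tensorMap j) n
        rw [hg] at hx
        exact (Submodule.Quotient.mk_eq_zero ((P.F n).plusPiece j)).1 hx
  · intro z
    rw [hf, Submodule.mkQ_apply, Submodule.Quotient.mk_eq_zero]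
    constructor
    · intro hz
      obtain ⟨y, hy⟩ := P.mem_bdry.1 (show z.1 ∈ P.bdry i from hz)
      -- The chain bounding `z` need not be homogeneous; since `z` has degree `j` and `R₊ F` is
      -- graded, its component of degree `j` bounds `z` as well.
      refine ⟨Submodule.Quotient.mk ⟨(P.F (i + 1)).proj j y, (P.F (i + 1)).proj_mem j y⟩, ?_⟩
      refine ((Submodule.Quotient.eq ((P.F i).plusPiece j)).2 ?_).symm
      have := isGradedSub_plus _ hy j
      rw [map_sub, proj_of_mem z.2.2, ← (P.d i).map_proj] at this
      exact this
    · rintro ⟨y, hy⟩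
      induction y using Submodule.Quotient.induction_on with
      | H y =>
        have := (Submodule.Quotient.eq ((P.F i).plusPiece j)).1 hy.symm
        exact P.mem_bdry.2 ⟨y.1, this⟩

/-- Two resolutions related by an equivariant chain map have isomorphic homology. -/
theorem nonempty_iso_of_chainMap {Q : Resolution M} (φ : ∀ i, Hom (P.F i) (Q.F i))
    (hφ0 : ∀ x, Q.ε.toLin ((φ 0).toLin x) = P.ε.toLin x)
    (hφ : ∀ i x, (Q.d i).toLin ((φ (i + 1)).toLin x) = (φ i).toLin ((P.d i).toLin x)) (i j : ℕ) :
    Nonempty (Rep.of (P.homRep i j) ≅ Rep.of (Q.homRep i j)) := by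
  set J := (HomogeneousIdeal.irrelevant 𝒜).toIdeal with hJ
  -- The inverse `ψ` need be neither graded nor equivariant: it only serves to show that the map
  -- induced by `φ`, which is both, is bijective.
  obtain ⟨ψ, hψ, h1, h2⟩ := exists_inverse_modulo J P.exact P.exact_zero P.surjective Q.exact
    Q.exact_zero (fun i => (φ i).toLin) hφ0 hφ
  have hc : ∀ x ∈ P.cycPiece i j, ((φ i).toLin.restrictScalars k) x ∈ Q.cycPiece i j := fun x hx =>
    ⟨map_mem_cyclesMod J (fun i => (φ i).toLin) hφ hx.1, (φ i).map_gr hx.2⟩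
  let f : P.cycPiece i j →ₗ[k] Q.cycPiece i j := ((φ i).toLin.restrictScalars k).restrict hc
  have hb : P.bdryPiece i j ≤ (Q.bdryPiece i j).comap f := fun x hx =>
    map_mem_boundariesMod J (fun i => (φ i).toLin) hφ hx
  let F : (P.cycPiece i j ⧸ P.bdryPiece i j) →ₗ[k] (Q.cycPiece i j ⧸ Q.bdryPiece i j) :=
    Submodule.mapQ _ _ f hb
  have hF : Function.Bijective F := by
    constructor
    · rw [injective_iff_map_eq_zero]
      intro x hx
      induction x using Submodule.Quotient.induction_on with
      | H x =>
        have hx' : (φ i).toLin x.1 ∈ Q.bdry i := (Submodule.Quotient.mk_eq_zero (Q.bdryPiece i j)).1 hx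
        refine (Submodule.Quotient.mk_eq_zero _).2 ?_
        change x.1 ∈ P.bdry i
        rw [← sub_sub_cancel (ψ i ((φ i).toLin x.1)) x.1]
        exact sub_mem (map_mem_boundariesMod J ψ hψ hx') (h1 i x.1 x.2.1)
    · intro y
      induction y using Submodule.Quotient.induction_on with
      | H y =>
        refine ⟨Submodule.Quotient.mk ⟨(P.F i).proj j (ψ i y.1),
          P.isGradedSub_cyc i _ (map_mem_cyclesMod J ψ hψ y.2.1) j, (P.F i).proj_mem j _⟩, ?_⟩
        refine (Submodule.Quotient.eq _).2 ?_
        change (φ i).toLin ((P.F i).proj j (ψ i y.1)) - y.1 ∈ Q.bdry i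
        rw [(φ i).map_proj, ← proj_of_mem y.2.2, ← map_sub, proj_of_mem y.2.2]
        exact Q.isGradedSub_bdry i _ (h2 i y.1 y.2.1) j
  refine ⟨Rep.isoOfBijective F (fun g x => ?_) hF⟩
  induction x using Submodule.Quotient.induction_on with
  | H x =>
    refine congrArg (Submodule.Quotient.mk (p := Q.bdryPiece i j)) (Subtype.ext ?_)
    exact (φ i).map_ρ g x.1

end Resolution

end GradedSkewModule

/-! ### `Tor` computed by an arbitrary equivariant resolution -/

namespace GradedSkewModule

variable {k R : Type u} [Field k] [CommRing R] [Algebra k R] {𝒜 : ℕ → Submodule k R}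
  {Θ : Type u} [Group Θ] [MulSemiringAction Θ R] [GradedAlgebra 𝒜] [SMulCommClass Θ k R]
  [GradedGroupAction 𝒜 Θ]

/-- The morphism from the free cover determined by the images of the generators. -/
def freeCoverLift {M A : GradedSkewModule 𝒜 Θ} (a : ∀ x : M.Homog, A.gr x.1) :
    Hom M.freeCover A where
  toLin := Finsupp.linearCombination R fun x : Θ × M.Homog => A.ρ x.1 (a x.2).1
  map_gr := by
    intro d f hf
    change (Θ × M.Homog) →₀ R at f
    change Finsupp.linearCombination R (fun x : Θ × M.Homog => A.ρ x.1 (a x.2).1) f ∈ A.gr d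
    rw [Finsupp.linearCombination_apply]
    refine sum_mem fun x _ => ?_
    have hx : f x ∈ shift 𝒜 x.2.1 d := hf x
    unfold shift at hx
    split_ifs at hx with h
    · have := A.smul_mem hx (A.ρ_mem x.1 (a x.2).2)
      rwa [Nat.sub_add_cancel h] at this
    · dsimp only
      rw [(Submodule.mem_bot k).1 hx, zero_smul]
      exact zero_mem _
  map_ρ := by
    intro g f
    change Finsupp.linearCombination R (fun x : Θ × M.Homog => A.ρ x.1 (a x.2).1)
        (M.freeCoverRep g f) =
      A.ρ g (Finsupp.linearCombination R (fun x : Θ × M.Homog => A.ρ x.1 (a x.2).1) f)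
    change (Θ × M.Homog) →₀ R at f
    induction f using Finsupp.induction_linear with
    | zero => simp
    | add f g hf hg => simp only [map_add, hf, hg]
    | single x r =>
      rw [freeCoverRep_single, Finsupp.linearCombination_single, Finsupp.linearCombination_single,
        A.ρ_smul, map_mul]
      rfl

/-- Free covers have the lifting property of projective objects. -/
theorem exists_freeCover_lift {M A B : GradedSkewModule 𝒜 Θ} (π : Hom A B) (f : Hom M.freeCover B)
    (h : ∀ x, ∃ y, π.toLin y = f.toLin x) :
    ∃ l : Hom M.freeCover A, ∀ x, π.toLin (l.toLin x) = f.toLin x := by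
  let e : Θ × M.Homog → M.freeCover := fun x => (Finsupp.single x (1 : R) : (Θ × M.Homog) →₀ R)
  have he : ∀ x : M.Homog, e (1, x) ∈ M.freeCover.gr x.1 := fun x => by
    have := mem_shift_add (𝒜 := 𝒜) (a := x.1) (SetLike.one_mem_graded 𝒜)
    rw [zero_add] at this
    exact M.single_mem_freeCoverGr (x := ((1 : Θ), x)) this
  -- A lift is chosen only for the generators `t_1 e_x`, and is made homogeneous by taking its
  -- component in the degree of `x`. Equivariance then forces its value on `t_g e_x`.
  have h' : ∀ x : M.Homog, ∃ y : A.gr x.1, π.toLin y.1 = f.toLin (e (1, x)) := fun x => by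
    obtain ⟨y, hy⟩ := h (e (1, x))
    refine ⟨⟨A.proj x.1 y, A.proj_mem _ _⟩, ?_⟩
    rw [π.map_proj, hy, proj_of_mem (f.map_gr (he x))]
  choose a ha using h'
  refine ⟨freeCoverLift a, fun v => ?_⟩
  change (Θ × M.Homog) →₀ R at v
  induction v using Finsupp.induction_linear with
  | zero => exact (map_zero (π.toLin ∘ₗ (freeCoverLift a).toLin)).trans (map_zero f.toLin).symm
  | add v w hv hw =>
    exact (map_add (π.toLin ∘ₗ (freeCoverLift a).toLin) v w).trans
      ((congrArg₂ (· + ·) hv hw).trans (map_add f.toLin v w).symm)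
  | single x r =>
    have hr : (Finsupp.single x r : (Θ × M.Homog) →₀ R) = r • Finsupp.single x (1 : R) := by simp
    have hx : e x = M.freeCover.ρ x.1 (e (1, x.2)) := by
      change _ = M.freeCoverRep x.1 (Finsupp.single (1, x.2) 1)
      rw [freeCoverRep_single, smul_one, mul_one]
    have hl : (freeCoverLift a).toLin (e x) = A.ρ x.1 (a x.2).1 := by
      change Finsupp.linearCombination R (fun x : Θ × M.Homog => A.ρ x.1 (a x.2).1)
        (Finsupp.single x 1) = _
      rw [Finsupp.linearCombination_single, one_smul]
    have h1 : π.toLin ((freeCoverLift a).toLin (e x)) = f.toLin (e x) := by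
      rw [hl, π.map_ρ, ha, hx, f.map_ρ]
    rw [hr]
    refine ((π.toLin ∘ₗ (freeCoverLift a).toLin).map_smul r (e x)).trans ?_
    refine Eq.trans ?_ (f.toLin.map_smul r (e x)).symm
    exact congrArg (r • ·) h1

variable {M : GradedSkewModule 𝒜 Θ}

theorem exists_stdResolution_hom (P : Resolution M) :
    ∃ φ : ∀ i, Hom (M.stdResolution.F i) (P.F i),
      (∀ x, P.ε.toLin ((φ 0).toLin x) = M.stdResolution.ε.toLin x) ∧
      ∀ i x, (P.d i).toLin ((φ (i + 1)).toLin x) =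
        (φ i).toLin ((M.stdResolution.d i).toLin x) := by
  obtain ⟨φ₀, h0⟩ : ∃ φ : Hom (M.stdResolution.F 0) (P.F 0),
      ∀ x, P.ε.toLin (φ.toLin x) = M.stdResolution.ε.toLin x :=
    exists_freeCover_lift P.ε _ fun x => P.surjective _
  obtain ⟨φ, rfl, hφ⟩ := exists_dependent_seq (α := fun i => Hom (M.stdResolution.F i) (P.F i))
    (fun i f => ∀ x, ∃ y, (P.d i).toLin y = f.toLin ((M.stdResolution.d i).toLin x))
    (fun i f f' => ∀ x, (P.d i).toLin (f'.toLin x) = f.toLin ((M.stdResolution.d i).toLin x)) φ₀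
    (fun x => (P.exact_zero _).1 (by
      rw [h0, M.stdResolution.exact_zero.apply_apply_eq_zero])) fun i f hf => by
      obtain ⟨f', hf'⟩ : ∃ f' : Hom (M.stdResolution.F (i + 1)) (P.F (i + 1)),
          ∀ x, (P.d i).toLin (f'.toLin x) = (f.comp (M.stdResolution.d i)).toLin x :=
        exists_freeCover_lift (P.d i) _ hf
      refine ⟨f', hf', fun x => (P.exact i _).1 ?_⟩
      rw [hf']
      change f.toLin ((M.stdResolution.d i).toLin ((M.stdResolution.d (i + 1)).toLin x)) = 0
      rw [(M.stdResolution.exact i).apply_apply_eq_zero, map_zero]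
  exact ⟨φ, h0, hφ⟩

/-- `Tor` can be computed by any equivariant graded free resolution. -/
theorem nonempty_tor_iso (P : Resolution M) (i j : ℕ) :
    Nonempty (M.tor i j ≅ Rep.of (P.homRep i j)) := by
  obtain ⟨φ, h0, h⟩ := exists_stdResolution_hom P
  obtain ⟨e⟩ := M.stdResolution.nonempty_homologyIso i j
  obtain ⟨e'⟩ := M.stdResolution.nonempty_iso_of_chainMap φ h0 h i j
  exact ⟨e ≪≫ e'⟩

theorem repClass_tor (P : Resolution M) (i j : ℕ) :
    repClass (M.tor i j) = repClass (Rep.of (P.homRep i j)) :=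
  repClass_eq_of_iso (nonempty_tor_iso P i j).some

theorem nontrivial_tor_iff (P : Resolution M) (i j : ℕ) :
    Nontrivial (M.tor i j) ↔ ¬ P.cycPiece i j ≤ (P.bdry i).restrictScalars k := by
  rw [(Representation.equivOfIso (nonempty_tor_iso P i j).some).toLinearEquiv.toEquiv.nontrivial_congr]
  rw [Submodule.Quotient.nontrivial_iff, Ne, Resolution.bdryPiece, Submodule.submoduleOf,
    Submodule.comap_subtype_eq_top]

theorem finite_tor (P : Resolution M) (i j : ℕ) (h : Module.Finite k ((P.F i).gr j)) :
    Module.Finite k (M.tor i j) := by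
  have h' : Module.Finite k (P.cycPiece i j) :=
    Module.Finite.of_injective (Submodule.inclusion inf_le_right :
      P.cycPiece i j →ₗ[k] (P.F i).gr j) (Submodule.inclusion_injective _)
  exact Module.Finite.equiv
    (Representation.equivOfIso (nonempty_tor_iso P i j).some).toLinearEquiv.symm

end GradedSkewModule

open scoped TensorProduct

/-! ### The augmentation of a connected algebra -/

section Augmentation

variable {k R : Type u} [Field k] [CommRing R] [Nontrivial R] [Algebra k R]
  {𝒜 : ℕ → Submodule k R} [GradedAlgebra 𝒜]

theorem exists_augmentation (hconnected : 𝒜 0 = 1) : ∃ ε : R →ₗ[k] k,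
    (∀ c, ε (algebraMap k R c) = c) ∧ (∀ i ≠ 0, ∀ r ∈ 𝒜 i, ε r = 0) ∧
    (∀ r ∈ 𝒜 0, r = algebraMap k R (ε r)) ∧
    (∀ r ∈ (HomogeneousIdeal.irrelevant 𝒜).toIdeal, ε r = 0) ∧
    ∀ r, r - algebraMap k R (ε r) ∈ (HomogeneousIdeal.irrelevant 𝒜).toIdeal := by
  have inj : Function.Injective (Algebra.linearMap k R) := (algebraMap k R).injective
  let p0 : R →ₗ[k] R := GradedAlgebra.proj 𝒜 0
  have hp0 : ∀ r, p0 r ∈ LinearMap.range (Algebra.linearMap k R) := fun r => by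
    have h : p0 r ∈ 𝒜 0 := SetLike.coe_mem _
    rwa [hconnected, Submodule.one_eq_range] at h
  let ε : R →ₗ[k] k := (LinearEquiv.ofInjective (Algebra.linearMap k R) inj).symm.toLinearMap ∘ₗ
    p0.codRestrict _ hp0
  have hε : ∀ r, algebraMap k R (ε r) = p0 r := fun r =>
    congrArg Subtype.val ((LinearEquiv.ofInjective (Algebra.linearMap k R) inj).apply_symm_apply
      (p0.codRestrict _ hp0 r))
  have h0 : ∀ r ∈ 𝒜 0, p0 r = r := fun r hr => DirectSum.decompose_of_mem_same 𝒜 hr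
  have hc : ∀ c, algebraMap k R c ∈ 𝒜 0 := fun c => SetLike.algebraMap_mem_graded 𝒜 c
  have hirr : ∀ r ∈ (HomogeneousIdeal.irrelevant 𝒜).toIdeal, ε r = 0 := fun r hr => inj <| by
    rw [map_zero]
    exact (hε r).trans hr
  refine ⟨ε, fun c => inj ((hε _).trans (h0 _ (hc c))), ?_, fun r hr => ((hε r).trans (h0 r hr)).symm,
    hirr, fun r => ?_⟩
  · intro i hi r hr
    refine hirr r ?_
    exact DirectSum.decompose_of_mem_ne 𝒜 hr hi
  · change p0 (r - algebraMap k R (ε r)) = 0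
    rw [map_sub, h0 _ (hc _), hε, sub_self]

end Augmentation

/-! ### Generators and induced modules -/

namespace GradedSkewModule

variable {k R : Type u} [Field k] [CommRing R] [Algebra k R] {𝒜 : ℕ → Submodule k R}
  {Θ : Type u} [Group Θ] [MulSemiringAction Θ R] [GradedAlgebra 𝒜]

section Nakayama

variable {M : GradedSkewModule 𝒜 Θ}

/-- Nakayama in its generating form. Induction on the degree replaces finite generation: a
homogeneous element of `R₊ M` is a combination of elements of lower degree. -/
theorem eq_top_of_sup_plus {N : Submodule R M} (hN : IsGradedSub N) (h : ⊤ ≤ N ⊔ M.plus) :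
    N = ⊤ := by
  classical
  have key : ∀ d, ∀ v ∈ M.gr d, v ∈ N := by
    intro d
    induction d using Nat.strong_induction_on with
    | _ d ih =>
      intro v hd
      have hz : ∀ x ∈ M.plus, M.proj d x ∈ N := by
        intro x hx
        refine Submodule.smul_induction_on hx ?_ ?_
        · intro r hr m _
          obtain ⟨s, hs⟩ := exists_eq_sum_proj m
          rw [hs, ← DirectSum.sum_support_decompose 𝒜 r, Finset.sum_smul, map_sum]
          refine sum_mem fun i _ => ?_
          rw [Finset.smul_sum, map_sum]
          refine sum_mem fun a _ => ?_
          by_cases hi : i = 0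
          · subst hi
            have : (DirectSum.decompose 𝒜 r 0 : R) = 0 := hr
            rw [this, zero_smul, map_zero]
            exact zero_mem _
          · have hmem := M.smul_mem (Subtype.prop (DirectSum.decompose 𝒜 r i)) (M.proj_mem a m)
            by_cases hd' : d = i + a
            · exact proj_mem_of_homogeneous
                (N.smul_mem _ (ih a (by omega) _ (M.proj_mem a m))) hmem d
            · rw [proj_of_mem_ne hd' hmem]
              exact zero_mem _
        · intro x y hx hy
          rw [map_add]
          exact add_mem hx hy
      obtain ⟨n, hn, p, hp, hv⟩ := Submodule.mem_sup.1 (h (Submodule.mem_top (x := v)))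
      rw [← proj_of_mem hd, ← hv, map_add]
      exact add_mem (hN n hn d) (hz p hp)
  rw [eq_top_iff]
  intro v _
  obtain ⟨s, hs⟩ := exists_eq_sum_proj v
  rw [hs]
  exact sum_mem fun j _ => key j _ (M.proj_mem j v)

/-- Only the component of `r` in `R_0 = k` contributes to degree `d`. This turns finite generation
over `R` into finite dimension of each component. -/
theorem proj_smul_mem_span (hconnected : 𝒜 0 = 1) {d : ℕ} {x : M} (hx : x ∈ M.gr d) (r : R) :
    M.proj d (r • x) ∈ Submodule.span k {x} := by
  induction r using DirectSum.Decomposition.inductionOn 𝒜 with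
  | zero => rw [zero_smul, map_zero]; exact zero_mem _
  | @homogeneous i r =>
    have h := M.smul_mem r.2 hx
    by_cases hi : i = 0
    · subst hi
      rw [zero_add] at h
      rw [proj_of_mem h]
      have hr : (r : R) ∈ 𝒜 0 := r.2
      obtain ⟨c, hc⟩ := Submodule.mem_one.1 (hconnected.le hr)
      rw [← hc, algebraMap_smul]
      exact Submodule.smul_mem _ _ (Submodule.mem_span_singleton_self x)
    · rw [proj_of_mem_ne (by omega) h]
      exact zero_mem _
  | add a b ha hb => rw [add_smul, map_add]; exact add_mem ha hb

/-- The homogeneous components of a finitely generated module are finite-dimensional. -/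
theorem finite_gr [IsNoetherianRing R] (hconnected : 𝒜 0 = 1) [Module.Finite R M] (d : ℕ) :
    Module.Finite k (M.gr d) := by
  have hfg : (Submodule.span R (M.gr d : Set M)).FG := IsNoetherian.noetherian _
  obtain ⟨t, ht, hspan⟩ := (Submodule.fg_span_iff_fg_span_finset_subset _).1 hfg
  have hle : M.gr d ≤ Submodule.span k (t : Set M) := by
    intro v hv
    have h : v ∈ Submodule.span R (t : Set M) := hspan ▸ Submodule.subset_span hv
    obtain ⟨c, -, hc⟩ := Submodule.mem_span_finset.1 h
    rw [← proj_of_mem hv, ← hc, map_sum]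
    refine sum_mem fun x hx => ?_
    exact Submodule.span_mono (Set.singleton_subset_iff.2 hx)
      (proj_smul_mem_span hconnected (ht hx) (c x))
  have := Module.Finite.span_finset k t
  exact Module.Finite.of_injective (Submodule.inclusion hle) (Submodule.inclusion_injective _)

end Nakayama

section Induced

/-- A graded representation of `Θ`. -/
structure GradedRep (k Θ : Type u) [Field k] [Group Θ] where
  carrier : Type u
  [addCommGroup : AddCommGroup carrier]
  [module : Module k carrier]
  ρ : Representation k Θ carrier
  gr : ℕ → Submodule k carrier
  isInternal : DirectSum.IsInternal gr
  ρ_mem : ∀ (g : Θ) (d : ℕ), ∀ m ∈ gr d, ρ g m ∈ gr d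

attribute [instance] GradedRep.addCommGroup GradedRep.module

variable (𝒜) (V : GradedRep k Θ)

/-- The component of degree `n` of `R ⊗ V`. -/
def inducedGr (n : ℕ) : Submodule k (R ⊗[k] V.carrier) :=
  Submodule.span k {x | ∃ i a r v, i + a = n ∧ r ∈ 𝒜 i ∧ v ∈ V.gr a ∧ x = r ⊗ₜ[k] v}

variable {𝒜 V} in
theorem tmul_mem_inducedGr {i a : ℕ} {r : R} {v : V.carrier} (hr : r ∈ 𝒜 i) (hv : v ∈ V.gr a) :
    r ⊗ₜ[k] v ∈ inducedGr 𝒜 V (i + a) :=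
  Submodule.subset_span ⟨i, a, r, v, rfl, hr, hv, rfl⟩

/-- The projection of `V` to its component of degree `j`. -/
def GradedRep.proj (V : GradedRep k Θ) : ℕ → V.carrier →ₗ[k] V.carrier :=
  (exists_projections V.isInternal).choose

theorem GradedRep.proj_mem (j : ℕ) (v : V.carrier) : V.proj j v ∈ V.gr j :=
  (exists_projections V.isInternal).choose_spec.1 j v

variable {V} in
theorem GradedRep.proj_of_mem {j : ℕ} {v : V.carrier} (hv : v ∈ V.gr j) : V.proj j v = v :=
  (exists_projections V.isInternal).choose_spec.2.1 j v hv

variable {V} in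
theorem GradedRep.proj_of_mem_ne {i j : ℕ} (hij : i ≠ j) {v : V.carrier} (hv : v ∈ V.gr j) :
    V.proj i v = 0 :=
  (exists_projections V.isInternal).choose_spec.2.2.1 i j hij v hv

variable {V} in
theorem GradedRep.exists_eq_sum_proj (v : V.carrier) : ∃ s : Finset ℕ, v = ∑ j ∈ s, V.proj j v :=
  (exists_projections V.isInternal).choose_spec.2.2.2 v

theorem GradedRep.ρ_proj (g : Θ) (j : ℕ) (v : V.carrier) :
    V.ρ g (V.proj j v) = V.proj j (V.ρ g v) :=
  map_projection (V.ρ g) (V.ρ_mem g) V.proj_mem exists_eq_sum_proj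
    (fun _ _ => proj_of_mem) (fun _ _ h _ => proj_of_mem_ne h)
    (fun _ _ => proj_of_mem) (fun _ _ h _ => proj_of_mem_ne h) j v

/-- The projection of `R ⊗ V` to `R_i ⊗ V_a`. -/
def inducedProj (x : ℕ × ℕ) : R ⊗[k] V.carrier →ₗ[k] R ⊗[k] V.carrier :=
  TensorProduct.map (GradedAlgebra.proj 𝒜 x.1) (V.proj x.2)

variable {𝒜 V} in
theorem inducedProj_tmul {i a : ℕ} (x : ℕ × ℕ) {r : R} (hr : r ∈ 𝒜 i) {v : V.carrier}
    (hv : v ∈ V.gr a) :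
    inducedProj 𝒜 V x (r ⊗ₜ v) = if x = (i, a) then r ⊗ₜ v else 0 := by
  rw [inducedProj, TensorProduct.map_tmul]
  split_ifs with h
  · subst h
    rw [show GradedAlgebra.proj 𝒜 i r = r from DirectSum.decompose_of_mem_same 𝒜 hr,
      GradedRep.proj_of_mem hv]
  · by_cases hi : i = x.1
    · have : x.2 ≠ a := fun h' => h (Prod.ext hi.symm h')
      rw [GradedRep.proj_of_mem_ne this hv, TensorProduct.tmul_zero]
    · rw [show GradedAlgebra.proj 𝒜 x.1 r = 0 from DirectSum.decompose_of_mem_ne 𝒜 hr hi,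
        TensorProduct.zero_tmul]

variable {𝒜 V} in
theorem sum_inducedProj {n : ℕ} {x : R ⊗[k] V.carrier} (h : x ∈ inducedGr 𝒜 V n) :
    ∑ y ∈ Finset.HasAntidiagonal.antidiagonal n, inducedProj 𝒜 V y x = x := by
  classical
  induction h using Submodule.span_induction with
  | mem x h =>
    obtain ⟨i, a, r, v, rfl, hr, hv, rfl⟩ := h
    rw [Finset.sum_congr rfl fun x _ => inducedProj_tmul x hr hv,
      Finset.sum_ite_eq', if_pos (by simp)]
  | zero => simp
  | add x y _ _ hx hy =>
    conv_rhs => rw [← hx, ← hy]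
    rw [← Finset.sum_add_distrib]
    exact Finset.sum_congr rfl fun _ _ => map_add _ _ _
  | smul c x _ hx =>
    conv_rhs => rw [← hx]
    rw [Finset.smul_sum]
    exact Finset.sum_congr rfl fun _ _ => map_smul _ _ _

theorem inducedGr_isInternal : DirectSum.IsInternal (inducedGr 𝒜 V) := by
  classical
  refine isInternal_of_projections _
    (fun n => ∑ x ∈ Finset.HasAntidiagonal.antidiagonal n, inducedProj 𝒜 V x) ?_ ?_ ?_
  · intro n x h
    rw [LinearMap.sum_apply]
    exact sum_inducedProj h
  · intro m n hmn x h
    induction h using Submodule.span_induction with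
    | mem x h =>
      obtain ⟨i, a, r, v, rfl, hr, hv, rfl⟩ := h
      rw [LinearMap.sum_apply, Finset.sum_congr rfl fun x _ => inducedProj_tmul x hr hv,
        Finset.sum_ite_eq', if_neg fun h => hmn (Finset.HasAntidiagonal.mem_antidiagonal.1 h).symm]
    | zero => rw [map_zero]
    | add x y _ _ hx hy => rw [map_add, hx, hy, add_zero]
    | smul c x _ hx => rw [map_smul, hx, smul_zero]
  · intro x
    induction x with
    | zero => exact zero_mem _
    | add x y hx hy => exact add_mem hx hy
    | tmul r v =>
      obtain ⟨s, hs⟩ := GradedRep.exists_eq_sum_proj v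
      rw [hs, ← DirectSum.sum_support_decompose 𝒜 r, TensorProduct.sum_tmul]
      refine sum_mem fun i _ => ?_
      rw [TensorProduct.tmul_sum]
      refine sum_mem fun a _ => ?_
      exact Submodule.mem_iSup_of_mem (i + a) (tmul_mem_inducedGr (Subtype.prop _) (V.proj_mem a v))

variable [SMulCommClass Θ k R] [GradedGroupAction 𝒜 Θ]

/-- The graded free `R ⋊ Θ`-module `R ⊗ V`. -/
def induced : GradedSkewModule 𝒜 Θ where
  carrier := R ⊗[k] V.carrier
  ρ := (Representation.ofDistribMulAction k Θ R).tprod V.ρ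
  gr := inducedGr 𝒜 V
  isInternal := inducedGr_isInternal 𝒜 V
  smul_mem := by
    intro i j r m hr hm
    induction hm using Submodule.span_induction with
    | mem x h =>
      obtain ⟨i', a, s, v, rfl, hs, hv, rfl⟩ := h
      rw [TensorProduct.smul_tmul', ← add_assoc]
      exact tmul_mem_inducedGr (SetLike.mul_mem_graded hr hs) hv
    | zero => rw [smul_zero]; exact zero_mem _
    | add x y _ _ hx hy => rw [smul_add]; exact add_mem hx hy
    | smul c x _ hx => rw [smul_comm]; exact Submodule.smul_mem _ _ hx
  ρ_smul g r m := by
    induction m with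
    | zero => simp
    | add x y hx hy => rw [smul_add, map_add, map_add, smul_add, hx, hy]
    | tmul s v =>
      rw [TensorProduct.smul_tmul']
      simp only [Representation.tprod_apply, TensorProduct.map_tmul, TensorProduct.smul_tmul']
      congr 1
      exact smul_mul' g r s
  ρ_mem := by
    intro g d m hm
    induction hm using Submodule.span_induction with
    | mem x h =>
      obtain ⟨i, a, r, v, rfl, hr, hv, rfl⟩ := h
      exact tmul_mem_inducedGr (GradedGroupAction.smul_mem g hr) (V.ρ_mem g a v hv)
    | zero => rw [map_zero]; exact zero_mem _
    | add x y _ _ hx hy => rw [map_add]; exact add_mem hx hy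
    | smul c x _ hx => rw [map_smul]; exact Submodule.smul_mem _ _ hx

theorem induced_finite [Module.Finite k V.carrier] : Module.Finite R (induced 𝒜 V) :=
  inferInstanceAs (Module.Finite R (R ⊗[k] V.carrier))

theorem induced_isGradedFree : (induced 𝒜 V).IsGradedFree := by
  classical
  let b := V.isInternal.collectedBasis fun d => Module.Basis.ofVectorSpace k (V.gr d)
  have hb : ∀ i, b i ∈ V.gr i.1 := V.isInternal.collectedBasis_mem _
  let e := Module.Basis.baseChange R b
  refine ⟨_, e, fun i => ⟨i.1, ?_⟩⟩
  change e i ∈ inducedGr 𝒜 V i.1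
  rw [Module.Basis.baseChange_apply]
  have := tmul_mem_inducedGr (SetLike.one_mem_graded 𝒜) (hb i)
  rwa [zero_add] at this

variable {𝒜 V}

theorem induced_gr_eq_bot {d : ℕ} (h : ∀ b ≤ d, V.gr b = ⊥) : (induced 𝒜 V).gr d = ⊥ := by
  change inducedGr 𝒜 V d = ⊥
  rw [inducedGr, Submodule.span_eq_bot]
  rintro _ ⟨i, a, r, v, rfl, hr, hv, rfl⟩
  rw [h a (Nat.le_add_left a i)] at hv
  rw [(Submodule.mem_bot k).1 hv, TensorProduct.tmul_zero]

theorem liftBaseChange_mem_gr {M : GradedSkewModule 𝒜 Θ} (τ : V.carrier →ₗ[k] M)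
    (hτ : ∀ d, ∀ v ∈ V.gr d, τ v ∈ M.gr d) {d : ℕ} {m : R ⊗[k] V.carrier}
    (hm : m ∈ inducedGr 𝒜 V d) : LinearMap.liftBaseChange R τ m ∈ M.gr d := by
  induction hm using Submodule.span_induction with
  | mem x h =>
    obtain ⟨i, a, r, v, rfl, hr, hv, rfl⟩ := h
    rw [LinearMap.liftBaseChange_tmul]
    exact M.smul_mem hr (hτ a v hv)
  | zero => rw [map_zero]; exact zero_mem _
  | add x y _ _ hx hy => rw [map_add]; exact add_mem hx hy
  | smul c x _ hx =>
    rw [LinearMap.map_smul_of_tower]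
    exact Submodule.smul_mem _ _ hx

theorem liftBaseChange_ρ {M : GradedSkewModule 𝒜 Θ} (τ : V.carrier →ₗ[k] M)
    (hρ : ∀ g v, τ (V.ρ g v) = M.ρ g (τ v)) (g : Θ) (m : R ⊗[k] V.carrier) :
    LinearMap.liftBaseChange R τ ((Representation.ofDistribMulAction k Θ R).tprod V.ρ g m) =
      M.ρ g (LinearMap.liftBaseChange R τ m) := by
  rw [Representation.tprod_apply]
  induction m with
  | zero => simp
  | add x y hx hy => simp only [map_add, hx, hy]
  | tmul s v =>
    rw [TensorProduct.map_tmul, LinearMap.liftBaseChange_tmul, LinearMap.liftBaseChange_tmul, hρ,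
      M.ρ_smul]
    rfl

/-- The morphism `R ⊗ V → M` given by a graded equivariant map `V → M`. -/
def inducedHom {M : GradedSkewModule 𝒜 Θ} (τ : V.carrier →ₗ[k] M)
    (hτ : ∀ d, ∀ v ∈ V.gr d, τ v ∈ M.gr d) (hρ : ∀ g v, τ (V.ρ g v) = M.ρ g (τ v)) :
    Hom (induced 𝒜 V) M where
  toLin := (LinearMap.liftBaseChange R τ : R ⊗[k] V.carrier →ₗ[R] M)
  map_gr hm := liftBaseChange_mem_gr τ hτ hm
  map_ρ g m := liftBaseChange_ρ τ hρ g m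

end Induced

end GradedSkewModule

open scoped TensorProduct

namespace GradedSkewModule

variable {k R : Type u} [Field k] [CommRing R] [Algebra k R] {𝒜 : ℕ → Submodule k R}
  {Θ : Type u} [Group Θ] [MulSemiringAction Θ R] [GradedAlgebra 𝒜] [SMulCommClass Θ k R]
  [GradedGroupAction 𝒜 Θ] {V : GradedRep k Θ}

/-- The map is `ε ⊗ id` for the augmentation `ε : R → k`; it identifies `R ⊗ V` modulo `R₊` with
`V`. The last clause holds because positive-degree factors from `R` would need elements of `V` below
its lowest degree; it makes covers injective in lowest degree. -/
theorem exists_tensorAug [Nontrivial R] (hconnected : 𝒜 0 = 1) (V : GradedRep k Θ) :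
    ∃ E : R ⊗[k] V.carrier →ₗ[k] V.carrier, (∀ v, E (1 ⊗ₜ v) = v) ∧
      (∀ x ∈ (HomogeneousIdeal.irrelevant 𝒜).toIdeal • (⊤ : Submodule R (R ⊗[k] V.carrier)),
        E x = 0) ∧
      (∀ x, x - 1 ⊗ₜ E x ∈
        (HomogeneousIdeal.irrelevant 𝒜).toIdeal • (⊤ : Submodule R (R ⊗[k] V.carrier))) ∧
      (∀ d, ∀ x ∈ inducedGr 𝒜 V d, E x ∈ V.gr d) ∧
      ∀ d, (∀ b < d, V.gr b = ⊥) → ∀ x ∈ inducedGr 𝒜 V d, x = 1 ⊗ₜ E x := by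
  obtain ⟨ε, h1, h2, h3, h4, h5⟩ := exists_augmentation hconnected
  let E : R ⊗[k] V.carrier →ₗ[k] V.carrier :=
    (TensorProduct.lid k V.carrier).toLinearMap ∘ₗ TensorProduct.map ε LinearMap.id
  have hE : ∀ r v, E (r ⊗ₜ v) = ε r • v := fun r v => by simp [E]
  refine ⟨E, ?_, ?_, ?_, ?_, ?_⟩
  · intro v
    rw [hE, ← map_one (algebraMap k R), h1, one_smul]
  · intro x hx
    refine Submodule.smul_induction_on hx (fun r hr n _ => ?_) fun x y hx hy => ?_
    · clear * - hr h4 hE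
      induction n with
      | zero => simp
      | add x y hx hy => rw [smul_add, map_add, hx, hy, add_zero]
      | tmul s v =>
        rw [TensorProduct.smul_tmul', hE, smul_eq_mul, h4 _ (Ideal.mul_mem_right _ _ hr), zero_smul]
    · rw [map_add, hx, hy, add_zero]
  · intro x
    induction x with
    | zero => rw [map_zero, TensorProduct.tmul_zero, sub_zero]; exact zero_mem _
    | add x y hx hy =>
      rw [map_add, TensorProduct.tmul_add, add_sub_add_comm]
      exact add_mem hx hy
    | tmul r v =>
      have : (r ⊗ₜ v - 1 ⊗ₜ E (r ⊗ₜ v) : R ⊗[k] V.carrier) =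
          (r - algebraMap k R (ε r)) • ((1 : R) ⊗ₜ[k] v) := by
        rw [hE, TensorProduct.tmul_smul, TensorProduct.smul_tmul', TensorProduct.smul_tmul',
          ← TensorProduct.sub_tmul, smul_eq_mul, mul_one, Algebra.algebraMap_eq_smul_one]
      rw [this]
      exact Submodule.smul_mem_smul (h5 r) Submodule.mem_top
  · intro d x hx
    induction hx using Submodule.span_induction with
    | mem x h =>
      obtain ⟨i, a, r, v, rfl, hr, hv, rfl⟩ := h
      rw [hE]
      by_cases hi : i = 0
      · subst hi
        rw [zero_add]
        exact Submodule.smul_mem _ _ hv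
      · rw [h2 i hi r hr, zero_smul]
        exact zero_mem _
    | zero => rw [map_zero]; exact zero_mem _
    | add x y _ _ hx hy => rw [map_add]; exact add_mem hx hy
    | smul c x _ hx => rw [map_smul]; exact Submodule.smul_mem _ _ hx
  · intro d hd x hx
    induction hx using Submodule.span_induction with
    | mem x h =>
      obtain ⟨i, a, r, v, rfl, hr, hv, rfl⟩ := h
      by_cases hi : i = 0
      · subst hi
        rw [hE, TensorProduct.tmul_smul]
        conv_lhs => rw [h3 r hr, Algebra.algebraMap_eq_smul_one]
        rw [TensorProduct.smul_tmul']
      · rw [hd a (by omega)] at hv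
        rw [(Submodule.mem_bot k).1 hv, TensorProduct.tmul_zero, map_zero, TensorProduct.tmul_zero]
    | zero => rw [map_zero, TensorProduct.tmul_zero]
    | add x y _ _ hx hy => rw [map_add, TensorProduct.tmul_add, ← hx, ← hy]
    | smul c x _ hx => rw [map_smul, TensorProduct.tmul_smul, ← hx]

variable (𝒜) in
/-- The inclusion `V → R ⊗ V`. -/
def inducedι (V : GradedRep k Θ) : V.carrier →ₗ[k] induced 𝒜 V := TensorProduct.mk k R V.carrier 1

theorem inducedι_mem {d : ℕ} {v : V.carrier} (hv : v ∈ V.gr d) :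
    inducedι 𝒜 V v ∈ (induced 𝒜 V).gr d := by
  have := tmul_mem_inducedGr (SetLike.one_mem_graded 𝒜) hv
  rwa [zero_add] at this

theorem inducedι_ρ (g : Θ) (v : V.carrier) :
    (induced 𝒜 V).ρ g (inducedι 𝒜 V v) = inducedι 𝒜 V (V.ρ g v) :=
  congrArg (· ⊗ₜ[k] V.ρ g v) (smul_one g : g • (1 : R) = 1)

theorem inducedHom_ι {M : GradedSkewModule 𝒜 Θ} (τ : V.carrier →ₗ[k] M)
    (hτ : ∀ d, ∀ v ∈ V.gr d, τ v ∈ M.gr d) (hρ : ∀ g v, τ (V.ρ g v) = M.ρ g (τ v))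
    (v : V.carrier) : (inducedHom τ hτ hρ).toLin (inducedι 𝒜 V v) = τ v :=
  (LinearMap.liftBaseChange_tmul (A := R) (l := τ) 1 v).trans (one_smul R _)

/-- The reduction `R ⊗ V → V` modulo `R₊`. -/
theorem exists_inducedAug [Nontrivial R] (hconnected : 𝒜 0 = 1) (V : GradedRep k Θ) :
    ∃ E : induced 𝒜 V →ₗ[k] V.carrier, (∀ v, E (inducedι 𝒜 V v) = v) ∧
      (∀ x ∈ (induced 𝒜 V).plus, E x = 0) ∧
      (∀ x, x - inducedι 𝒜 V (E x) ∈ (induced 𝒜 V).plus) ∧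
      (∀ d, ∀ x ∈ (induced 𝒜 V).gr d, E x ∈ V.gr d) ∧
      ∀ d, (∀ b < d, V.gr b = ⊥) → ∀ x ∈ (induced 𝒜 V).gr d, x = inducedι 𝒜 V (E x) :=
  exists_tensorAug hconnected V

/-- The action of `Θ` on the component of degree `d`. -/
def GradedRep.pieceRep (V : GradedRep k Θ) (d : ℕ) : Representation k Θ (V.gr d) :=
  V.ρ.subrepresentation (V.gr d) fun g m hm => V.ρ_mem g d m hm

theorem repClass_tensorPiece_induced [Nontrivial R] (hconnected : 𝒜 0 = 1)
    [Module.Finite k V.carrier] (d : ℕ) :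
    repClass ((induced 𝒜 V).tensorPiece d) = repClass (Rep.of (V.pieceRep d)) := by
  obtain ⟨E, h1, h2, h3, h4, -⟩ := exists_inducedAug (𝒜 := 𝒜) hconnected V
  -- No equivariance of `E` was recorded, but `E x` is determined by `x ≡ 1 ⊗ E x` modulo the stable
  -- submodule `R₊`, so it follows.
  have hρ : ∀ g x, E ((induced 𝒜 V).ρ g x) = V.ρ g (E x) := fun g x => by
    have e := h2 _ ((induced 𝒜 V).ρ_mem_plus g (h3 x))
    rw [map_sub, inducedι_ρ, map_sub, h1, sub_eq_zero] at e
    exact e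
  let E' : (induced 𝒜 V).gr d →ₗ[k] V.gr d := (E ∘ₗ ((induced 𝒜 V).gr d).subtype).codRestrict _
    fun x => h4 d x.1 x.2
  have hker : (induced 𝒜 V).plusPiece d ≤ LinearMap.ker E' := fun x hx => Subtype.ext (h2 x.1 hx)
  refine repClass_congr (((induced 𝒜 V).plusPiece d).liftQ E' hker) ?_ ⟨?_, ?_⟩
  · intro g x
    induction x using Submodule.Quotient.induction_on with
    | H x => exact Subtype.ext (hρ g x.1)
  · rw [injective_iff_map_eq_zero]
    intro x hx
    induction x using Submodule.Quotient.induction_on with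
    | H x =>
      refine (Submodule.Quotient.mk_eq_zero _).2 ?_
      have hx' : E x.1 = 0 := congrArg Subtype.val hx
      have := h3 x.1
      rwa [hx', map_zero, sub_zero] at this
  · intro v
    exact ⟨Submodule.Quotient.mk ⟨_, inducedι_mem v.2⟩, Subtype.ext (h1 v.1)⟩

section Components

variable (𝒜 V)

/-- The projection of `R` to `R_i`. -/
def ringComp (Θ : Type u) [Group Θ] [MulSemiringAction Θ R] [SMulCommClass Θ k R]
    [GradedGroupAction 𝒜 Θ] (i : ℕ) : R →ₗ[k] (self 𝒜 Θ).gr i :=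
  (GradedAlgebra.proj 𝒜 i).codRestrict (𝒜 i) fun _ => SetLike.coe_mem _

/-- The projection of `V` to `V_a`. -/
def GradedRep.comp (a : ℕ) : V.carrier →ₗ[k] V.gr a := (V.proj a).codRestrict _ (V.proj_mem a)

/-- The projection of `R ⊗ V` to `R_i ⊗ V_a`. -/
def tensorComp (x : ℕ × ℕ) : R ⊗[k] V.carrier →ₗ[k] (self 𝒜 Θ).gr x.1 ⊗[k] V.gr x.2 :=
  TensorProduct.map (ringComp 𝒜 Θ x.1) (V.comp x.2)

/-- The inclusion of `R_i ⊗ V_a` in `R ⊗ V`. -/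
def tensorIncl (x : ℕ × ℕ) : (self 𝒜 Θ).gr x.1 ⊗[k] V.gr x.2 →ₗ[k] R ⊗[k] V.carrier :=
  TensorProduct.map ((self 𝒜 Θ).gr x.1).subtype (V.gr x.2).subtype

/-- The representation of `Θ` on `R_i ⊗ V_a`. -/
def tensorRep (x : ℕ × ℕ) : Representation k Θ ((self 𝒜 Θ).gr x.1 ⊗[k] V.gr x.2) :=
  ((self 𝒜 Θ).pieceRep x.1).tprod (V.pieceRep x.2)

theorem tensorIncl_mem (x : ℕ × ℕ) (t : (self 𝒜 Θ).gr x.1 ⊗[k] V.gr x.2) :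
    tensorIncl 𝒜 V x t ∈ inducedGr 𝒜 V (x.1 + x.2) := by
  induction t with
  | zero => rw [map_zero]; exact zero_mem _
  | add a b ha hb => rw [map_add]; exact add_mem ha hb
  | tmul r v => exact tmul_mem_inducedGr (𝒜 := 𝒜) r.2 v.2

theorem tensorIncl_comp (x : ℕ × ℕ) (t : R ⊗[k] V.carrier) :
    tensorIncl 𝒜 V x (tensorComp 𝒜 V x t) = inducedProj 𝒜 V x t := by
  induction t with
  | zero => simp only [map_zero]
  | add a b ha hb => simp only [map_add, ha, hb]
  | tmul r v => rfl

theorem tensorComp_incl (x : ℕ × ℕ) (t : (self 𝒜 Θ).gr x.1 ⊗[k] V.gr x.2) :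
    tensorComp 𝒜 V x (tensorIncl 𝒜 V x t) = t := by
  induction t with
  | zero => simp only [map_zero]
  | add a b ha hb => simp only [map_add, ha, hb]
  | tmul r v =>
    change ringComp 𝒜 Θ x.1 r.1 ⊗ₜ V.comp x.2 v.1 = _
    have e1 : ringComp 𝒜 Θ x.1 r.1 = r := Subtype.ext (DirectSum.decompose_of_mem_same 𝒜 r.2)
    have e2 : V.comp x.2 v.1 = v := Subtype.ext (GradedRep.proj_of_mem v.2)
    rw [e1, e2]

theorem tensorComp_incl_of_ne {x y : ℕ × ℕ} (h : x ≠ y) (t : (self 𝒜 Θ).gr x.1 ⊗[k] V.gr x.2) :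
    tensorComp 𝒜 V y (tensorIncl 𝒜 V x t) = 0 := by
  induction t with
  | zero => simp only [map_zero]
  | add a b ha hb => simp only [map_add, ha, hb, add_zero]
  | tmul r v =>
    change ringComp 𝒜 Θ y.1 r.1 ⊗ₜ V.comp y.2 v.1 = _
    by_cases h1 : x.1 = y.1
    · have e2 : V.comp y.2 v.1 = 0 :=
        Subtype.ext (GradedRep.proj_of_mem_ne (fun h2 => h (Prod.ext h1 h2.symm)) v.2)
      rw [e2, TensorProduct.tmul_zero]
    · have e1 : ringComp 𝒜 Θ y.1 r.1 = 0 := Subtype.ext (DirectSum.decompose_of_mem_ne 𝒜 r.2 h1)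
      rw [e1, TensorProduct.zero_tmul]

theorem tensorComp_ρ (x : ℕ × ℕ) (g : Θ) (t : R ⊗[k] V.carrier) :
    tensorComp 𝒜 V x ((Representation.ofDistribMulAction k Θ R).tprod V.ρ g t) =
      tensorRep 𝒜 V x g (tensorComp 𝒜 V x t) := by
  have hproj : ∀ r : R, g • GradedAlgebra.proj 𝒜 x.1 r = GradedAlgebra.proj 𝒜 x.1 (g • r) := by
    intro r
    induction r using DirectSum.Decomposition.inductionOn 𝒜 with
    | zero => simp
    | @homogeneous i r =>
      by_cases hi : i = x.1
      · subst hi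
        rw [GradedAlgebra.proj_apply, GradedAlgebra.proj_apply,
          DirectSum.decompose_of_mem_same 𝒜 r.2,
          DirectSum.decompose_of_mem_same 𝒜 (GradedGroupAction.smul_mem g r.2)]
      · rw [GradedAlgebra.proj_apply, GradedAlgebra.proj_apply,
          DirectSum.decompose_of_mem_ne 𝒜 r.2 hi,
          DirectSum.decompose_of_mem_ne 𝒜 (GradedGroupAction.smul_mem g r.2) hi, smul_zero]
    | add a b ha hb => rw [map_add, smul_add, ha, hb, smul_add, map_add]
  induction t with
  | zero => simp only [map_zero]
  | add a b ha hb => simp only [map_add, ha, hb]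
  | tmul r v =>
    change ringComp 𝒜 Θ x.1 (g • r) ⊗ₜ V.comp x.2 (V.ρ g v) =
      ((self 𝒜 Θ).pieceRep x.1 g (ringComp 𝒜 Θ x.1 r)) ⊗ₜ (V.pieceRep x.2 g (V.comp x.2 v))
    congr 1
    · exact Subtype.ext (hproj r).symm
    · exact Subtype.ext (V.ρ_proj g x.2 v).symm

variable {𝒜 V}

theorem eq_zero_of_tensorComp {n : ℕ} (v : (induced 𝒜 V).gr n)
    (h : ∀ x ∈ Finset.HasAntidiagonal.antidiagonal n, tensorComp (Θ := Θ) 𝒜 V x v.1 = 0) :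
    v = 0 := by
  refine Subtype.ext ((sum_inducedProj v.2).symm.trans (Finset.sum_eq_zero fun x hx => ?_))
  exact (tensorIncl_comp 𝒜 V x v.1).symm.trans ((congrArg _ (h x hx)).trans (map_zero _))

theorem finite_gr_induced (hfin : ∀ d, Module.Finite k (𝒜 d)) [Module.Finite k V.carrier]
    (n : ℕ) : Module.Finite k ((induced 𝒜 V).gr n) := by
  have : ∀ i, Module.Finite k ((self 𝒜 Θ).gr i) := hfin
  refine Module.Finite.of_injective (LinearMap.pi fun x : Finset.HasAntidiagonal.antidiagonal n =>
    tensorComp (Θ := Θ) 𝒜 V x.1 ∘ₗ (inducedGr 𝒜 V n).subtype :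
      (induced 𝒜 V).gr n →ₗ[k] ∀ x : Finset.HasAntidiagonal.antidiagonal n,
        (self 𝒜 Θ).gr x.1.1 ⊗[k] V.gr x.1.2) ?_
  rw [injective_iff_map_eq_zero]
  exact fun v hv => eq_zero_of_tensorComp v fun x hx => congrFun hv ⟨x, hx⟩

end Components

theorem repClass_piece_induced (hfin : ∀ d, Module.Finite k (𝒜 d)) [Module.Finite k V.carrier]
    (n : ℕ) : repClass ((induced 𝒜 V).piece n) =
      ∑ x ∈ Finset.HasAntidiagonal.antidiagonal n,
        repClass ((self 𝒜 Θ).piece x.1) * repClass (Rep.of (V.pieceRep x.2)) := by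
  classical
  have ht : ∀ x : ℕ × ℕ, repClass ((self 𝒜 Θ).piece x.1) * repClass (Rep.of (V.pieceRep x.2)) =
      repClass (Rep.of (tensorRep (Θ := Θ) 𝒜 V x)) := fun x => by
    have : Module.Finite k ((self 𝒜 Θ).gr x.1) := hfin x.1
    exact (repClass_tprod _ _).symm
  rw [Finset.sum_congr rfl fun x _ => ht x]
  have hgr := finite_gr_induced (Θ := Θ) (V := V) hfin n
  -- The inclusion of `R_i ⊗ V_a` lands in degree `n` only if `i + a = n`; for other pairs any value
  -- will do.
  obtain ⟨j, hj⟩ : ∃ j : ∀ x : ℕ × ℕ, (self 𝒜 Θ).gr x.1 ⊗[k] V.gr x.2 →ₗ[k] inducedGr 𝒜 V n,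
      ∀ x ∈ Finset.HasAntidiagonal.antidiagonal n, ∀ t, (j x t).1 = tensorIncl 𝒜 V x t := by
    refine ⟨fun x => if h : x ∈ Finset.HasAntidiagonal.antidiagonal n then
      (tensorIncl 𝒜 V x).codRestrict (inducedGr 𝒜 V n) (fun t =>
        Finset.HasAntidiagonal.mem_antidiagonal.1 h ▸ tensorIncl_mem 𝒜 V x t) else 0,
      fun x hx t => ?_⟩
    dsimp only
    rw [dif_pos hx]
    rfl
  refine repClass_eq_sum (tensorRep (Θ := Θ) 𝒜 V) _
    ((induced 𝒜 V).pieceRep n) (fun x => tensorComp 𝒜 V x ∘ₗ (inducedGr 𝒜 V n).subtype) j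
    ?_ ?_ ?_ ?_
  · exact fun x g v => tensorComp_ρ 𝒜 V x g v.1
  · exact fun x hx t => (congrArg (tensorComp 𝒜 V x) (hj x hx t)).trans (tensorComp_incl 𝒜 V x t)
  · exact fun y hy x hx hne t => (congrArg (tensorComp 𝒜 V y) (hj x hx t)).trans
      (tensorComp_incl_of_ne 𝒜 V (Ne.symm hne) t)
  · exact fun v hv => eq_zero_of_tensorComp v hv

end GradedSkewModule

/-! ### Equivariant covers -/

namespace GradedSkewModule

variable {k R : Type u} [Field k] [CommRing R] [Algebra k R] {𝒜 : ℕ → Submodule k R}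
  {Θ : Type u} [Group Θ] [MulSemiringAction Θ R] [GradedAlgebra 𝒜]

/-- The graded representation on the sum of stable subspaces of the components of `M`. -/
def subGradedRep (M : GradedSkewModule 𝒜 Θ) (W : ℕ → Submodule k M) (hW : ∀ d, W d ≤ M.gr d)
    (hst : ∀ g d, ∀ v ∈ W d, M.ρ g v ∈ W d) : GradedRep k Θ where
  carrier := (⨆ d, W d : Submodule k M)
  ρ := M.ρ.subrepresentation (⨆ d, W d) fun g v hv => by
    refine Submodule.iSup_induction W (motive := fun v => M.ρ g v ∈ ⨆ d, W d) hv ?_ ?_ ?_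
    · exact fun d v hv => Submodule.mem_iSup_of_mem d (hst g d v hv)
    · rw [map_zero]; exact zero_mem _
    · intro v w hv hw
      rw [map_add]
      exact add_mem hv hw
  gr d := (W d).submoduleOf (⨆ d, W d)
  isInternal := by
    have hp : ∀ j, ∀ v ∈ ⨆ d, W d, M.proj j v ∈ W j := by
      intro j v hv
      refine Submodule.iSup_induction W (motive := fun v => M.proj j v ∈ W j) hv ?_ ?_ ?_
      · intro d v hv
        by_cases h : j = d
        · subst h
          rwa [proj_of_mem (hW _ hv)]
        · rw [proj_of_mem_ne h (hW _ hv)]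
          exact zero_mem _
      · rw [map_zero]; exact zero_mem _
      · intro v w hv hw
        rw [map_add]
        exact add_mem hv hw
    have hp' : ∀ j, ∀ v ∈ ⨆ d, W d, M.proj j v ∈ ⨆ d, W d := fun j v hv =>
      Submodule.mem_iSup_of_mem j (hp j v hv)
    refine isInternal_of_projections _ (fun j => (M.proj j).restrict (hp' j)) ?_ ?_ ?_
    · exact fun j v hv => Subtype.ext (proj_of_mem (hW _ hv))
    · exact fun i j hij v hv => Subtype.ext (proj_of_mem_ne hij (hW _ hv))
    · intro v
      obtain ⟨s, hs⟩ := exists_eq_sum_proj v.1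
      have : v = ∑ j ∈ s, (M.proj j).restrict (hp' j) v := by
        apply Subtype.ext
        rw [AddSubmonoidClass.coe_finsetSum]
        exact hs
      rw [this]
      exact sum_mem fun j _ => Submodule.mem_iSup_of_mem (p := fun d =>
        (W d).submoduleOf (⨆ d, W d)) j (hp j v.1 v.2)
  ρ_mem g d v hv := hst g d v.1 hv

theorem finite_subGradedRep (M : GradedSkewModule 𝒜 Θ) (W : ℕ → Submodule k M)
    (hW : ∀ d, W d ≤ M.gr d) (hst : ∀ g d, ∀ v ∈ W d, M.ρ g v ∈ W d)
    (hfin : ∀ d, Module.Finite k (W d)) (D : ℕ) (hD : ∀ d, D < d → W d = ⊥) :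
    Module.Finite k (M.subGradedRep W hW hst).carrier := by
  have h : (⨆ d, W d) ≤ ⨆ d : Fin (D + 1), W d := iSup_le fun d => by
    by_cases hd : D < d
    · rw [hD d hd]
      exact bot_le
    · exact le_iSup (fun d : Fin (D + 1) => W d) ⟨d, by omega⟩
  exact Module.Finite.of_injective (Submodule.inclusion h) (Submodule.inclusion_injective h)

/-- Elements of large degree of a finitely generated graded submodule `N` lie in `I N`, if `I`
contains all elements of `R` of large degree. -/
theorem exists_gr_le_smul (M : GradedSkewModule 𝒜 Θ) {N : Submodule R M} (hN : IsGradedSub N)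
    (hfg : N.FG) {I : Ideal R} {D₀ : ℕ} (hI : ∀ i, D₀ ≤ i → ∀ r ∈ 𝒜 i, r ∈ I) :
    ∃ D, ∀ d, D ≤ d → ∀ v ∈ N, v ∈ M.gr d → v ∈ I • N := by
  classical
  obtain ⟨t, ht⟩ := hfg
  choose s hs using fun x : M => exists_eq_sum_proj x
  have htN : ∀ x ∈ t, x ∈ N := fun x hx => ht ▸ Submodule.subset_span hx
  refine ⟨(t.biUnion s).sup id + D₀, fun d hd v hv hvd => ?_⟩
  have key : ∀ x ∈ t, ∀ r : R, M.proj d (r • x) ∈ I • N := by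
    intro x hx r
    conv in r • x => rw [hs x]
    rw [Finset.smul_sum, map_sum]
    refine sum_mem fun a ha => ?_
    -- Components of the generators have degree at most this supremum, so reaching degree `d`
    -- requires a coefficient of degree at least `D₀`, that is, one in `I`.
    have ha' : a ≤ (t.biUnion s).sup id :=
      Finset.le_sup (f := id) (Finset.mem_biUnion.2 ⟨x, hx, ha⟩)
    induction r using DirectSum.Decomposition.inductionOn 𝒜 with
    | zero => rw [zero_smul, map_zero]; exact zero_mem _
    | @homogeneous i r =>
      by_cases hi : d = i + a
      · rw [proj_of_mem (hi ▸ M.smul_mem r.2 (M.proj_mem a x))]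
        exact Submodule.smul_mem_smul (hI i (by omega) _ r.2) (hN x (htN x hx) a)
      · rw [proj_of_mem_ne hi (M.smul_mem r.2 (M.proj_mem a x))]
        exact zero_mem _
    | add a b ha hb => rw [add_smul, map_add]; exact add_mem ha hb
  obtain ⟨c, -, hc⟩ := Submodule.mem_span_finset.1 (ht ▸ hv)
  rw [← proj_of_mem hvd, ← hc, map_sum]
  exact sum_mem fun x hx => key x hx (c x)

theorem exists_gr_le_plus (M : GradedSkewModule 𝒜 Θ) [Module.Finite R M] :
    ∃ D, ∀ d, D < d → ∀ v ∈ M.gr d, v ∈ M.plus := by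
  obtain ⟨D, hD⟩ := exists_gr_le_smul M isGradedSub_top Module.Finite.fg_top
    (I := (HomogeneousIdeal.irrelevant 𝒜).toIdeal) (D₀ := 1) fun i hi r hr => by
      rw [HomogeneousIdeal.irrelevant_eq_span]
      exact Ideal.subset_span (Set.mem_iUnion.2 ⟨i, Set.mem_iUnion.2 ⟨by omega, hr⟩⟩)
  exact ⟨D, fun d hd v hv => hD d hd.le v Submodule.mem_top hv⟩

/-- A surjection from a finitely generated graded free module, an isomorphism in lowest degree, and
minimal in the semisimple case. -/
structure Cover (N : GradedSkewModule 𝒜 Θ) where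
  F : GradedSkewModule 𝒜 Θ
  π : Hom F N
  surj : Function.Surjective π.toLin
  free : F.IsGradedFree
  finite : Module.Finite R F
  lowest : ∀ a, (∀ b < a, F.gr b = ⊥) → ∀ x ∈ F.gr a, π.toLin x = 0 → x = 0
  gr_eq_bot : ∀ d, (∀ b ≤ d, N.gr b = ⊥) → F.gr d = ⊥
  minimal : (Nat.card Θ : k) ≠ 0 → ∀ x, π.toLin x = 0 → x ∈ F.plus

variable [SMulCommClass Θ k R] [GradedGroupAction 𝒜 Θ]

/-- Stable complements of `R₊ M`, or the full components if there are none. -/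
theorem exists_generating_subspaces
    (M : GradedSkewModule 𝒜 Θ) [Module.Finite R M] :
    ∃ W : ℕ → Submodule k M, (∀ d, W d ≤ M.gr d) ∧ (∀ g d, ∀ v ∈ W d, M.ρ g v ∈ W d) ∧
      (∃ D, ∀ d, D < d → W d = ⊥) ∧ (∀ d, ∀ v ∈ M.gr d, ∃ w ∈ W d, v - w ∈ M.plus) ∧
      ((Nat.card Θ : k) ≠ 0 → ∀ d, ∀ w ∈ W d, w ∈ M.plus → w = 0) := by
  obtain ⟨D, hD⟩ := exists_gr_le_plus M
  -- `Nat.card` is `0` for infinite `Θ`, so this case contains both infinite groups and those whose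
  -- order vanishes in `k`.
  by_cases hcard : (Nat.card Θ : k) = 0
  · refine ⟨fun d => if d ≤ D then M.gr d else ⊥, ?_, ?_, ⟨D, ?_⟩, ?_, fun h => absurd hcard h⟩
    · intro d
      dsimp only
      split_ifs
      exacts [le_rfl, bot_le]
    · intro g d v hv
      dsimp only at hv ⊢
      split_ifs at hv ⊢ with h
      · exact M.ρ_mem g hv
      · rw [(Submodule.mem_bot k).1 hv, map_zero]
        exact zero_mem _
    · exact fun d hd => if_neg (by omega)
    · intro d v hv
      by_cases h : d ≤ D
      · exact ⟨v, by simpa only [if_pos h] using hv, by rw [sub_self]; exact zero_mem _⟩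
      · exact ⟨0, zero_mem _, by rw [sub_zero]; exact hD d (by omega) v hv⟩
  · have : NeZero (Nat.card Θ : k) := ⟨hcard⟩
    have : Finite Θ := Nat.finite_of_card_ne_zero fun h => hcard (by rw [h, Nat.cast_zero])
    -- Maschke's theorem: subrepresentations have stable complements.
    have hc : ∀ d, ∃ q : Subrepresentation (M.pieceRep d), IsCompl
        (⟨M.plusPiece d, fun g _ hm => M.ρ_mem_plus g hm⟩ : Subrepresentation (M.pieceRep d)) q :=
      fun d => ComplementedLattice.exists_isCompl _
    choose q hq using hc
    have hinf : ∀ d, ∀ w ∈ (q d).toSubmodule, w.1 ∈ M.plus → w = 0 := by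
      intro d w hw hw'
      have h := (hq d).inf_eq_bot
      have h' : w ∈ (⟨M.plusPiece d, fun g _ hm => M.ρ_mem_plus g hm⟩ ⊓ q d :
        Subrepresentation (M.pieceRep d)).toSubmodule := ⟨hw', hw⟩
      rw [h] at h'
      exact (Submodule.mem_bot k).1 h'
    have hgen : ∀ d, ∀ v ∈ M.gr d, ∃ w ∈ (q d).toSubmodule.map (M.gr d).subtype,
        v - w ∈ M.plus := by
      intro d v hv
      have h := (hq d).sup_eq_top
      have h' : (⟨v, hv⟩ : M.gr d) ∈ (⟨M.plusPiece d, fun g _ hm => M.ρ_mem_plus g hm⟩ ⊔ q d :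
        Subrepresentation (M.pieceRep d)).toSubmodule := by rw [h]; exact Submodule.mem_top
      obtain ⟨p, hp, w, hw, e⟩ := Submodule.mem_sup.1 h'
      refine ⟨w.1, ⟨w, hw, rfl⟩, ?_⟩
      have e' : v = p.1 + w.1 := (congrArg Subtype.val e).symm
      rw [e', add_sub_cancel_right]
      exact hp
    refine ⟨fun d => (q d).toSubmodule.map (M.gr d).subtype, ?_, ?_, ⟨D, ?_⟩, hgen, fun _ => ?_⟩
    · rintro d _ ⟨w, -, rfl⟩
      exact w.2
    · rintro g d _ ⟨w, hw, rfl⟩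
      exact ⟨M.pieceRep d g w, (q d).apply_mem_toSubmodule g hw, rfl⟩
    · intro d hd
      rw [eq_bot_iff]
      rintro _ ⟨w, hw, rfl⟩
      rw [hinf d w hw (hD d hd w.1 w.2), map_zero]
      exact zero_mem _
    · rintro d _ ⟨w, hw, rfl⟩ hw'
      rw [hinf d w hw hw', map_zero]

/-- The cover is `R ⊗ V` with `V` the sum of the generating subspaces. The formula for the classes
stays outside `Cover`, because it is established for induced modules, while graded free modules will
also be covered by themselves. -/
theorem exists_cover [IsNoetherianRing R] [Nontrivial R] (hconnected : 𝒜 0 = 1)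
    (M : GradedSkewModule 𝒜 Θ) [Module.Finite R M] :
    ∃ c : Cover M, ∀ n, Module.Finite k (c.F.gr n) ∧ repClass (c.F.piece n) =
      ∑ x ∈ Finset.HasAntidiagonal.antidiagonal n,
        repClass ((self 𝒜 Θ).piece x.1) * repClass (c.F.tensorPiece x.2) := by
  obtain ⟨W, hW, hst, ⟨D, hD⟩, hgen, hmin⟩ := exists_generating_subspaces M
  have hfin : ∀ d, Module.Finite k (W d) := fun d => by
    have := finite_gr hconnected (M := M) d
    exact Module.Finite.of_injective (Submodule.inclusion (hW d)) (Submodule.inclusion_injective _)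
  have hA : ∀ d, Module.Finite k (𝒜 d) := fun d => by
    have : Module.Finite R (self 𝒜 Θ) := inferInstanceAs (Module.Finite R R)
    exact finite_gr hconnected (M := self 𝒜 Θ) d
  let V := M.subGradedRep W hW hst
  have hV : Module.Finite k V.carrier := M.finite_subGradedRep W hW hst hfin D hD
  obtain ⟨E, h1, h2, h3, h4, h5⟩ := exists_inducedAug (𝒜 := 𝒜) hconnected V
  let τ : V.carrier →ₗ[k] M := (⨆ d, W d).subtype
  have hτ : ∀ d, ∀ v ∈ V.gr d, τ v ∈ M.gr d := fun d v hv => hW d hv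
  have hτρ : ∀ g v, τ (V.ρ g v) = M.ρ g (τ v) := fun _ _ => rfl
  have hbot : ∀ b, (induced 𝒜 V).gr b = ⊥ → V.gr b = ⊥ := by
    intro b hb
    rw [eq_bot_iff]
    intro v hv
    have := inducedι_mem (𝒜 := 𝒜) hv
    rw [hb, Submodule.mem_bot] at this
    rw [Submodule.mem_bot, ← h1 v, this, map_zero]
  refine ⟨{ F := induced 𝒜 V
            π := inducedHom τ hτ hτρ
            surj := ?_
            free := induced_isGradedFree 𝒜 V
            finite := induced_finite 𝒜 V
            lowest := ?_
            gr_eq_bot := ?_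
            minimal := ?_ }, fun n => ⟨finite_gr_induced hA n, ?_⟩⟩
  -- Surjectivity follows from Nakayama, as `V` generates `M` modulo `R₊ M`.
  · rw [← LinearMap.range_eq_top]
    refine eq_top_of_sup_plus (IsGradedSub.range _) fun v _ => ?_
    obtain ⟨s, hs⟩ := exists_eq_sum_proj v
    rw [hs]
    refine sum_mem fun j _ => ?_
    obtain ⟨w, hw, hvw⟩ := hgen j _ (M.proj_mem j v)
    rw [← add_sub_cancel w (M.proj j v)]
    exact Submodule.add_mem_sup ⟨_, inducedHom_ι τ hτ hτρ
      (⟨w, Submodule.mem_iSup_of_mem j hw⟩ : (⨆ d, W d : Submodule k M))⟩ hvw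
  -- In its lowest degree `R ⊗ V` is `1 ⊗ V`, where the cover is the inclusion of `V` in `M`.
  · intro a ha x hx hx0
    have e := h5 a (fun b hb => hbot b (ha b hb)) x hx
    rw [e, inducedHom_ι] at hx0
    rw [e, show E x = 0 from Subtype.ext hx0, map_zero]
  · intro d hd
    refine induced_gr_eq_bot fun b hb => ?_
    rw [eq_bot_iff]
    intro v hv
    have : v.1 ∈ M.gr b := hW b hv
    rw [hd b hb, Submodule.mem_bot] at this
    exact (Submodule.mem_bot k).2 (Subtype.ext this)
  -- Modulo `R₊` an element `x` of the kernel is `1 ⊗ E x`, so `E x`, viewed in `M`, lies in `R₊ M`.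
  -- Its components lie in the complements `W_j`, hence vanish, and `x` lies in `R₊ F`.
  · intro hcard x hx
    have hx3 := h3 x
    have := map_mem_plus (inducedHom τ hτ hτρ).toLin hx3
    rw [map_sub, hx, zero_sub, inducedHom_ι, neg_mem_iff] at this
    have hE : E x = 0 := by
      have hz : ∀ j, V.proj j (E x) = 0 := by
        intro j
        refine Subtype.ext (hmin hcard j _ (V.proj_mem j (E x)) ?_)
        have e := isGradedSub_plus _ this j
        have e' : τ (V.proj j (E x)) = M.proj j (τ (E x)) :=
          map_projection τ hτ V.proj_mem GradedRep.exists_eq_sum_proj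
            (fun _ _ => GradedRep.proj_of_mem) (fun _ _ h _ => GradedRep.proj_of_mem_ne h)
            (fun _ _ => proj_of_mem) (fun _ _ h _ => proj_of_mem_ne h) j _
        rw [← e'] at e
        exact e
      obtain ⟨s, hs⟩ := GradedRep.exists_eq_sum_proj (E x)
      rw [hs]
      exact Finset.sum_eq_zero fun j _ => hz j
    rwa [hE, map_zero, sub_zero] at hx3
  · rw [repClass_piece_induced hA]
    exact Finset.sum_congr rfl fun x _ => by rw [repClass_tensorPiece_induced hconnected]

end GradedSkewModule

/-! ### Resolutions by iterated covers -/

namespace GradedSkewModule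

variable {k R : Type u} [Field k] [CommRing R] [Algebra k R] {𝒜 : ℕ → Submodule k R}
  {Θ : Type u} [Group Θ] [MulSemiringAction Θ R]

theorem gr_eq_bot_of_subsingleton (M : GradedSkewModule 𝒜 Θ) [Subsingleton M] (d : ℕ) :
    M.gr d = ⊥ :=
  eq_bot_iff.2 fun x _ => (Submodule.mem_bot k).2 (Subsingleton.elim x 0)

theorem subsingleton_of_gr_eq_bot {M : GradedSkewModule 𝒜 Θ} (h : ∀ d, M.gr d = ⊥) :
    Subsingleton M :=
  subsingleton_of_forall_eq 0 fun _ => eq_zero_of_proj fun j =>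
    (Submodule.mem_bot k).1 (h j ▸ M.proj_mem j _)

theorem kernel_gr_eq_bot {M N : GradedSkewModule 𝒜 Θ} {f : Hom M N} {d : ℕ}
    (h : ∀ x ∈ M.gr d, f.toLin x = 0 → x = 0) : f.kernel.gr d = ⊥ :=
  eq_bot_iff.2 fun x hx => (Submodule.mem_bot k).2 (Subtype.ext (h x.1 hx x.2))

instance finite_kernel [IsNoetherianRing R] {M N : GradedSkewModule 𝒜 Θ} (f : Hom M N)
    [Module.Finite R M] : Module.Finite R f.kernel :=
  have : IsNoetherian R M := isNoetherian_of_isNoetherianRing_of_finite R M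
  inferInstanceAs (Module.Finite R (LinearMap.ker f.toLin))

variable [GradedAlgebra 𝒜]

/-- A graded free module covers itself. -/
def Cover.refl (N : GradedSkewModule 𝒜 Θ) (hfree : N.IsGradedFree) (hfin : Module.Finite R N) :
    Cover N where
  F := N
  π := ⟨LinearMap.id, fun h => h, fun _ _ => rfl⟩
  surj := Function.surjective_id
  free := hfree
  finite := hfin
  lowest _ _ _ _ h := h
  gr_eq_bot d h := h d le_rfl
  minimal _ x hx := by
    rw [show x = 0 from hx]
    exact zero_mem _

section CoverResolution

variable [IsNoetherianRing R] (c : ∀ N : GradedSkewModule 𝒜 Θ, Module.Finite R N → Cover N)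

/-- The syzygies of a finitely generated module with respect to a choice of covers. -/
def syzygy (M : GradedSkewModule 𝒜 Θ) (hM : Module.Finite R M) :
    ℕ → {N : GradedSkewModule 𝒜 Θ // Module.Finite R N}
  | 0 => ⟨M, hM⟩
  | i + 1 =>
    let N := syzygy M hM i
    ⟨(c N.1 N.2).π.kernel, have := (c N.1 N.2).finite; inferInstance⟩

/-- The cover of the `i`-th syzygy. -/
def syzygyCover (M : GradedSkewModule 𝒜 Θ) (hM : Module.Finite R M) (i : ℕ) :
    Cover (syzygy c M hM i).1 :=
  c (syzygy c M hM i).1 (syzygy c M hM i).2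

/-- The resolution obtained from a choice of covers. -/
def coverResolution (M : GradedSkewModule 𝒜 Θ) (hM : Module.Finite R M) : Resolution M where
  F i := (syzygyCover c M hM i).F
  d i := (syzygyCover c M hM i).π.kernelι.comp (syzygyCover c M hM (i + 1)).π
  ε := (syzygyCover c M hM 0).π
  free i := (syzygyCover c M hM i).free
  exact i := by
    intro y
    constructor
    · intro hy
      have hy' : (syzygyCover c M hM (i + 1)).π.toLin y = 0 := Subtype.ext hy
      obtain ⟨z, hz⟩ := (syzygyCover c M hM (i + 2)).surj ⟨y, hy'⟩
      exact ⟨z, congrArg Subtype.val hz⟩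
    · rintro ⟨z, rfl⟩
      exact congrArg Subtype.val ((syzygyCover c M hM (i + 2)).π.toLin z).2
  exact_zero := by
    intro y
    constructor
    · intro hy
      obtain ⟨z, hz⟩ := (syzygyCover c M hM 1).surj ⟨y, hy⟩
      exact ⟨z, congrArg Subtype.val hz⟩
    · rintro ⟨z, rfl⟩
      exact ((syzygyCover c M hM 1).π.toLin z).2
  surjective := (syzygyCover c M hM 0).surj

variable (M : GradedSkewModule 𝒜 Θ) (hM : Module.Finite R M)

theorem exact_syzygyCover (i : ℕ) : Function.Exact ((coverResolution c M hM).d i).toLin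
    (syzygyCover c M hM i).π.toLin := by
  intro y
  constructor
  · intro hy
    obtain ⟨z, hz⟩ := (syzygyCover c M hM (i + 1)).surj ⟨y, hy⟩
    exact ⟨z, congrArg Subtype.val hz⟩
  · rintro ⟨z, rfl⟩
    exact ((syzygyCover c M hM (i + 1)).π.toLin z).2

theorem coverResolution_isFinite : (coverResolution c M hM).IsFinite :=
  fun i => (syzygyCover c M hM i).finite

/-- If `F_i` vanishes below degree `a`, its cover map is injective up to degree `a`. So the next
syzygy vanishes through degree `a`, and a cover starts no earlier than the module it covers. This
one-degree gain yields the growth of mindeg, the persistence of zero terms, and the vanishing of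
`F_i` below degree `i`. -/
theorem coverResolution_gr_succ_eq_bot {i a : ℕ}
    (h : ∀ b < a, ((coverResolution c M hM).F i).gr b = ⊥) :
    ∀ b ≤ a, ((coverResolution c M hM).F (i + 1)).gr b = ⊥ := by
  have hK : ∀ b ≤ a, (syzygy c M hM (i + 1)).1.gr b = ⊥ := fun b hb =>
    kernel_gr_eq_bot fun x hx hx0 =>
      (syzygyCover c M hM i).lowest b (fun b' hb' => h b' (hb'.trans_le hb)) x hx hx0
  exact fun b hb => (syzygyCover c M hM (i + 1)).gr_eq_bot b fun b' hb' => hK b' (hb'.trans hb)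

theorem coverResolution_hasIncreasingMindeg : (coverResolution c M hM).HasIncreasingMindeg := by
  classical
  intro i hi
  by_cases hex : ∃ b, ((coverResolution c M hM).F i).gr b ≠ ⊥
  · have h0 : ∀ b < Nat.find hex, ((coverResolution c M hM).F i).gr b = ⊥ :=
      fun b hb => not_not.1 (Nat.find_min hex hb)
    have h1 := coverResolution_gr_succ_eq_bot c M hM h0
    refine (iInf₂_le (Nat.find hex) (Nat.find_spec hex)).trans_lt
      ((Nat.cast_lt.2 (Nat.lt_succ_self _)).trans_le (le_iInf₂ fun d hd => Nat.cast_le.2 ?_))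
    exact Nat.succ_le_of_lt (not_le.1 fun hle => hd (h1 d hle))
  · push Not at hex
    have := subsingleton_of_gr_eq_bot (M := (coverResolution c M hM).F (i + 1)) fun d =>
      coverResolution_gr_succ_eq_bot c M hM (fun b _ => hex b) d le_rfl
    exact absurd hi (not_nontrivial _)

/-- The syzygies after a vanishing syzygy vanish. -/
theorem coverResolution_subsingleton {i : ℕ} (h : Subsingleton ((coverResolution c M hM).F i)) :
    ∀ j, i ≤ j → Subsingleton ((coverResolution c M hM).F j) := by
  intro j hj
  induction j, hj using Nat.le_induction with
  | base => exact h
  | succ j _ ih =>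
    exact subsingleton_of_gr_eq_bot fun d => coverResolution_gr_succ_eq_bot c M hM
      (fun b _ => gr_eq_bot_of_subsingleton _ b) d le_rfl

theorem irrelevant_ne_top (𝒜 : ℕ → Submodule k R) [GradedAlgebra 𝒜] [Nontrivial R] :
    (HomogeneousIdeal.irrelevant 𝒜).toIdeal ≠ ⊤ := by
  rw [Ideal.ne_top_iff_one]
  intro h
  have : GradedRing.proj 𝒜 0 (1 : R) = 0 := (HomogeneousIdeal.mem_irrelevant_iff 𝒜 _).1 h
  rw [GradedRing.proj_apply, DirectSum.decompose_of_mem_same 𝒜 (SetLike.one_mem_graded 𝒜)] at this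
  exact one_ne_zero this

theorem coverResolution_d_mem_plus (hcard : (Nat.card Θ : k) ≠ 0) (i : ℕ)
    (x : (coverResolution c M hM).F (i + 1)) :
    ((coverResolution c M hM).d i).toLin x ∈ ((coverResolution c M hM).F i).plus :=
  (syzygyCover c M hM i).minimal hcard _ ((syzygyCover c M hM (i + 1)).π.toLin x).2

theorem coverResolution_isMinimal [Nontrivial R] (hcard : (Nat.card Θ : k) ≠ 0) :
    (coverResolution c M hM).IsMinimal := by
  refine ⟨coverResolution_d_mem_plus c M hM hcard, ?_⟩
  intro G δ η hfree hfin hG hG0 sG i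
  have : Nontrivial (R ⧸ (HomogeneousIdeal.irrelevant 𝒜).toIdeal) :=
    Ideal.Quotient.nontrivial_iff.2 (irrelevant_ne_top 𝒜)
  exact finrank_le_of_minimal (X := fun i => (coverResolution c M hM).F i) (Y := fun i => G i)
    (HomogeneousIdeal.irrelevant 𝒜).toIdeal
    (dX := fun i => ((coverResolution c M hM).d i).toLin) (coverResolution c M hM).exact
    (coverResolution c M hM).exact_zero (coverResolution c M hM).surjective hG hG0 sG
    (coverResolution_d_mem_plus c M hM hcard) i

end CoverResolution

/-! ### Freeness of syzygies and the length of the resolution -/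

section Freeness

theorem IsGradedFree.of_bijective {M N : GradedSkewModule 𝒜 Θ} (h : M.IsGradedFree) (f : Hom M N)
    (hf : Function.Bijective f.toLin) : N.IsGradedFree := by
  obtain ⟨ι, b, hb⟩ := h
  refine ⟨ι, b.map (LinearEquiv.ofBijective f.toLin hf), fun i => ?_⟩
  obtain ⟨d, hd⟩ := hb i
  exact ⟨d, f.map_gr hd⟩

/-- A module is graded free if its first homology modulo `R₊` vanishes. -/
theorem isGradedFree_of_cycles_le [IsNoetherianRing R]
    (c : ∀ N : GradedSkewModule 𝒜 Θ, Module.Finite R N → Cover N)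
    (hcard : (Nat.card Θ : k) ≠ 0) (N : GradedSkewModule 𝒜 Θ) (hN : Module.Finite R N)
    {X : ℕ → Type u} [∀ i, AddCommGroup (X i)] [∀ i, Module R (X i)] [∀ i, Module.Projective R (X i)]
    {dX : ∀ i, X (i + 1) →ₗ[R] X i} {eX : X 0 →ₗ[R] N}
    (hX : ∀ i, Function.Exact (dX (i + 1)) (dX i)) (hX0 : Function.Exact (dX 0) eX)
    (sX : Function.Surjective eX)
    (h : cyclesMod (HomogeneousIdeal.irrelevant 𝒜).toIdeal dX 1 ≤
      boundariesMod (HomogeneousIdeal.irrelevant 𝒜).toIdeal dX 1) : N.IsGradedFree := by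
  have key : (coverResolution c N hN).cyc 1 ≤ (coverResolution c N hN).bdry 1 :=
    cyclesMod_le_boundariesMod (Y := fun i => (coverResolution c N hN).F i) _ hX hX0 sX
      (coverResolution c N hN).exact (coverResolution c N hN).exact_zero
      (coverResolution c N hN).surjective h
  have hd := coverResolution_d_mem_plus c N hN hcard
  -- Both differentials at `F_1` are zero modulo `R₊`, so all of `F_1` consists of cycles, while
  -- boundaries lie in `R₊ F_1`. Hence `F_1 = R₊ F_1` and Nakayama applies.
  have htop : (⊤ : Submodule R ((coverResolution c N hN).F 1)) = ⊥ := by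
    refine eq_bot_of_le_plus isGradedSub_top fun x _ => ?_
    obtain ⟨y, hy⟩ := (Resolution.mem_bdry _).1 (key ((Resolution.mem_cyc_succ _).2 (hd 0 x)))
    have := add_mem hy (hd 1 y)
    rwa [sub_add_cancel] at this
  refine (syzygyCover c N hN 0).free.of_bijective (syzygyCover c N hN 0).π
    ⟨?_, (syzygyCover c N hN 0).surj⟩
  rw [injective_iff_map_eq_zero]
  intro x hx
  obtain ⟨y, rfl⟩ := ((exact_syzygyCover c N hN 0) x).1 hx
  rw [show y = 0 from (Submodule.mem_bot R).1 (htop ▸ Submodule.mem_top), map_zero]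
  rfl

end Freeness

end GradedSkewModule

namespace GradedSkewModule

variable {k R : Type u} [Field k] [CommRing R] [Algebra k R] {𝒜 : ℕ → Submodule k R}
  {Θ : Type u} [Group Θ] [MulSemiringAction Θ R] [GradedAlgebra 𝒜]

section Forget

/-- The trivial action of the trivial group. -/
@[reducible] def trivialAction (R : Type u) [CommRing R] : MulSemiringAction PUnit.{u + 1} R where
  smul _ r := r
  one_smul _ := rfl
  mul_smul _ _ _ := rfl
  smul_zero _ := rfl
  smul_add _ _ _ := rfl
  smul_one _ := rfl
  smul_mul _ _ _ := rfl

attribute [local instance] trivialAction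

/-- Forget the action of the group. -/
def forget (M : GradedSkewModule 𝒜 Θ) : GradedSkewModule 𝒜 PUnit.{u + 1} where
  carrier := M
  ρ := 1
  gr := M.gr
  isInternal := M.isInternal
  smul_mem := M.smul_mem
  ρ_smul _ _ _ := rfl
  ρ_mem _ _ _ hm := hm

/-- A finitely generated graded module is graded free if its first homology modulo `R₊` vanishes. -/
theorem isGradedFree_of_cyclesMod_le [IsNoetherianRing R] [Nontrivial R] (hconnected : 𝒜 0 = 1)
    (N : GradedSkewModule 𝒜 Θ) (hN : Module.Finite R N)
    {X : ℕ → Type u} [∀ i, AddCommGroup (X i)] [∀ i, Module R (X i)]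
    [∀ i, Module.Projective R (X i)]
    {dX : ∀ i, X (i + 1) →ₗ[R] X i} {eX : X 0 →ₗ[R] N}
    (hX : ∀ i, Function.Exact (dX (i + 1)) (dX i)) (hX0 : Function.Exact (dX 0) eX)
    (sX : Function.Surjective eX)
    (h : cyclesMod (HomogeneousIdeal.irrelevant 𝒜).toIdeal dX 1 ≤
      boundariesMod (HomogeneousIdeal.irrelevant 𝒜).toIdeal dX 1) : N.IsGradedFree := by
  have : SMulCommClass PUnit.{u + 1} k R := ⟨fun _ _ _ => rfl⟩
  have : GradedGroupAction 𝒜 PUnit.{u + 1} := ⟨fun _ _ _ hr => hr⟩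
  -- For the trivial group the order is `1`, which is nonzero in any field, so minimal covers are
  -- available whatever the original `Θ`.
  exact isGradedFree_of_cycles_le (Θ := PUnit.{u + 1}) (N := N.forget)
    (fun K _ => (exists_cover hconnected K).choose) (by simp) hN hX hX0 sX h

end Forget

variable [IsNoetherianRing R] [SMulCommClass Θ k R] [GradedGroupAction 𝒜 Θ]

/-- `Tor` controls homogeneous cycles only; since cycles modulo `R₊` form a graded submodule, this
suffices. -/
theorem cyc_le_bdry_of_tor {M : GradedSkewModule 𝒜 Θ} (P : Resolution M) {i : ℕ}
    (h : ∀ j, ¬ Nontrivial (M.tor i j)) : P.cyc i ≤ P.bdry i := by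
  intro x hx
  obtain ⟨s, hs⟩ := exists_eq_sum_proj x
  rw [hs]
  refine sum_mem fun j _ => ?_
  have := (nontrivial_tor_iff P i j).not.1 (h j)
  rw [not_not] at this
  exact this ⟨P.isGradedSub_cyc i x hx j, (P.F i).proj_mem j x⟩

theorem nontrivial_of_tor {M : GradedSkewModule 𝒜 Θ} (P : Resolution M) {i j : ℕ}
    (h : Nontrivial (M.tor i j)) : Nontrivial (P.F i) := by
  rw [nontrivial_tor_iff P] at h
  by_contra hc
  rw [not_nontrivial_iff_subsingleton] at hc
  refine h fun x _ => ?_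
  rw [Subsingleton.elim x 0]
  exact zero_mem _

variable [Nontrivial R]

/-- If `Tor` vanishes in degree `h + 1`, then the `h`-th syzygy is graded free. -/
theorem isGradedFree_syzygy (hconnected : 𝒜 0 = 1)
    (c : ∀ N : GradedSkewModule 𝒜 Θ, Module.Finite R N → Cover N) (M : GradedSkewModule 𝒜 Θ)
    (hM : Module.Finite R M) {h : ℕ} (hh : ∀ j, ¬ Nontrivial (M.tor (h + 1) j)) :
    (syzygy c M hM h).1.IsGradedFree := by
  have := cyc_le_bdry_of_tor (coverResolution c M hM) hh
  -- The resolution truncated at `h` resolves the `h`-th syzygy, and its first homology modulo `R₊`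
  -- is the homology in degree `h + 1` of the whole.
  exact isGradedFree_of_cyclesMod_le hconnected _ (syzygy c M hM h).2
    (X := fun i => (coverResolution c M hM).F (h + i))
    (dX := fun i => ((coverResolution c M hM).d (h + i)).toLin)
    (eX := (syzygyCover c M hM h).π.toLin)
    (fun i => (coverResolution c M hM).exact (h + i)) (exact_syzygyCover c M hM h)
    (syzygyCover c M hM h).surj this

open Classical in
/-- A choice of covers, which are bijective whenever that is possible. -/
def coverChoice (hconnected : 𝒜 0 = 1) (N : GradedSkewModule 𝒜 Θ) (hN : Module.Finite R N) :
    Cover N :=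
  if h : N.IsGradedFree then Cover.refl N h hN else (exists_cover hconnected N).choose

theorem coverChoice_injective (hconnected : 𝒜 0 = 1) (N : GradedSkewModule 𝒜 Θ)
    (hN : Module.Finite R N) (h : N.IsGradedFree) :
    Function.Injective (coverChoice hconnected N hN).π.toLin := by
  rw [coverChoice, dif_pos h]
  exact Function.injective_id

/-- A nonzero `Tor_i` forces `F_i ≠ 0`, giving one inequality. For the other, the syzygy in position
`hd` is graded free, so the chosen cover of it is injective, the next syzygy is zero, and zero terms
persist. -/
theorem length_coverResolution (hconnected : 𝒜 0 = 1) (M : GradedSkewModule 𝒜 Θ)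
    (hM : Module.Finite R M) (hd : M.hd ≠ ⊤) :
    (coverResolution (coverChoice hconnected) M hM).length = M.hd := by
  obtain ⟨h, hh⟩ := ENat.ne_top_iff_exists.1 hd
  refine le_antisymm (iSup₂_le fun i hi => ?_)
    (iSup₂_le fun i hi => le_iSup₂ (f := fun (i : ℕ)
      (_ : Nontrivial ((coverResolution (coverChoice hconnected) M hM).F i)) => (i : ℕ∞)) i
        (nontrivial_of_tor _ hi.choose_spec))
  rw [← hh, Nat.cast_le]
  by_contra hlt
  push Not at hlt
  have htor : ∀ j, ¬ Nontrivial (M.tor (h + 1) j) := by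
    intro j hj
    have : ((h + 1 : ℕ) : ℕ∞) ≤ M.hd := le_iSup₂ (f := fun (i : ℕ)
      (_ : ∃ j, Nontrivial (M.tor i j)) => (i : ℕ∞)) (h + 1) ⟨j, hj⟩
    rw [← hh, Nat.cast_le] at this
    omega
  have hinj := coverChoice_injective hconnected _ (syzygy (coverChoice hconnected) M hM h).2
    (isGradedFree_syzygy hconnected _ M hM htor)
  have hsub : Subsingleton ((coverResolution (coverChoice hconnected) M hM).F (h + 1)) :=
    subsingleton_of_gr_eq_bot fun d =>
      (syzygyCover (coverChoice hconnected) M hM (h + 1)).gr_eq_bot d fun b _ =>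
        kernel_gr_eq_bot fun x _ hx => (injective_iff_map_eq_zero _).1 hinj x hx
  have := coverResolution_subsingleton _ M hM hsub i hlt
  exact not_nontrivial _ hi

end GradedSkewModule

/-! ### Euler characteristics and the identity for the `Tor` series -/

section SubspaceClasses

variable {k Θ : Type u} [Field k] [Group Θ]

theorem subClass_bot {V : Type u} [AddCommGroup V] [Module k V] (ρ : Representation k Θ V)
    {N : Submodule k V} (h : ∀ g, ∀ v ∈ N, ρ g v ∈ N) (hN : N = ⊥) : subClass ρ N h = 0 := by
  subst hN
  exact repClass_of_subsingleton _

theorem repClass_quotient_add {V : Type u} [AddCommGroup V] [Module k V]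
    {ρ : Representation k Θ V} {B C : Submodule k V} (hB : ∀ g, ∀ v ∈ B, ρ g v ∈ B)
    (hC : ∀ g, ∀ v ∈ C, ρ g v ∈ C) [Module.Finite k C] (hBC : B ≤ C) {B' : Submodule k C}
    (hB' : ∀ c, c ∈ B' ↔ c.1 ∈ B)
    (hst : ∀ g, B' ≤ B'.comap (ρ.subrepresentation C hC g)) :
    repClass (Rep.of ((ρ.subrepresentation C hC).quotient B' hst)) + subClass ρ B hB =
      subClass ρ C hC := by
  rw [add_comm, eq_comm]
  refine repClass_of_exact (Submodule.inclusion hBC) B'.mkQ (fun _ _ => rfl) (fun _ _ => rfl)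
    (Submodule.inclusion_injective _) (fun v hv => ?_) (fun u => ?_) B'.mkQ_surjective
  · rw [Submodule.mkQ_apply, Submodule.Quotient.mk_eq_zero] at hv
    exact ⟨⟨v.1, (hB' v).1 hv⟩, rfl⟩
  · rw [Submodule.mkQ_apply, Submodule.Quotient.mk_eq_zero]
    exact (hB' _).2 u.2

/-- The map `f` induces an isomorphism of `A / K` with `C / B`; the identity is `[A] - [K] = [C] -
[B]`. It is used for the differentials of a resolution and for multiplication by a parameter. -/
theorem subClass_four_term {V V' : Type u} [AddCommGroup V] [Module k V] [AddCommGroup V']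
    [Module k V'] {ρ : Representation k Θ V} {ρ' : Representation k Θ V'} (f : V →ₗ[k] V')
    (hf : ∀ g v, f (ρ g v) = ρ' g (f v)) {A K : Submodule k V} {B C : Submodule k V'}
    (hA : ∀ g, ∀ v ∈ A, ρ g v ∈ A) (hK : ∀ g, ∀ v ∈ K, ρ g v ∈ K)
    (hB : ∀ g, ∀ v ∈ B, ρ' g v ∈ B) (hC : ∀ g, ∀ v ∈ C, ρ' g v ∈ C)
    [Module.Finite k A] [Module.Finite k C] (hBC : B ≤ C) (hfA : ∀ a ∈ A, f a ∈ C)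
    (hfK : ∀ a, a ∈ K ↔ a ∈ A ∧ f a ∈ B) (hfC : ∀ c ∈ C, ∃ a ∈ A, c - f a ∈ B) :
    subClass ρ A hA + subClass ρ' B hB = subClass ρ' C hC + subClass ρ K hK := by
  have hst : ∀ g, (B.submoduleOf C) ≤ (B.submoduleOf C).comap (ρ'.subrepresentation C hC g) :=
    fun g v hv => hB g v.1 hv
  have h1 := repClass_quotient_add hB hC hBC (B' := B.submoduleOf C) (fun _ => Iff.rfl) hst
  have h2 : subClass ρ A hA = subClass ρ K hK +
      repClass (Rep.of ((ρ'.subrepresentation C hC).quotient (B.submoduleOf C) hst)) := by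
    refine repClass_of_exact (Submodule.inclusion fun a ha => ((hfK a).1 ha).1)
      ((B.submoduleOf C).mkQ ∘ₗ f.restrict hfA) (fun _ _ => rfl) (fun g v => ?_)
      (Submodule.inclusion_injective _) (fun v hv => ?_) (fun u => ?_) (fun w => ?_)
    · exact congrArg (B.submoduleOf C).mkQ (Subtype.ext (hf g v.1))
    · rw [LinearMap.comp_apply, Submodule.mkQ_apply, Submodule.Quotient.mk_eq_zero] at hv
      exact ⟨⟨v.1, (hfK v.1).2 ⟨v.2, hv⟩⟩, rfl⟩
    · rw [LinearMap.comp_apply, Submodule.mkQ_apply, Submodule.Quotient.mk_eq_zero]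
      exact ((hfK u.1).1 u.2).2
    · obtain ⟨c, rfl⟩ := (B.submoduleOf C).mkQ_surjective w
      obtain ⟨a, ha, hca⟩ := hfC c.1 c.2
      refine ⟨⟨a, ha⟩, ?_⟩
      rw [LinearMap.comp_apply, ← sub_eq_zero, ← map_sub, Submodule.mkQ_apply,
        Submodule.Quotient.mk_eq_zero, ← neg_mem_iff, neg_sub]
      exact hca
  rw [h2, ← h1]
  abel

end SubspaceClasses

theorem sum_range_alternating {A : Type*} [CommRing A] (e : ℕ → A) (n : ℕ) :
    ∑ i ∈ Finset.range n, (-1) ^ i * (e i + e (i + 1)) = e 0 - (-1) ^ n * e n := by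
  induction n with
  | zero => simp
  | succ n ih => rw [Finset.sum_range_succ, ih]; ring

namespace GradedSkewModule

variable {k R : Type u} [Field k] [CommRing R] [Algebra k R] {𝒜 : ℕ → Submodule k R}
  {Θ : Type u} [Group Θ] [MulSemiringAction Θ R] [GradedAlgebra 𝒜]

theorem ρ_mem_inf_gr (M : GradedSkewModule 𝒜 Θ) {N : Submodule R M}
    (hN : ∀ g, ∀ v ∈ N, M.ρ g v ∈ N) (j : ℕ) :
    ∀ g, ∀ v ∈ N.restrictScalars k ⊓ M.gr j, M.ρ g v ∈ N.restrictScalars k ⊓ M.gr j :=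
  fun g v hv => ⟨hN g v hv.1, M.ρ_mem g hv.2⟩

section EulerCharacteristic

variable [SMulCommClass Θ k R] [GradedGroupAction 𝒜 Θ] {M : GradedSkewModule 𝒜 Θ}

/-- The Euler characteristic of the homology of `P ⊗ k` is that of `P ⊗ k`. -/
theorem sum_repClass_tor (P : Resolution M) {j : ℕ} (hfin : ∀ i, Module.Finite k ((P.F i).gr j))
    {n : ℕ} (hn : (P.F n).gr j = ⊥) :
    ∑ i ∈ Finset.range n, (-1) ^ i * repClass (M.tor i j) =
      ∑ i ∈ Finset.range n, (-1) ^ i * repClass ((P.F i).tensorPiece j) := by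
  let f : ℕ → GrothendieckRing k Θ := fun i => repClass ((P.F i).piece j)
  let z : ℕ → GrothendieckRing k Θ := fun i => subClass _ (P.cycPiece i j) (P.ρ_mem_cycPiece i j)
  let p : ℕ → GrothendieckRing k Θ := fun i =>
    subClass _ _ ((P.F i).ρ_mem_inf_gr (fun g v => (P.F i).ρ_mem_plus g) j)
  let b : ℕ → GrothendieckRing k Θ := fun i =>
    subClass _ _ ((P.F i).ρ_mem_inf_gr (fun g v => P.ρ_mem_bdry i g) j)
  have hplus : ∀ i, (P.F i).plus ≤ P.bdry i := fun i => le_sup_left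
  have hw : ∀ i, repClass ((P.F i).tensorPiece j) + p i = f i := fun i =>
    repClass_quotient_add _ _ inf_le_right (B' := (P.F i).plusPiece j)
      (fun c => ⟨fun h => ⟨h, c.2⟩, fun h => h.1⟩) _
  have hcycfin : ∀ i, Module.Finite k (P.cycPiece i j) := fun i =>
    have := hfin i
    Module.Finite.of_injective (Submodule.inclusion inf_le_right :
      P.cycPiece i j →ₗ[k] (P.F i).gr j) (Submodule.inclusion_injective _)
  have ht : ∀ i, repClass (M.tor i j) + b i = z i := fun i => by
    have := hcycfin i
    rw [repClass_tor P i j]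
    exact repClass_quotient_add _ _ (inf_le_inf_right _ fun x hx => P.bdry_le_cyc i hx)
      (B' := P.bdryPiece i j) (fun c => ⟨fun h => ⟨h, c.2.2⟩, fun h => h.1⟩) _
  -- The differential maps `F_{i+1}` onto boundaries modulo `R₊ F_i`, with kernel the cycles modulo
  -- `R₊`.
  have hb : ∀ i, f (i + 1) + p i = b i + z (i + 1) := fun i => by
    have := hfin (i + 1)
    have : Module.Finite k ((P.bdry i).restrictScalars k ⊓ (P.F i).gr j : Submodule k (P.F i)) :=
      have := hfin i
      Module.Finite.of_injective (Submodule.inclusion inf_le_right :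
        _ →ₗ[k] (P.F i).gr j) (Submodule.inclusion_injective _)
    refine subClass_four_term ((P.d i).toLin.restrictScalars k) (P.d i).map_ρ
      (fun g v hv => (P.F (i + 1)).ρ_mem g hv) _ _ _
      (inf_le_inf_right _ fun x hx => hplus i hx)
      (fun a ha => ⟨Submodule.mem_sup_right ⟨a, rfl⟩, (P.d i).map_gr ha⟩)
      (fun a => ⟨fun h => ⟨h.2, h.1, (P.d i).map_gr h.2⟩, fun h => ⟨h.2.1, h.1⟩⟩) ?_
    rintro c ⟨hc, hcj⟩
    obtain ⟨y, hy⟩ := P.mem_bdry.1 hc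
    refine ⟨(P.F (i + 1)).proj j y, (P.F (i + 1)).proj_mem j y, ?_, sub_mem hcj
      ((P.d i).map_gr ((P.F (i + 1)).proj_mem j y))⟩
    have := isGradedSub_plus _ hy j
    rwa [map_sub, proj_of_mem hcj, ← (P.d i).map_proj] at this
  have hz0 : z 0 = f 0 := by
    have h : P.cycPiece 0 j = (P.F 0).gr j := inf_eq_right.2 fun x _ => P.mem_cyc_zero x
    change subClass _ _ _ = subClass _ _ _
    congr 1
  have hzn : z n = 0 := subClass_bot _ _ (eq_bot_iff.2 (hn ▸ inf_le_right))
  have hfn : f n = 0 := subClass_bot _ _ hn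
  -- The three relations give `[Tor_i] - [F_i ⊗ k] = -(e_i + e_{i+1})` with `e_i = f_i - z_i`. The
  -- alternating sum telescopes, and both ends vanish: everything in `F_0` is a cycle, and `F_n` is
  -- zero in degree `j`.
  have key := sum_range_alternating (fun i => f i - z i) n
  rw [hz0, hzn, hfn, sub_self, sub_self, mul_zero, sub_zero] at key
  rw [← sub_eq_zero, ← Finset.sum_sub_distrib, ← neg_eq_zero, ← key, ← Finset.sum_neg_distrib]
  refine Finset.sum_congr rfl fun i _ => ?_
  rw [eq_sub_of_add_eq (hw i), eq_sub_of_add_eq (ht i), eq_sub_of_add_eq (hb i).symm]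
  ring

end EulerCharacteristic

theorem repClass_piece_kernel {M N : GradedSkewModule 𝒜 Θ} (f : Hom M N)
    (hf : Function.Surjective f.toLin) (n : ℕ) [Module.Finite k (M.gr n)] :
    repClass (M.piece n) = repClass (f.kernel.piece n) + repClass (N.piece n) := by
  refine repClass_of_exact
    ((f.kernelι.toLin.restrictScalars k).restrict fun _ hm => f.kernelι.map_gr hm)
    ((f.toLin.restrictScalars k).restrict fun _ hm => f.map_gr hm)
    (fun _ _ => rfl) (fun g v => Subtype.ext (f.map_ρ g v.1))
    (fun x y h => Subtype.ext (Subtype.ext (congrArg (fun v => v.1) h)))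
    (fun v hv => ⟨⟨⟨v.1, congrArg Subtype.val hv⟩, v.2⟩, rfl⟩) (fun u => Subtype.ext u.1.2)
    fun w => ?_
  obtain ⟨m, hm⟩ := hf w.1
  refine ⟨⟨M.proj n m, M.proj_mem n m⟩, Subtype.ext ?_⟩
  change f.toLin (M.proj n m) = w.1
  rw [f.map_proj, hm, proj_of_mem w.2]

section Series

variable [SMulCommClass Θ k R] [GradedGroupAction 𝒜 Θ] [IsNoetherianRing R]

theorem coverResolution_gr_eq_bot (c : ∀ N : GradedSkewModule 𝒜 Θ, Module.Finite R N → Cover N)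
    (M : GradedSkewModule 𝒜 Θ) (hM : Module.Finite R M) (i : ℕ) :
    ∀ b < i, ((coverResolution c M hM).F i).gr b = ⊥ := by
  induction i with
  | zero => exact fun b hb => absurd hb (Nat.not_lt_zero b)
  | succ i ih => exact fun b hb => coverResolution_gr_succ_eq_bot c M hM ih b (Nat.lt_succ_iff.1 hb)

/-- Each cover gives `[F_i] = [K_i] + [K_{i+1}]` for consecutive syzygies, and the alternating sum
telescopes. -/
theorem sum_repClass_coverResolution
    (c : ∀ N : GradedSkewModule 𝒜 Θ, Module.Finite R N → Cover N)
    (M : GradedSkewModule 𝒜 Θ) (hM : Module.Finite R M) (j : ℕ)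
    (hfin : ∀ i, Module.Finite k (((coverResolution c M hM).F i).gr j)) (n : ℕ) :
    ∑ i ∈ Finset.range n, (-1) ^ i * repClass (((coverResolution c M hM).F i).piece j) =
      repClass (M.piece j) - (-1) ^ n * repClass ((syzygy c M hM n).1.piece j) := by
  refine (Finset.sum_congr rfl fun i _ => ?_).trans
    (sum_range_alternating (fun i => repClass ((syzygy c M hM i).1.piece j)) n)
  have : Module.Finite k ((syzygyCover c M hM i).F.gr j) := hfin i
  have h := repClass_piece_kernel (syzygyCover c M hM i).π (syzygyCover c M hM i).surj j
  exact congrArg _ (h.trans (add_comm _ _))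

theorem repClass_self_piece_zero [Nontrivial R] (hconnected : 𝒜 0 = 1) :
    repClass ((self 𝒜 Θ).piece 0) = 1 := by
  have hfin : Module.Finite k ((self 𝒜 Θ).gr 0) := by
    have : Module.Finite R (self 𝒜 Θ) := inferInstanceAs (Module.Finite R R)
    exact finite_gr hconnected 0
  have h : repClass (Rep.of (Representation.trivial k Θ k)) = repClass ((self 𝒜 Θ).piece 0) := by
    refine repClass_congr ((Algebra.linearMap k R).codRestrict (𝒜 0) fun x => ?_) (fun g x => ?_)
      ⟨?_, ?_⟩
    · rw [hconnected]
      exact Submodule.mem_one.2 ⟨x, rfl⟩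
    · refine Subtype.ext ?_
      -- The action is `k`-linear and fixes `1`, hence is trivial on `R_0 = k`.
      change algebraMap k R x = g • algebraMap k R x
      rw [Algebra.algebraMap_eq_smul_one, smul_comm, smul_one]
    · intro x y h
      exact (algebraMap k R).injective (congrArg Subtype.val h)
    · rintro ⟨x, hx⟩
      have hx' : x ∈ 𝒜 0 := hx
      rw [hconnected] at hx'
      obtain ⟨y, hy⟩ := (Submodule.mem_one (R := k) (A := R)).1 hx'
      exact ⟨y, Subtype.ext hy⟩
  rw [← h, repClass_trivial]

theorem isUnit_series_self [Nontrivial R] (hconnected : 𝒜 0 = 1) :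
    IsUnit (self 𝒜 Θ).series := by
  rw [PowerSeries.isUnit_iff_constantCoeff, ← PowerSeries.coeff_zero_eq_constantCoeff_apply, series,
    PowerSeries.coeff_mk, repClass_self_piece_zero hconnected]
  exact isUnit_one

/-- The covers by induced modules. -/
def inducedCover [Nontrivial R] (hconnected : 𝒜 0 = 1) (N : GradedSkewModule 𝒜 Θ)
    (_ : Module.Finite R N) : Cover N :=
  (exists_cover hconnected N).choose

variable [Nontrivial R]

theorem finite_gr_inducedResolution (hconnected : 𝒜 0 = 1) (M : GradedSkewModule 𝒜 Θ)
    (hM : Module.Finite R M) (i j : ℕ) :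
    Module.Finite k (((coverResolution (inducedCover hconnected) M hM).F i).gr j) :=
  have := (syzygy (inducedCover hconnected) M hM i).2
  ((exists_cover hconnected (syzygy (inducedCover hconnected) M hM i).1).choose_spec j).1

theorem finite_tor_of_finite (hconnected : 𝒜 0 = 1) (M : GradedSkewModule 𝒜 Θ)
    (hM : Module.Finite R M) (i j : ℕ) : Module.Finite k (M.tor i j) :=
  finite_tor (coverResolution (inducedCover hconnected) M hM) i j
    (finite_gr_inducedResolution hconnected M hM i j)

theorem not_nontrivial_tor (hconnected : 𝒜 0 = 1) (M : GradedSkewModule 𝒜 Θ)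
    (hM : Module.Finite R M) {i j : ℕ} (hij : j < i) : ¬ Nontrivial (M.tor i j) := by
  rw [nontrivial_tor_iff (coverResolution (inducedCover hconnected) M hM), not_not]
  refine (inf_le_right).trans ?_
  rw [coverResolution_gr_eq_bot _ M hM i j hij]
  exact bot_le

theorem finite_setOf_nontrivial_tor (hconnected : 𝒜 0 = 1) (M : GradedSkewModule 𝒜 Θ)
    (hM : Module.Finite R M) (j : ℕ) : {i | Nontrivial (M.tor i j)}.Finite :=
  (Set.finite_Iic j).subset fun _ hi =>
    not_lt.1 fun hij => not_nontrivial_tor hconnected M hM hij hi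

/-- In degree `j` both `Tor_i` and `F_i` vanish for `i > j`, so the sum may be cut at any `n > j`.
The freedom in `n` allows one range for all the coefficients entering a product. -/
theorem coeff_torSeries (hconnected : 𝒜 0 = 1) (M : GradedSkewModule 𝒜 Θ)
    (hM : Module.Finite R M) {j n : ℕ} (hjn : j < n) :
    PowerSeries.coeff j M.torSeries =
    ∑ i ∈ Finset.range n, (-1) ^ i *
      repClass (((coverResolution (inducedCover hconnected) M hM).F i).tensorPiece j) := by
  rw [torSeries, PowerSeries.coeff_mk, ← sum_repClass_tor _
    (fun i => finite_gr_inducedResolution hconnected M hM i j)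
    (coverResolution_gr_eq_bot _ M hM n j hjn)]
  refine finsum_eq_sum_of_support_subset _ fun i hi => ?_
  rw [Finset.coe_range, Set.mem_Iio]
  by_contra hni
  have := not_nontrivial_iff_subsingleton.1
    (not_nontrivial_tor hconnected M hM (hjn.trans_le (not_lt.1 hni)))
  refine hi ?_
  change (-1) ^ i * repClass (M.tor i j) = 0
  rw [show repClass (M.tor i j) = 0 from repClass_of_subsingleton (M.tor i j).ρ, mul_zero]

/-- With `F_i = R ⊗ V_i`, degree `n` of `∑ (-1)^i [F_i]` is on one side `[M_n]`, by exactness, and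
on the other the Cauchy product of `[R]` with `∑ (-1)^i [V_i]`, which is the `Tor` series. -/
theorem torSeries_mul_series (hconnected : 𝒜 0 = 1) (M : GradedSkewModule 𝒜 Θ)
    (hM : Module.Finite R M) :
    M.torSeries * (self 𝒜 Θ).series = M.series := by
  ext n
  rw [PowerSeries.coeff_mul]
  have h1 : ∀ x ∈ Finset.HasAntidiagonal.antidiagonal n,
      PowerSeries.coeff x.1 M.torSeries * PowerSeries.coeff x.2 (self 𝒜 Θ).series =
      ∑ i ∈ Finset.range (n + 1), (-1) ^ i * (repClass ((self 𝒜 Θ).piece x.2) * repClass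
        (((coverResolution (inducedCover hconnected) M hM).F i).tensorPiece x.1)) := by
    intro x hx
    have := Finset.HasAntidiagonal.mem_antidiagonal.1 hx
    rw [coeff_torSeries hconnected M hM (by omega : x.1 < n + 1), Finset.sum_mul, series,
      PowerSeries.coeff_mk]
    exact Finset.sum_congr rfl fun i _ => by ring
  refine (Finset.sum_congr rfl h1).trans ?_
  rw [Finset.sum_comm]
  have h2 := sum_repClass_coverResolution (inducedCover hconnected) M hM n
    (fun i => finite_gr_inducedResolution hconnected M hM i n) (n + 1)
  -- `F_n` vanishes below degree `n`, so its cover map is injective in degree `n` and the syzygy `n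
  -- + 1` has no component there: the telescoped remainder is zero.
  have h3 : repClass ((syzygy (inducedCover hconnected) M hM (n + 1)).1.piece n) = 0 :=
    subClass_bot _ _ (kernel_gr_eq_bot fun x hx hx0 =>
      (syzygyCover (inducedCover hconnected) M hM n).lowest n
        (coverResolution_gr_eq_bot _ M hM n) x hx hx0)
  rw [h3, mul_zero, sub_zero] at h2
  rw [series, PowerSeries.coeff_mk, ← h2]
  refine Finset.sum_congr rfl fun i _ => ?_
  rw [← Finset.mul_sum]
  have := (syzygy (inducedCover hconnected) M hM i).2
  have h4 := ((exists_cover hconnected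
    (syzygy (inducedCover hconnected) M hM i).1).choose_spec n).2
  refine congrArg _ (Eq.trans ?_ h4.symm)
  exact Finset.sum_nbij' Prod.swap Prod.swap (by simp [add_comm]) (by simp [add_comm]) (by simp)
    (by simp) (fun _ _ => rfl)

end Series

end GradedSkewModule

/-! ### Composition multiplicities -/

section FactorCount

variable {A : Type*} [Ring A] (S : Type*) [AddCommGroup S] [Module A S]
  {M : Type*} [AddCommGroup M] [Module A M]

/-- The number of factors of a composition series which are isomorphic to `S`. -/
def factorCount (s : CompositionSeries (Submodule A M)) : ℕ :=
  Nat.card {i : Fin s.length //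
    Nonempty ((s i.succ ⧸ (s i.castSucc).submoduleOf (s i.succ)) ≃ₗ[A] S)}

/-- Jordan–Hölder: the factors are matched by a bijection up to isomorphism. -/
theorem factorCount_eq_of_endpoints_eq (s t : CompositionSeries (Submodule A M))
    (hb : s.head = t.head) (ht : s.last = t.last) : factorCount S s = factorCount S t := by
  obtain ⟨f, hf⟩ := CompositionSeries.jordan_holder s t hb ht
  refine Nat.card_congr (f.subtypeEquiv fun i => ?_)
  let e := JordanHolderLattice.Iso.linearEquiv (hf i)
  exact ⟨fun ⟨a⟩ => ⟨e.symm.trans a⟩, fun ⟨a⟩ => ⟨e.trans a⟩⟩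

theorem factorCount_smash (s t : CompositionSeries (Submodule A M)) (h : s.last = t.head) :
    factorCount S (s.smash t h) = factorCount S s + factorCount S t := by
  let P : Fin (s.length + t.length) → Prop := fun i => Nonempty
    ((s.smash t h i.succ ⧸ (s.smash t h i.castSucc).submoduleOf (s.smash t h i.succ)) ≃ₗ[A] S)
  have e1 : {i // P i} ≃ {x : Fin s.length ⊕ Fin t.length // P (finSumFinEquiv x)} :=
    (finSumFinEquiv.subtypeEquiv fun _ => Iff.rfl).symm
  refine (Nat.card_congr (e1.trans (Equiv.subtypeSum))).trans ?_
  rw [Nat.card_sum]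
  congr 1
  · refine Nat.card_congr (Equiv.subtypeEquivRight fun i => ?_)
    change Nonempty _ ↔ Nonempty _
    rw [finSumFinEquiv_apply_left, RelSeries.smash_succ_castAdd, RelSeries.smash_castAdd]
  · refine Nat.card_congr (Equiv.subtypeEquivRight fun i => ?_)
    change Nonempty _ ↔ Nonempty _
    rw [finSumFinEquiv_apply_right, RelSeries.smash_succ_natAdd, RelSeries.smash_natAdd]

variable {N : Type*} [AddCommGroup N] [Module A N]

theorem factorCount_map (f : M →ₗ[A] N) (hf : Function.Injective f)
    (s : CompositionSeries (Submodule A M)) :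
    factorCount S (s.map ⟨Submodule.map f, Submodule.map_covBy_of_injective hf⟩) =
      factorCount S s := by
  refine Nat.card_congr (Equiv.subtypeEquivRight fun i => ?_)
  let e : (s i.succ ⧸ (s i.castSucc).submoduleOf (s i.succ)) ≃ₗ[A]
      ((s i.succ).map f ⧸ ((s i.castSucc).map f).submoduleOf ((s i.succ).map f)) :=
    Submodule.Quotient.equiv _ _ (Submodule.equivMapOfInjective f hf (s i.succ)) <| by
      ext ⟨x, hx⟩
      obtain ⟨y, hy, rfl⟩ := hx
      constructor
      · rintro ⟨z, hz, hzy⟩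
        exact ⟨z.1, hz, congrArg Subtype.val hzy⟩
      · rintro ⟨z, hz, hzy⟩
        have : z = y := hf hzy
        subst this
        exact ⟨⟨z, hy⟩, hz, rfl⟩
  exact ⟨fun ⟨a⟩ => ⟨e.trans a⟩, fun ⟨a⟩ => ⟨e.symm.trans a⟩⟩

theorem factorCount_comap (g : M →ₗ[A] N) (hg : Function.Surjective g)
    (s : CompositionSeries (Submodule A N)) :
    factorCount S (s.map ⟨Submodule.comap g, Submodule.comap_covBy_of_surjective hg⟩) =
      factorCount S s := by
  refine Nat.card_congr (Equiv.subtypeEquivRight fun i => ?_)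
  let g' : (s i.succ).comap g →ₗ[A] s i.succ := g.restrict fun _ h => h
  have hg' : Function.Surjective g' := by
    rintro ⟨y, hy⟩
    obtain ⟨x, rfl⟩ := hg y
    exact ⟨⟨x, hy⟩, rfl⟩
  have hker : LinearMap.ker (((s i.castSucc).submoduleOf (s i.succ)).mkQ ∘ₗ g') =
      ((s i.castSucc).comap g).submoduleOf ((s i.succ).comap g) := by
    rw [LinearMap.ker_comp, Submodule.ker_mkQ]
    rfl
  let e := (Submodule.quotEquivOfEq _ _ hker.symm).trans
    (LinearMap.quotKerEquivOfSurjective (((s i.castSucc).submoduleOf (s i.succ)).mkQ ∘ₗ g') <| by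
      rw [LinearMap.coe_comp]
      exact (Submodule.mkQ_surjective _).comp hg')
  exact ⟨fun ⟨a⟩ => ⟨e.symm.trans a⟩, fun ⟨a⟩ => ⟨e.trans a⟩⟩

open Classical in
/-- The multiplicity of `S` as a composition factor of a module of finite length. -/
def compositionMultiplicity (M : Type*) [AddCommGroup M] [Module A M] : ℕ :=
  if h : ∃ s : CompositionSeries (Submodule A M), s.head = ⊥ ∧ s.last = ⊤ then
    factorCount S h.choose else 0

theorem compositionMultiplicity_eq (s : CompositionSeries (Submodule A M)) (hb : s.head = ⊥)
    (ht : s.last = ⊤) : compositionMultiplicity (A := A) S M = factorCount S s := by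
  have h : ∃ s : CompositionSeries (Submodule A M), s.head = ⊥ ∧ s.last = ⊤ := ⟨s, hb, ht⟩
  rw [compositionMultiplicity, dif_pos h]
  exact factorCount_eq_of_endpoints_eq S _ _ (h.choose_spec.1.trans hb.symm)
    (h.choose_spec.2.trans ht.symm)

/-- The image of a composition series of `L` and the preimage of one of `N` meet at `range f = ker
g`, and together form a composition series of `M`. -/
theorem compositionMultiplicity_eq_add {L : Type*} [AddCommGroup L] [Module A L]
    [IsNoetherian A M] [IsArtinian A M] (f : L →ₗ[A] M) (g : M →ₗ[A] N)
    (hf : Function.Injective f) (hg : Function.Surjective g)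
    (hfg : LinearMap.range f = LinearMap.ker g) :
    compositionMultiplicity (A := A) S M =
      compositionMultiplicity (A := A) S L + compositionMultiplicity (A := A) S N := by
  have := isNoetherian_of_injective f hf
  have := isArtinian_of_injective f hf
  have := isNoetherian_of_surjective g (LinearMap.range_eq_top.2 hg)
  have := isArtinian_of_surjective _ g hg
  obtain ⟨s, hs, hs'⟩ := exists_compositionSeries_of_isNoetherian_isArtinian A L
  obtain ⟨t, ht, ht'⟩ := exists_compositionSeries_of_isNoetherian_isArtinian A N
  let s1 : CompositionSeries (Submodule A M) := s.map ⟨Submodule.map f, Submodule.map_covBy_of_injective hf⟩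
  let t1 : CompositionSeries (Submodule A M) := t.map ⟨Submodule.comap g, Submodule.comap_covBy_of_surjective hg⟩
  have h1 : s1.head = ⊥ := by
    change s.head.map f = ⊥
    rw [hs, Submodule.map_bot]
  have h2 : s1.last = LinearMap.range f := by
    change s.last.map f = _
    rw [hs', Submodule.map_top]
  have h3 : t1.head = LinearMap.ker g := by
    change t.head.comap g = _
    rw [ht, Submodule.comap_bot]
  have h4 : t1.last = ⊤ := by
    change t.last.comap g = _
    rw [ht', Submodule.comap_top]
  have hc : s1.last = t1.head := by rw [h2, h3, hfg]
  rw [compositionMultiplicity_eq S s hs hs', compositionMultiplicity_eq S t ht ht',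
    compositionMultiplicity_eq S (s1.smash t1 hc) (by rw [RelSeries.head_smash, h1])
    (by rw [RelSeries.last_smash, h4]), factorCount_smash,
    factorCount_map S f hf, factorCount_comap S g hg]

end FactorCount

section Multiplicity

variable {k Θ : Type u} [Field k] [Group Θ] (S : Type u) [AddCommGroup S]
  [Module (MonoidAlgebra k Θ) S]

theorem compositionMultiplicity_of_exact {U V W : Type u} [AddCommGroup U] [Module k U]
    [AddCommGroup V] [Module k V] [AddCommGroup W] [Module k W] [Module.Finite k V]
    {ρU : Representation k Θ U} {ρV : Representation k Θ V} {ρW : Representation k Θ W}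
    (f : U →ₗ[k] V) (g : V →ₗ[k] W)
    (hf : ∀ a u, f (ρU a u) = ρV a (f u)) (hg : ∀ a v, g (ρV a v) = ρW a (g v))
    (inj : Function.Injective f) (ex : Function.Exact f g) (surj : Function.Surjective g) :
    compositionMultiplicity (A := MonoidAlgebra k Θ) S ρV.asModule =
      compositionMultiplicity (A := MonoidAlgebra k Θ) S ρU.asModule +
      compositionMultiplicity (A := MonoidAlgebra k Θ) S ρW.asModule := by
  have : IsNoetherian k ρV.asModule := inferInstance
  have : IsArtinian k ρV.asModule := inferInstance
  have : IsNoetherian (MonoidAlgebra k Θ) ρV.asModule := isNoetherian_of_tower k inferInstance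
  have : IsArtinian (MonoidAlgebra k Θ) ρV.asModule := isArtinian_of_tower k inferInstance
  refine compositionMultiplicity_eq_add S
    (Representation.IntertwiningMap.equivLinearMapAsModule ρU ρV
      (LinearMap.intertwiningMap_of_isIntertwiningMap ρU ρV f hf))
    (Representation.IntertwiningMap.equivLinearMapAsModule ρV ρW
      (LinearMap.intertwiningMap_of_isIntertwiningMap ρV ρW g hg)) inj surj ?_
  ext v
  exact (ex v).symm

/-- The composition multiplicity on formal sums of representations. -/
def freeMultiplicity : FreeRepRing k Θ →+ ℤ :=
  (Finsupp.liftAddHom fun c : Skeleton (FDRep k Θ) =>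
    AddMonoidHom.mulRight
      (compositionMultiplicity (A := MonoidAlgebra k Θ) S (Representation.asModule c.out.ρ) : ℤ)).comp
    MonoidAlgebra.coeffAddEquiv.toAddMonoidHom

theorem compositionMultiplicity_congr {U V : Type u} [AddCommGroup U] [Module k U]
    [AddCommGroup V] [Module k V] [Module.Finite k V]
    {ρU : Representation k Θ U} {ρV : Representation k Θ V}
    (f : U →ₗ[k] V) (hf : ∀ a u, f (ρU a u) = ρV a (f u)) (bij : Function.Bijective f) :
    compositionMultiplicity (A := MonoidAlgebra k Θ) S ρU.asModule =
      compositionMultiplicity (A := MonoidAlgebra k Θ) S ρV.asModule := by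
  have h1 := compositionMultiplicity_of_exact S (ρU := ρU) (ρV := ρV)
    (ρW := (1 : Representation k Θ PUnit.{u+1})) f 0 hf (by simp) bij.1
    (fun v => ⟨fun _ => bij.2 v, fun _ => rfl⟩) (fun v => ⟨0, rfl⟩)
  have h2 := compositionMultiplicity_of_exact S (ρU := ρV) (ρV := ρV)
    (ρW := (1 : Representation k Θ PUnit.{u+1})) LinearMap.id 0 (by simp) (by simp)
    Function.injective_id (fun v => ⟨fun _ => ⟨v, rfl⟩, fun _ => rfl⟩) (fun v => ⟨0, rfl⟩)
  omega

/-- The skeleton stores a representative that is only isomorphic to `V`, so invariance under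
isomorphism is needed. -/
theorem freeMultiplicity_gen (V : FDRep k Θ) : freeMultiplicity S (FreeRepRing.gen V) =
    compositionMultiplicity (A := MonoidAlgebra k Θ) S (Representation.asModule V.ρ) := by
  have h : freeMultiplicity S (FreeRepRing.gen V) = compositionMultiplicity
      (A := MonoidAlgebra k Θ) S (Representation.asModule (toSkeleton V).out.ρ) := by
    simp [freeMultiplicity, FreeRepRing.gen]
  obtain ⟨e⟩ : Nonempty ((toSkeleton V).out ≅ V) := ⟨fromSkeletonToSkeletonIso V⟩
  rw [h, compositionMultiplicity_congr S (ρU := (toSkeleton V).out.ρ) (ρV := V.ρ)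
    (FDRep.isoToLinearEquiv e).toLinearMap ?_ (FDRep.isoToLinearEquiv e).bijective]
  intro a u
  rw [FDRep.Iso.conj_ρ e a]
  simp

theorem lTensor_equivariant {M N W : FDRep k Θ} (f : M ⟶ N) (a : Θ) (u : TensorProduct k W M) :
    LinearMap.lTensor W f.hom.hom.hom (Representation.tprod W.ρ M.ρ a u) =
      Representation.tprod W.ρ N.ρ a (LinearMap.lTensor W f.hom.hom.hom u) := by
  induction u using TensorProduct.induction_on with
  | zero => simp only [map_zero]
  | add x y hx hy => simp only [map_add, hx, hy]
  | tmul x y =>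
    have h : f.hom.hom.hom (M.ρ a y) = N.ρ a (f.hom.hom.hom y) :=
      congrArg (fun φ => φ.hom.hom y) (f.comm a)
    simp only [Representation.tprod_apply, TensorProduct.map_tmul, LinearMap.lTensor_tmul]
    exact congrArg _ h

open MonoidalCategory in
-- The relations generate an ideal, not just a subgroup, so multiples must be killed too. Tensoring
-- over `k` with `W` is exact, so a generator times a relation is again a relation.
theorem freeMultiplicity_mul_eq_zero {x : FreeRepRing k Θ} (hx : x ∈ grothendieckRelations k Θ)
    (a : FreeRepRing k Θ) : freeMultiplicity S (a * x) = 0 := by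
  induction a using MonoidAlgebra.induction_linear with
  | zero => rw [zero_mul, map_zero]
  | add a b ha hb => rw [add_mul, map_add, ha, hb, add_zero]
  | single c n =>
    obtain ⟨W, rfl⟩ : ∃ W : FDRep k Θ, toSkeleton W = c := ⟨c.out, Quotient.out_eq c⟩
    have hn : (MonoidAlgebra.single (toSkeleton W) n : FreeRepRing k Θ) =
        n • FreeRepRing.gen W := by
      simp [FreeRepRing.gen]
    obtain ⟨M', M, M'', f, g, hf, hfg, hg, rfl⟩ := hx
    rw [hn, smul_mul_assoc, map_zsmul, mul_add, mul_sub, ← FreeRepRing.gen_tensor,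
      ← FreeRepRing.gen_tensor, ← FreeRepRing.gen_tensor, map_add, map_sub, freeMultiplicity_gen,
      freeMultiplicity_gen, freeMultiplicity_gen]
    have key := compositionMultiplicity_of_exact S (ρU := Representation.tprod W.ρ M'.ρ)
      (ρV := Representation.tprod W.ρ M.ρ) (ρW := Representation.tprod W.ρ M''.ρ)
      (LinearMap.lTensor W f.hom.hom.hom) (LinearMap.lTensor W g.hom.hom.hom) (lTensor_equivariant f) (lTensor_equivariant g)
      (Module.Flat.lTensor_preserves_injective_linearMap _ hf)
      (lTensor_exact _ hfg hg) (LinearMap.lTensor_surjective _ hg)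
    change n • ((compositionMultiplicity (A := MonoidAlgebra k Θ) S
        (Representation.tprod W.ρ M'.ρ).asModule : ℤ) -
      compositionMultiplicity (A := MonoidAlgebra k Θ) S (Representation.tprod W.ρ M.ρ).asModule +
      compositionMultiplicity (A := MonoidAlgebra k Θ) S
        (Representation.tprod W.ρ M''.ρ).asModule) = 0
    rw [key]
    simp

/-- The composition multiplicity on the Grothendieck ring. -/
def grothendieckMultiplicity : GrothendieckRing k Θ →+ ℤ :=
  QuotientAddGroup.lift (Ideal.span (grothendieckRelations k Θ)).toAddSubgroup
    (freeMultiplicity S) <| by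
    intro x hx
    change x ∈ Ideal.span _ at hx
    -- Quantifying over all multiples makes the induction pass through multiplication by ring
    -- elements.
    have h : ∀ a, freeMultiplicity S (a * x) = 0 := by
      induction hx using Submodule.span_induction with
      | mem x hx => exact freeMultiplicity_mul_eq_zero S hx
      | zero => intro a; rw [mul_zero, map_zero]
      | add x y _ _ hx hy => intro a; rw [mul_add, map_add, hx, hy, add_zero]
      | smul b x _ hx => intro a; rw [smul_eq_mul, ← mul_assoc]; exact hx _
    simpa using h 1

theorem isCompositionMultiplicity_grothendieckMultiplicity :
    IsCompositionMultiplicity S (grothendieckMultiplicity (k := k) (Θ := Θ) S) := by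
  intro V s hb ht
  have h : grothendieckMultiplicity S (grothendieckClass V) =
    freeMultiplicity S (FreeRepRing.gen V) := rfl
  rw [h, freeMultiplicity_gen, compositionMultiplicity_eq S s hb ht]
  rfl

end Multiplicity

/-! ### The equivariant Hilbert–Serre argument -/

theorem subClass_congr {k Θ V : Type u} [Field k] [Group Θ] [AddCommGroup V] [Module k V]
    (ρ : Representation k Θ V) {N N' : Submodule k V} (h : ∀ g, ∀ v ∈ N, ρ g v ∈ N)
    (h' : ∀ g, ∀ v ∈ N', ρ g v ∈ N') (e : N = N') : subClass ρ N h = subClass ρ N' h' := by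
  subst e
  rfl

theorem PowerSeries.mem_range_coe {A : Type*} [CommRing A] {f : PowerSeries A} {D : ℕ}
    (h : ∀ n, D ≤ n → PowerSeries.coeff n f = 0) :
    f ∈ (Polynomial.coeToPowerSeries.ringHom (R := A)).range := by
  refine ⟨PowerSeries.trunc D f, ?_⟩
  ext n
  rw [Polynomial.coeToPowerSeries.ringHom_apply, Polynomial.coeff_coe, PowerSeries.coeff_trunc]
  split_ifs with hn
  · rfl
  · exact (h n (not_lt.1 hn)).symm

namespace GradedSkewModule

variable {k R : Type u} [Field k] [CommRing R] [Algebra k R] {𝒜 : ℕ → Submodule k R}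
  {Θ : Type u} [Group Θ] [MulSemiringAction Θ R] [GradedAlgebra 𝒜]

section HilbertSerre

variable {M : GradedSkewModule 𝒜 Θ}

theorem proj_add_smul {e : ℕ} {y : R} (hy : y ∈ 𝒜 e) (n : ℕ) (v : M) :
    M.proj (e + n) (y • v) = y • M.proj n v := by
  have key : ∀ j, ∀ w ∈ M.gr j, M.proj (e + n) (y • w) = y • M.proj n w := by
    intro j w hw
    by_cases hj : n = j
    · subst hj
      rw [proj_of_mem hw, proj_of_mem (M.smul_mem hy hw)]
    · rw [proj_of_mem_ne hj hw, smul_zero, proj_of_mem_ne (by omega) (M.smul_mem hy hw)]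
  obtain ⟨s, hs⟩ := exists_eq_sum_proj v
  rw [hs]
  simp only [Finset.smul_sum, map_sum]
  exact Finset.sum_congr rfl fun j _ => key j _ (M.proj_mem j v)

theorem proj_smul_eq_zero {e n : ℕ} (hn : n < e) {y : R} (hy : y ∈ 𝒜 e) (v : M) :
    M.proj n (y • v) = 0 := by
  obtain ⟨s, hs⟩ := exists_eq_sum_proj v
  rw [hs]
  simp only [Finset.smul_sum, map_sum]
  exact Finset.sum_eq_zero fun j _ =>
    proj_of_mem_ne (by omega) (M.smul_mem hy (M.proj_mem j v))

/-- The submodule `y N`. -/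
def mulSub (y : R) (N : Submodule R M) : Submodule R M := N.map (LinearMap.lsmul R M y)

/-- The submodule of `v ∈ N` such that `y v ∈ L`. -/
def colonSub (y : R) (N L : Submodule R M) : Submodule R M := N ⊓ L.comap (LinearMap.lsmul R M y)

theorem isGradedSub_mulSub {e : ℕ} {y : R} (hy : y ∈ 𝒜 e) {N : Submodule R M}
    (hN : IsGradedSub N) : IsGradedSub (mulSub y N) := by
  rintro _ ⟨v, hv, rfl⟩ j
  change M.proj j (y • v) ∈ _
  by_cases hj : j < e
  · rw [proj_smul_eq_zero hj hy]
    exact zero_mem _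
  · obtain ⟨n, rfl⟩ := Nat.exists_eq_add_of_le (not_lt.1 hj)
    rw [proj_add_smul hy]
    exact ⟨_, hN v hv n, rfl⟩

theorem isGradedSub_colonSub {e : ℕ} {y : R} (hy : y ∈ 𝒜 e) {N L : Submodule R M}
    (hN : IsGradedSub N) (hL : IsGradedSub L) : IsGradedSub (colonSub y N L) := by
  rintro v ⟨hv, hv'⟩ j
  refine ⟨hN v hv j, ?_⟩
  change y • M.proj j v ∈ L
  rw [← proj_add_smul hy]
  exact hL _ hv' _

/-- The Hilbert series of a stable submodule, with values in the Grothendieck ring. -/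
def subSeries (N : Submodule R M) (hN : ∀ g, ∀ v ∈ N, M.ρ g v ∈ N) :
    PowerSeries (GrothendieckRing k Θ) :=
  PowerSeries.mk fun n => subClass M.ρ _ (M.ρ_mem_inf_gr hN n)

/-- Multiplication by `y` maps `B` onto `(A + yB) / A` with kernel the colon submodule. It raises
degrees by `e`, and it is equivariant because `y` is invariant. -/
theorem subSeries_mul {e : ℕ} {y : R} (hy : y ∈ 𝒜 e) (hfin : ∀ n, Module.Finite k (M.gr n))
    (hinv : ∀ g : Θ, g • y = y) {A B : Submodule R M} (gA : IsGradedSub A) (gB : IsGradedSub B)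
    (hA : ∀ g, ∀ v ∈ A, M.ρ g v ∈ A) (hB : ∀ g, ∀ v ∈ B, M.ρ g v ∈ B) 
    (hA' : ∀ g, ∀ v ∈ A ⊔ mulSub y B, M.ρ g v ∈ A ⊔ mulSub y B)
    (hK : ∀ g, ∀ v ∈ colonSub y B A, M.ρ g v ∈ colonSub y B A) :
    PowerSeries.X ^ e * subSeries B hB + subSeries A hA =
      subSeries _ hA' + PowerSeries.X ^ e * subSeries _ hK := by
  have hfin' : ∀ (N : Submodule R M) n,
      Module.Finite k (N.restrictScalars k ⊓ M.gr n : Submodule k M) := fun N n =>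
    have := hfin n
    Module.Finite.of_injective (Submodule.inclusion inf_le_right : _ →ₗ[k] M.gr n)
      (Submodule.inclusion_injective _)
  ext n
  simp only [map_add, PowerSeries.coeff_X_pow_mul', subSeries, PowerSeries.coeff_mk]
  split_ifs with hn
  · obtain ⟨n, rfl⟩ := Nat.exists_eq_add_of_le hn
    rw [Nat.add_sub_cancel_left]
    have := hfin' B n
    have := hfin' (A ⊔ mulSub y B) (e + n)
    refine subClass_four_term ((LinearMap.lsmul R M y).restrictScalars k)
      (fun g v => ?_) _ _ _ _ (inf_le_inf_right _ fun x hx => Submodule.mem_sup_left hx)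
      (fun b hb => ⟨Submodule.mem_sup_right ⟨b, hb.1, rfl⟩, M.smul_mem hy hb.2⟩)
      (fun b => ⟨fun h => ⟨⟨h.1.1, h.2⟩, h.1.2, M.smul_mem hy h.2⟩,
        fun h => ⟨⟨h.1.1, h.2.1⟩, h.1.2⟩⟩) ?_
    · change y • M.ρ g v = M.ρ g (y • v)
      rw [M.ρ_smul, hinv]
    · rintro c ⟨hc, hcn⟩
      obtain ⟨a, ha, _, ⟨b, hb, rfl⟩, rfl⟩ := Submodule.mem_sup.1 hc
      have hbn : y • M.proj n b ∈ M.gr (e + n) := M.smul_mem hy (M.proj_mem n b)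
      refine ⟨M.proj n b, ⟨gB b hb n, M.proj_mem n b⟩, ?_, sub_mem hcn hbn⟩
      change a + y • b - y • M.proj n b ∈ A
      have h : M.proj (e + n) (a + y • b) = a + y • b := proj_of_mem hcn
      rw [← h, map_add, proj_add_smul hy, add_sub_cancel_right]
      exact gA a ha _
  -- Below degree `e` the submodule `yB` has no components, so `A + yB` and `A` agree.
  · rw [zero_add, add_zero]
    refine subClass_congr _ _ _ (le_antisymm
      (inf_le_inf_right _ fun x hx => Submodule.mem_sup_left hx) ?_)
    rintro c ⟨hc, hcn⟩
    refine ⟨?_, hcn⟩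
    obtain ⟨a, ha, _, ⟨b, hb, rfl⟩, rfl⟩ := Submodule.mem_sup.1 hc
    have h : M.proj n (a + y • b) = a + y • b := proj_of_mem hcn
    change a + y • b ∈ A
    rw [← h, map_add, proj_smul_eq_zero (not_le.1 hn) hy, add_zero]
    exact gA a ha _

/-- Hilbert–Serre for the subquotient `B / A`, by induction on the set of parameters that may fail
to kill it. Working with pairs of submodules of a fixed `M` avoids forming quotient modules. When
every parameter kills `B / A`, it vanishes in large degrees. -/
theorem subSeries_mul_prod_mem_range [IsNoetherianRing R] [Module.Finite R M]
    (hfin : ∀ n, Module.Finite k (M.gr n)) {ι : Type*} (y : ι → R) (e : ι → ℕ)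
    (hy : ∀ i, y i ∈ 𝒜 (e i)) (hinv : ∀ i (g : Θ), g • y i = y i) {D₀ : ℕ}
    (hD₀ : ∀ n, D₀ ≤ n → ∀ r ∈ 𝒜 n, r ∈ Ideal.span (Set.range y)) (s : Finset ι) :
    ∀ {A B : Submodule R M} (_ : IsGradedSub A) (_ : IsGradedSub B)
      (hA : ∀ g, ∀ v ∈ A, M.ρ g v ∈ A) (hB : ∀ g, ∀ v ∈ B, M.ρ g v ∈ B), A ≤ B →
      (∀ i ∉ s, ∀ b ∈ B, y i • b ∈ A) →
      (subSeries B hB - subSeries A hA) * ∏ i ∈ s, (1 - PowerSeries.X ^ e i) ∈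
        (Polynomial.coeToPowerSeries.ringHom (R := GrothendieckRing k Θ)).range := by
  classical
  induction s using Finset.induction with
  | empty =>
    intro A B gA gB hA hB hAB hkill
    have : IsNoetherian R M := isNoetherian_of_isNoetherianRing_of_finite R M
    obtain ⟨D, hD⟩ := exists_gr_le_smul M gB (IsNoetherian.noetherian B) hD₀
    rw [Finset.prod_empty, mul_one]
    refine PowerSeries.mem_range_coe (D := D) fun n hn => ?_
    rw [map_sub, subSeries, subSeries, PowerSeries.coeff_mk, PowerSeries.coeff_mk, sub_eq_zero]
    refine subClass_congr _ _ _ (le_antisymm ?_ (inf_le_inf_right _ hAB))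
    rintro v ⟨hv, hvn⟩
    refine ⟨?_, hvn⟩
    have hle : Ideal.span (Set.range y) • B ≤ A := by
      refine Submodule.smul_le.2 fun r hr b hb => ?_
      induction hr using Submodule.span_induction with
      | mem r hr =>
        obtain ⟨i, rfl⟩ := hr
        exact hkill i (Finset.notMem_empty i) b hb
      | zero => rw [zero_smul]; exact zero_mem _
      | add r r' _ _ h h' => rw [add_smul]; exact add_mem h h'
      | smul c r _ h => rw [smul_assoc]; exact A.smul_mem c h
    exact hle (hD n hn v hv hvn)
  | insert i s hi ih =>
    intro A B gA gB hA hB hAB hkill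
    have hA' : ∀ g, ∀ v ∈ A ⊔ mulSub (y i) B, M.ρ g v ∈ A ⊔ mulSub (y i) B := by
      intro g v hv
      obtain ⟨a, ha, _, ⟨b, hb, rfl⟩, rfl⟩ := Submodule.mem_sup.1 hv
      rw [map_add]
      refine Submodule.add_mem_sup (hA g a ha) ⟨M.ρ g b, hB g b hb, ?_⟩
      change y i • M.ρ g b = M.ρ g (y i • b)
      rw [M.ρ_smul, hinv]
    have hK : ∀ g, ∀ v ∈ colonSub (y i) B A, M.ρ g v ∈ colonSub (y i) B A := by
      rintro g v ⟨hv, hv'⟩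
      refine ⟨hB g v hv, ?_⟩
      have := hA g _ hv'
      change M.ρ g (y i • v) ∈ A at this
      rwa [M.ρ_smul, hinv] at this
    have h1 := ih (gA.sup (isGradedSub_mulSub (hy i) gB)) gB hA' hB (sup_le hAB ?_) ?_
    · have h2 := ih gA (isGradedSub_colonSub (hy i) gB gA) hA hK (fun a ha => ⟨hAB ha, A.smul_mem _ ha⟩) ?_
      · have key := subSeries_mul (hy i) hfin (hinv i) gA gB hA hB hA' hK
        rw [Finset.prod_insert hi, ← mul_assoc]
        -- This is `[B/A](1 - t^e) = [B/(A + yB)] - t^e [K/A]`, where `K` is the colon submodule.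
        -- Both subquotients on the right are killed by `y i`, so the induction hypothesis applies
        -- to each.
        have e1 : (subSeries B hB - subSeries A hA) * (1 - PowerSeries.X ^ e i) =
            (subSeries B hB - subSeries _ hA') -
              PowerSeries.X ^ e i * (subSeries _ hK - subSeries A hA) := by
          linear_combination (-1 : PowerSeries (GrothendieckRing k Θ)) * key
        rw [e1, sub_mul, mul_assoc]
        refine sub_mem h1 (mul_mem ⟨Polynomial.X ^ e i, ?_⟩ h2)
        simp
      · intro j hj b hb
        by_cases hji : j = i
        · rw [hji]; exact hb.2
        · exact hkill j (by simp [hj, hji]) b hb.1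
    · rintro _ ⟨b, hb, rfl⟩
      exact B.smul_mem _ hb
    · intro j hj b hb
      by_cases hji : j = i
      · rw [hji]; exact Submodule.mem_sup_right ⟨b, hb, rfl⟩
      · exact Submodule.mem_sup_left (hkill j (by simp [hj, hji]) b hb)

theorem series_mul_prod_mem_range [IsNoetherianRing R] [Module.Finite R M]
    (hfin : ∀ n, Module.Finite k (M.gr n)) {ι : Type*} [Fintype ι] (y : ι → R) (e : ι → ℕ)
    (hy : ∀ i, y i ∈ 𝒜 (e i)) (hinv : ∀ i (g : Θ), g • y i = y i) {D₀ : ℕ}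
    (hD₀ : ∀ n, D₀ ≤ n → ∀ r ∈ 𝒜 n, r ∈ Ideal.span (Set.range y)) :
    M.series * ∏ i, (1 - PowerSeries.X ^ e i) ∈
      (Polynomial.coeToPowerSeries.ringHom (R := GrothendieckRing k Θ)).range := by
  have h := subSeries_mul_prod_mem_range hfin y e hy hinv hD₀ Finset.univ
    (isGradedSub_bot (M := M)) isGradedSub_top
    (fun g v hv => by rw [(Submodule.mem_bot R).1 hv, map_zero]; exact zero_mem _)
    (fun _ _ _ => Submodule.mem_top) bot_le (fun i hi => absurd (Finset.mem_univ i) hi)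
  convert h using 2
  ext n
  rw [map_sub, subSeries, subSeries, series, PowerSeries.coeff_mk, PowerSeries.coeff_mk,
    PowerSeries.coeff_mk, subClass_bot M.ρ (N := (⊥ : Submodule R M).restrictScalars k ⊓ M.gr n) _
      (by simp), sub_zero]
  exact subClass_congr _ _ _ (by simp)

end HilbertSerre

end GradedSkewModule

/-! ### Homogeneous prime avoidance -/

section HomogeneousPrimes

variable {k R : Type u} [Field k] [CommRing R] [Algebra k R] (𝒜 : ℕ → Submodule k R)
  [GradedAlgebra 𝒜]

theorem mem_irrelevant_of_mem {n : ℕ} (hn : 0 < n) {r : R} (hr : r ∈ 𝒜 n) :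
    r ∈ (HomogeneousIdeal.irrelevant 𝒜).toIdeal := by
  rw [HomogeneousIdeal.irrelevant_eq_span]
  exact Ideal.subset_span (Set.mem_iUnion.2 ⟨n, Set.mem_iUnion.2 ⟨hn, hr⟩⟩)

variable {𝒜}

theorem exists_homogeneous_mem_notMem {I p : Ideal R} (hI : I.IsHomogeneous 𝒜) (h : ¬ I ≤ p) :
    ∃ n, ∃ x ∈ 𝒜 n, x ∈ I ∧ x ∉ p := by
  classical
  obtain ⟨x, hx, hxp⟩ := SetLike.not_le_iff_exists.1 h
  by_contra hc
  push Not at hc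
  refine hxp ?_
  rw [← DirectSum.sum_support_decompose 𝒜 x]
  exact sum_mem fun n _ => hc n _ (Subtype.prop _) (hI n hx)

theorem exists_homogeneous_pos_notMem {p : Ideal R}
    (h : ¬ (HomogeneousIdeal.irrelevant 𝒜).toIdeal ≤ p) : ∃ n, 0 < n ∧ ∃ x ∈ 𝒜 n, x ∉ p := by
  obtain ⟨n, x, hx, hxI, hxp⟩ :=
    exists_homogeneous_mem_notMem (HomogeneousIdeal.irrelevant 𝒜).isHomogeneous h
  refine ⟨n, Nat.pos_of_ne_zero ?_, x, hx, hxp⟩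
  rintro rfl
  have h0 : GradedRing.proj 𝒜 0 x = 0 := (HomogeneousIdeal.mem_irrelevant_iff 𝒜 _).1 hxI
  rw [GradedRing.proj_apply, DirectSum.decompose_of_mem_same 𝒜 hx] at h0
  exact hxp (h0 ▸ zero_mem p)

/-- Homogeneous prime avoidance: there is a homogeneous element of positive degree outside finitely
many homogeneous primes which do not contain `R₊`. -/
theorem exists_homogeneous_forall_notMem (P : Finset (Ideal R))
    (hP : ∀ p ∈ P, p.IsPrime ∧ p.IsHomogeneous 𝒜 ∧ ¬ (HomogeneousIdeal.irrelevant 𝒜).toIdeal ≤ p) :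
    ∃ n, 0 < n ∧ ∃ y ∈ 𝒜 n, ∀ p ∈ P, y ∉ p := by
  classical
  induction hc : P.card generalizing P with
  | zero =>
    rw [Finset.card_eq_zero] at hc
    subst hc
    exact ⟨1, one_pos, 0, zero_mem _, fun p hp => absurd hp (Finset.notMem_empty p)⟩
  | succ c ih =>
    -- If one prime lies in another, the smaller may be dropped, since avoiding the larger suffices.
    -- Afterwards the primes form an antichain.
    by_cases hanti : ∃ p ∈ P, ∃ q ∈ P, p ≠ q ∧ p ≤ q
    · obtain ⟨p, hp, q, hq, hpq, hle⟩ := hanti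
      obtain ⟨n, hn, y, hy, hyP⟩ := ih (P.erase p)
        (fun p' hp' => hP p' (Finset.mem_of_mem_erase hp')) (by
          rw [Finset.card_erase_of_mem hp, hc, Nat.add_sub_cancel])
      refine ⟨n, hn, y, hy, fun p' hp' => ?_⟩
      by_cases h : p' = p
      · rw [h]
        exact fun hyp => hyP q (Finset.mem_erase.2 ⟨hpq.symm, hq⟩) (hle hyp)
      · exact hyP p' (Finset.mem_erase.2 ⟨h, hp'⟩)
    · push Not at hanti
      obtain ⟨q, hq⟩ : P.Nonempty := Finset.card_pos.1 (by omega)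
      obtain ⟨a, ha, y, hy, hyP⟩ := ih (P.erase q)
        (fun p' hp' => hP p' (Finset.mem_of_mem_erase hp')) (by
          rw [Finset.card_erase_of_mem hq, hc, Nat.add_sub_cancel])
      by_cases hyq : y ∈ q
      · have hqp := (hP q hq).1
        have hx : ∀ p : P.erase q, ∃ n, ∃ x ∈ 𝒜 n, x ∈ p.1 ∧ x ∉ q := fun p =>
          exists_homogeneous_mem_notMem (hP p.1 (Finset.mem_of_mem_erase p.2)).2.1
            (hanti p.1 (Finset.mem_of_mem_erase p.2) q hq (Finset.ne_of_mem_erase p.2))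
        choose n x hxn hxp hxq using hx
        -- Here `y` avoids all primes but `q`. The product `v` will lie in all the others and not in
        -- `q`; the factor `w` gives it positive degree even if the `x p` have degree `0`. The
        -- powers `y ^ c'` and `v ^ a` have equal degree, and each prime contains exactly one of
        -- them.
        obtain ⟨b, hb, w, hw, hwq⟩ := exists_homogeneous_pos_notMem (hP q hq).2.2
        have hv : w * ∏ p : P.erase q, x p ∈ 𝒜 (b + ∑ p : P.erase q, n p) :=
          SetLike.mul_mem_graded hw (SetLike.prod_mem_graded _ _ _ fun p _ => hxn p)
        have hvq : w * ∏ p : P.erase q, x p ∉ q := fun h =>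
          (hqp.mem_or_mem h).elim hwq fun h' => by
            obtain ⟨p, -, hp⟩ := hqp.prod_mem_iff.1 h'
            exact hxq p hp
        set v := w * ∏ p : P.erase q, x p
        set c' := b + ∑ p : P.erase q, n p with hc'
        have hc'0 : 0 < c' := by omega
        refine ⟨c' * a, Nat.mul_pos hc'0 ha, y ^ c' + v ^ a, add_mem ?_ ?_, fun p hp => ?_⟩
        · simpa using SetLike.pow_mem_graded c' hy
        · have := SetLike.pow_mem_graded a hv
          rwa [smul_eq_mul, mul_comm] at this
        · by_cases hpq : p = q
          · subst hpq
            intro h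
            have h' := (Ideal.add_mem_iff_right _ (Ideal.pow_mem_of_mem _ hyq _ hc'0)).1 h
            exact hvq (hqp.mem_of_pow_mem _ h')
          · have hp' : p ∈ P.erase q := Finset.mem_erase.2 ⟨hpq, hp⟩
            have hvp : v ∈ p := Ideal.mul_mem_left _ _
              (Ideal.prod_mem p (Finset.mem_univ ⟨p, hp'⟩) (hxp ⟨p, hp'⟩))
            intro h
            have h' := (Ideal.add_mem_iff_left _ (Ideal.pow_mem_of_mem _ hvp _ ha)).1 h
            exact hyP p hp' ((hP p hp).1.mem_of_pow_mem _ h')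
      · refine ⟨a, ha, y, hy, fun p hp => ?_⟩
        by_cases hpq : p = q
        · rwa [hpq]
        · exact hyP p (Finset.mem_erase.2 ⟨hpq, hp⟩)

/-- Proper homogeneous ideals are contained in `R₊`. -/
theorem le_irrelevant_of_isHomogeneous (hconnected : 𝒜 0 = 1) {q : Ideal R}
    (hq : q.IsHomogeneous 𝒜) (hne : q ≠ ⊤) : q ≤ (HomogeneousIdeal.irrelevant 𝒜).toIdeal := by
  intro x hx
  refine (HomogeneousIdeal.mem_irrelevant_iff 𝒜 _).2 ?_
  rw [GradedRing.proj_apply]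
  have h0 : (DirectSum.decompose 𝒜 x 0 : R) ∈ q := hq 0 hx
  have h1 : (DirectSum.decompose 𝒜 x 0 : R) ∈ (1 : Submodule k R) :=
    hconnected ▸ (DirectSum.decompose 𝒜 x 0).2
  obtain ⟨c, hc⟩ := Submodule.mem_one.1 h1
  rw [← hc] at h0 ⊢
  by_contra hne0
  have hc0 : c ≠ 0 := fun h => hne0 (by rw [h, map_zero])
  exact hne (Ideal.eq_top_of_isUnit_mem _ h0 ((IsUnit.mk0 c hc0).map (algebraMap k R)))

/-- If a minimal prime of `I` contains `R₊`, then so does the radical of `I`. -/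
theorem irrelevant_le_radical_of_le_minimalPrime (hconnected : 𝒜 0 = 1) {I p : Ideal R}
    (hI : I.IsHomogeneous 𝒜) (hp : p ∈ I.minimalPrimes)
    (hle : (HomogeneousIdeal.irrelevant 𝒜).toIdeal ≤ p) :
    (HomogeneousIdeal.irrelevant 𝒜).toIdeal ≤ I.radical := by
  rw [← Ideal.sInf_minimalPrimes]
  refine le_sInf fun q hq => ?_
  have hqp : q.IsPrime := hq.1.1
  have hcore : (q.homogeneousCore 𝒜).toIdeal.IsPrime := hqp.homogeneousCore
  have hIcore : I ≤ (q.homogeneousCore 𝒜).toIdeal := by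
    rw [← hI.toIdeal_homogeneousCore_eq_self]
    exact Ideal.homogeneousCore_mono 𝒜 hq.1.2
  -- The core of `q` is a prime over `I` contained in `R₊`, hence in `p`. Minimality of `p` then
  -- gives `p ≤ core ≤ q`, so `R₊` lies in every minimal prime.
  have h1 : (q.homogeneousCore 𝒜).toIdeal ≤ p :=
    (le_irrelevant_of_isHomogeneous hconnected (q.homogeneousCore 𝒜).isHomogeneous
      hcore.ne_top).trans hle
  exact (hle.trans (hp.2 ⟨hcore, hIcore⟩ h1)).trans (Ideal.toIdeal_homogeneousCore_le 𝒜 q)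

end HomogeneousPrimes

/-! ### Invariant homogeneous parameters -/

section Parameters

variable {k R : Type u} [Field k] [CommRing R] [Algebra k R] {𝒜 : ℕ → Submodule k R}
  [GradedAlgebra 𝒜] {Θ : Type u} [Group Θ] [MulSemiringAction Θ R] [GradedGroupAction 𝒜 Θ]

/-- An invariant homogeneous element outside the minimal primes of a homogeneous ideal. -/
theorem exists_invariant_forall_notMem [Finite Θ] [IsNoetherianRing R] (hconnected : 𝒜 0 = 1)
    {I : Ideal R} (hI : I.IsHomogeneous 𝒜)
    (hrad : ¬ (HomogeneousIdeal.irrelevant 𝒜).toIdeal ≤ I.radical) :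
    ∃ n, 0 < n ∧ ∃ z ∈ 𝒜 n, (∀ g : Θ, g • z = z) ∧ ∀ p ∈ I.minimalPrimes, z ∉ p := by
  classical
  have := Fintype.ofFinite Θ
  -- A homogeneous `y` lies in `F (p, g)` exactly when `g • y ∈ p`. Passing to homogeneous cores is
  -- what makes homogeneous avoidance applicable.
  let F : Ideal R × Θ → Ideal R := fun x =>
    ((x.1.comap (MulSemiringAction.toRingHom Θ R x.2)).homogeneousCore 𝒜).toIdeal
  obtain ⟨n, hn, y, hy, hyP⟩ := exists_homogeneous_forall_notMem (𝒜 := 𝒜)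
    ((I.finite_minimalPrimes_of_isNoetherianRing.toFinset ×ˢ Finset.univ).image F) <| by
      intro p' hp'
      obtain ⟨⟨p, g⟩, hpg, rfl⟩ := Finset.mem_image.1 hp'
      have hp : p ∈ I.minimalPrimes := by simpa using hpg
      have hpp : p.IsPrime := hp.1.1
      refine ⟨(Ideal.comap_isPrime _ p).homogeneousCore,
        HomogeneousIdeal.isHomogeneous _, fun hle => hrad ?_⟩
      refine irrelevant_le_radical_of_le_minimalPrime hconnected hI hp fun x hx => ?_
      have h1 := Ideal.toIdeal_homogeneousCore_le 𝒜 _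
        (hle (GradedSkewModule.smul_mem_irrelevant (𝒜 := 𝒜) g⁻¹ hx))
      have h2 : g • g⁻¹ • x ∈ p := h1
      rwa [smul_inv_smul] at h2
  -- The witness is the product of all translates of `y`, of degree `|Θ| n`; a prime containing it
  -- would contain some `g • y`.
  refine ⟨∑ _g : Θ, n, ?_, ∏ g : Θ, g • y,
    SetLike.prod_mem_graded _ _ _ fun g _ => GradedGroupAction.smul_mem g hy, fun g => ?_,
    fun p hp hz => ?_⟩
  · rw [Finset.sum_const, smul_eq_mul]
    exact Nat.mul_pos (Finset.card_pos.2 ⟨1, Finset.mem_univ _⟩) hn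
  · rw [Finset.smul_prod']
    exact Fintype.prod_equiv (Equiv.mulLeft g) _ _ fun h => (mul_smul g h y).symm
  · have hpp : p.IsPrime := hp.1.1
    obtain ⟨g, -, hg⟩ := hpp.prod_mem_iff.1 hz
    refine hyP (F (p, g)) (Finset.mem_image_of_mem F (by simpa using hp)) ?_
    exact Ideal.mem_homogeneousCore_of_homogeneous_of_mem ⟨n, hy⟩ hg

/-- Invariant homogeneous parameters of `R / I`. -/
theorem exists_invariant_parameters_aux [Finite Θ] [IsNoetherianRing R] [Nontrivial R]
    (hconnected : 𝒜 0 = 1) (I : Ideal R) (hI : Ideal.IsHomogeneous 𝒜 I)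
    (hle : I ≤ (HomogeneousIdeal.irrelevant 𝒜).toIdeal) :
    ∃ (d : ℕ) (y : Fin d → R) (e : Fin d → ℕ), (∀ i, 0 < e i) ∧ (∀ i, y i ∈ 𝒜 (e i)) ∧
      (∀ i (g : Θ), g • y i = y i) ∧
      (HomogeneousIdeal.irrelevant 𝒜).toIdeal ≤ (I ⊔ Ideal.span (Set.range y)).radical ∧
      ∃ l : LTSeries (PrimeSpectrum R), l.length = d ∧ I ≤ l.head.asIdeal := by
  induction I using WellFoundedGT.induction with
  | ind I ih =>
    have hne : I ≠ ⊤ := fun h => GradedSkewModule.irrelevant_ne_top 𝒜 (top_le_iff.1 (h ▸ hle))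
    by_cases hrad : (HomogeneousIdeal.irrelevant 𝒜).toIdeal ≤ I.radical
    -- No parameters are needed when `R₊` is nilpotent modulo `I`; any prime over `I` gives a chain
    -- of length `0`.
    · obtain ⟨p, hp, hIp⟩ := Ideal.exists_le_maximal I hne
      exact ⟨0, Fin.elim0, Fin.elim0, fun i => i.elim0, fun i => i.elim0, fun i => i.elim0,
        hrad.trans (Ideal.radical_mono le_sup_left),
        RelSeries.singleton _ ⟨p, hp.isPrime⟩, rfl, hIp⟩
    · obtain ⟨n, hn, z, hz, hinv, hzp⟩ :=
        exists_invariant_forall_notMem (Θ := Θ) hconnected hI hrad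
      have hlt : I < I ⊔ Ideal.span {z} := by
        refine lt_of_le_of_ne le_sup_left fun h => ?_
        obtain ⟨m, hm, hIm⟩ := Ideal.exists_le_maximal I hne
        have := hm.isPrime
        obtain ⟨p, hp, -⟩ := Ideal.exists_minimalPrimes_le hIm
        refine hzp p hp (hp.1.2 ?_)
        rw [h]
        exact Ideal.mem_sup_right (Ideal.mem_span_singleton_self z)
      obtain ⟨d, y, e, he, hy, hyinv, hyrad, l, hl, hIl⟩ := ih (I ⊔ Ideal.span {z}) hlt
        (hI.sup (Ideal.homogeneous_span 𝒜 _ fun x hx => ⟨n, by rwa [Set.mem_singleton_iff.1 hx]⟩))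
        (sup_le hle ((Ideal.span_singleton_le_iff_mem _).2 (mem_irrelevant_of_mem 𝒜 hn hz)))
      -- A minimal prime of `I` below the head of the chain is strictly smaller, as the head
      -- contains `z` and `p` does not. So every new parameter lengthens the chain, which bounds
      -- their number by the dimension.
      obtain ⟨p, hp, hpl⟩ := Ideal.exists_minimalPrimes_le (le_sup_left.trans hIl)
      refine ⟨d + 1, Fin.cons z y, Fin.cons n e, Fin.cases hn he, Fin.cases hz hy,
        Fin.cases hinv hyinv, ?_, l.cons ⟨p, hp.1.1⟩ ?_, ?_, ?_⟩
      · refine hyrad.trans (Ideal.radical_mono ?_)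
        rw [Fin.range_cons, Ideal.span_insert, sup_assoc]
      · refine lt_of_le_of_ne hpl fun h => hzp p hp ?_
        have h' : p = l.head.asIdeal := h
        rw [h']
        exact hIl (Ideal.mem_sup_right (Ideal.mem_span_singleton_self z))
      · simp [hl]
      · rw [RelSeries.head_cons]
        exact hp.1.2

/-- Since `R₊ ^ N` is finitely generated, its elements of large degree lie in `R₊ · R₊ ^ N`, which
is the induction step. -/
theorem exists_le_pow_irrelevant [SMulCommClass Θ k R] [IsNoetherianRing R]
    (N : ℕ) : ∃ D, ∀ n, D ≤ n → ∀ r ∈ 𝒜 n, r ∈ (HomogeneousIdeal.irrelevant 𝒜).toIdeal ^ N := by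
  induction N with
  | zero => exact ⟨0, fun n _ r _ => by rw [pow_zero, Ideal.one_eq_top]; exact Submodule.mem_top⟩
  | succ N ih =>
    obtain ⟨D, hD⟩ := ih
    have hhom : ((HomogeneousIdeal.irrelevant 𝒜).toIdeal ^ N).IsHomogeneous 𝒜 := by
      clear hD
      induction N with
      | zero => rw [pow_zero, Ideal.one_eq_top]; exact Ideal.IsHomogeneous.top 𝒜
      | succ N ih => rw [pow_succ]; exact ih.mul (HomogeneousIdeal.irrelevant 𝒜).isHomogeneous
    have hfg : ((HomogeneousIdeal.irrelevant 𝒜).toIdeal ^ N • (⊤ : Ideal R)).FG :=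
      IsNoetherian.noetherian _
    obtain ⟨D', hD'⟩ := GradedSkewModule.exists_gr_le_smul (GradedSkewModule.self 𝒜 Θ)
      (GradedSkewModule.isGradedSub_smul_top _ hhom) hfg
      (I := (HomogeneousIdeal.irrelevant 𝒜).toIdeal) (D₀ := 1)
      fun i hi r hr => mem_irrelevant_of_mem 𝒜 hi hr
    refine ⟨D + D', fun n hn r hr => ?_⟩
    have h1 : r ∈ (HomogeneousIdeal.irrelevant 𝒜).toIdeal ^ N • (⊤ : Ideal R) := by
      rw [smul_eq_mul, Ideal.mul_top]
      exact hD n (by omega) r hr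
    have h2 : r ∈ (HomogeneousIdeal.irrelevant 𝒜).toIdeal •
      (HomogeneousIdeal.irrelevant 𝒜).toIdeal ^ N • (⊤ : Ideal R) := hD' n (by omega) r h1 hr
    rwa [smul_eq_mul, smul_eq_mul, Ideal.mul_top, ← pow_succ'] at h2

/-- There are at most `dim R` invariant homogeneous elements of positive degree generating an ideal
which contains all elements of large degree. -/
theorem exists_invariant_parameters [Finite Θ] [SMulCommClass Θ k R] [IsNoetherianRing R] [Nontrivial R]
    (hconnected : 𝒜 0 = 1) :
    ∃ (d : ℕ) (y : Fin d → R) (e : Fin d → ℕ), (d : WithBot ℕ∞) ≤ ringKrullDim R ∧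
      (∀ i, 0 < e i) ∧ (∀ i, y i ∈ 𝒜 (e i)) ∧ (∀ i (g : Θ), g • y i = y i) ∧
      ∃ D, ∀ n, D ≤ n → ∀ r ∈ 𝒜 n, r ∈ Ideal.span (Set.range y) := by
  obtain ⟨d, y, e, he, hy, hinv, hrad, l, hl, -⟩ := exists_invariant_parameters_aux (Θ := Θ)
    hconnected (⊥ : Ideal R) (Ideal.IsHomogeneous.bot 𝒜) bot_le
  rw [bot_sup_eq] at hrad
  obtain ⟨N, hN⟩ := Ideal.exists_pow_le_of_le_radical_of_fg hrad (IsNoetherian.noetherian _)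
  obtain ⟨D, hD⟩ := exists_le_pow_irrelevant (𝒜 := 𝒜) (Θ := Θ) N
  exact ⟨d, y, e, hl ▸ Order.LTSeries.length_le_krullDim l, he, hy, hinv, D, fun n hn r hr => hN (hD n hn r hr)⟩

end Parameters

/-! ### From polynomial multiples to rational functions -/

section Rationality

theorem isExpansionOf_div {f : PowerSeries ℚ} {D P : Polynomial ℚ} (hD : D ≠ 0)
    (h : f * (D : PowerSeries ℚ) = P) :
    IsExpansionOf f (algebraMap (Polynomial ℚ) (RatFunc ℚ) P /
      algebraMap (Polynomial ℚ) (RatFunc ℚ) D) := by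
  have hD' : algebraMap (Polynomial ℚ) (RatFunc ℚ) D ≠ 0 :=
    RatFunc.algebraMap_ne_zero hD
  have hD'' : ((algebraMap (Polynomial ℚ) (RatFunc ℚ) D : RatFunc ℚ) : LaurentSeries ℚ) ≠ 0 :=
    (map_ne_zero _).2 hD'
  have h' := congrArg (fun g : PowerSeries ℚ => (g : LaurentSeries ℚ)) h
  simp only [PowerSeries.coe_mul, RatFunc.coe_coe] at h'
  rw [IsExpansionOf, map_div₀, eq_div_iff hD'']
  exact h'

theorem poleOrder_div_le {D P : Polynomial ℚ} (hD : D ≠ 0) (a : ℚ) :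
    poleOrder (algebraMap (Polynomial ℚ) (RatFunc ℚ) P /
      algebraMap (Polynomial ℚ) (RatFunc ℚ) D) a ≤ D.rootMultiplicity a :=
  Polynomial.rootMultiplicity_le_rootMultiplicity_of_dvd hD (RatFunc.denom_div_dvd P D) a

theorem one_sub_X_pow_ne_zero {A : Type*} [CommRing A] [Nontrivial A] {e : ℕ} (he : 0 < e) :
    (1 - Polynomial.X ^ e : Polynomial A) ≠ 0 := by
  intro h
  have := congrArg (Polynomial.coeff · 0) h
  simp [he.ne] at this

/-- A double root would make the derivative `-e X^(e-1)` vanish at `1`, impossible in characteristic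
zero. -/
theorem rootMultiplicity_one_sub_X_pow_le {e : ℕ} (he : 0 < e) :
    (1 - Polynomial.X ^ e : Polynomial ℚ).rootMultiplicity 1 ≤ 1 := by
  by_contra h
  have h2 := ((Polynomial.one_lt_rootMultiplicity_iff_isRoot
    (one_sub_X_pow_ne_zero he)).1 (not_le.1 h)).2
  have h3 : (e : ℚ) = 0 := by
    simpa [Polynomial.IsRoot, Polynomial.derivative_X_pow] using h2
  exact he.ne' (Nat.cast_eq_zero.1 h3)

theorem rootMultiplicity_prod_one_sub_X_pow_le {ι : Type*} (s : Finset ι) (e : ι → ℕ)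
    (he : ∀ i, 0 < e i) :
    (∏ i ∈ s, (1 - Polynomial.X ^ e i) : Polynomial ℚ).rootMultiplicity 1 ≤ s.card := by
  classical
  induction s using Finset.induction with
  | empty => simp
  | insert i s hi ih =>
    rw [Finset.prod_insert hi, Finset.card_insert_of_notMem hi, Polynomial.rootMultiplicity_mul
      (mul_ne_zero (one_sub_X_pow_ne_zero (he i))
        (Finset.prod_ne_zero_iff.2 fun j _ => one_sub_X_pow_ne_zero (he j))), add_comm]
    exact add_le_add ih (rootMultiplicity_one_sub_X_pow_le (he i))

variable {k Θ : Type u} [Field k] [Group Θ] (m : GrothendieckRing k Θ →+ ℤ)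

/-- As `m` is only additive, it commutes with multiplication by series having integer coefficients,
not by arbitrary ones. This is why integral denominators are required throughout. -/
theorem coefficientSeries_mul (f : PowerSeries (GrothendieckRing k Θ)) (q : Polynomial ℤ) :
    coefficientSeries m (f * (q.map (Int.castRingHom (GrothendieckRing k Θ)) : Polynomial _)) =
      coefficientSeries m f * (q.map (Int.castRingHom ℚ) : Polynomial ℚ) := by
  ext n
  simp only [coefficientSeries, PowerSeries.coeff_mk, PowerSeries.coeff_mul, Polynomial.coeff_coe,
    Polynomial.coeff_map, map_sum, Int.cast_sum]
  refine Finset.sum_congr rfl fun x _ => ?_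
  rw [eq_intCast, eq_intCast, mul_comm, ← zsmul_eq_mul, map_zsmul, smul_eq_mul, Int.cast_mul,
    mul_comm]

theorem coefficientSeries_mem_range {f : PowerSeries (GrothendieckRing k Θ)}
    (hf : f ∈ (Polynomial.coeToPowerSeries.ringHom (R := GrothendieckRing k Θ)).range) :
    ∃ P : Polynomial ℚ, coefficientSeries m f = P := by
  obtain ⟨p, rfl⟩ := hf
  obtain ⟨P, hP⟩ := PowerSeries.mem_range_coe (D := p.natDegree + 1)
    (f := coefficientSeries m (Polynomial.coeToPowerSeries.ringHom p)) fun n hn => by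
      rw [coefficientSeries, PowerSeries.coeff_mk, Polynomial.coeToPowerSeries.ringHom_apply,
        Polynomial.coeff_coe, Polynomial.coeff_eq_zero_of_natDegree_lt (by omega), map_zero,
        Int.cast_zero]
  exact ⟨P, hP.symm⟩

/-- If a series becomes polynomial after multiplication by an integral polynomial `q`, then its
multiplicity series are rational with denominator `q`. -/
theorem exists_isExpansionOf {f : PowerSeries (GrothendieckRing k Θ)} {q : Polynomial ℤ}
    (hq : q ≠ 0)
    (hf : f * (q.map (Int.castRingHom (GrothendieckRing k Θ)) : Polynomial _) ∈
      (Polynomial.coeToPowerSeries.ringHom (R := GrothendieckRing k Θ)).range) :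
    ∃ r : RatFunc ℚ, IsExpansionOf (coefficientSeries m f) r ∧
      ∀ a, poleOrder r a ≤ (q.map (Int.castRingHom ℚ)).rootMultiplicity a := by
  obtain ⟨P, hP⟩ := coefficientSeries_mem_range m hf
  rw [coefficientSeries_mul] at hP
  have hq' : q.map (Int.castRingHom ℚ) ≠ 0 :=
    (Polynomial.map_ne_zero_iff (Int.cast_injective (α := ℚ))).2 hq
  exact ⟨_, isExpansionOf_div hq' hP, poleOrder_div_le hq'⟩

theorem exists_isExpansionOf_of_prod {f : PowerSeries (GrothendieckRing k Θ)} {d : ℕ}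
    {e : Fin d → ℕ} (he : ∀ i, 0 < e i)
    (hf : f * ∏ i, (1 - PowerSeries.X ^ e i) ∈
      (Polynomial.coeToPowerSeries.ringHom (R := GrothendieckRing k Θ)).range) :
    ∃ r : RatFunc ℚ, IsExpansionOf (coefficientSeries m f) r ∧ poleOrder r 1 ≤ d := by
  have hmap : ((((∏ i, (1 - Polynomial.X ^ e i) : Polynomial ℤ).map
      (Int.castRingHom (GrothendieckRing k Θ)) : Polynomial _)) :
      PowerSeries (GrothendieckRing k Θ)) = ∏ i, (1 - PowerSeries.X ^ e i) := by
    rw [Polynomial.map_prod, ← Polynomial.coeToPowerSeries.ringHom_apply, map_prod]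
    simp
  obtain ⟨r, hr, hr'⟩ := exists_isExpansionOf m (q := ∏ i, (1 - Polynomial.X ^ e i))
    (Finset.prod_ne_zero_iff.2 fun i _ => one_sub_X_pow_ne_zero (he i)) (by rwa [hmap])
  refine ⟨r, hr, (hr' 1).trans ?_⟩
  rw [Polynomial.map_prod]
  simpa using rootMultiplicity_prod_one_sub_X_pow_le Finset.univ e he

end Rationality

/-! ### Integral multiples of polynomials over the Grothendieck ring -/

section CayleyHamilton

open Polynomial in
/-- A polynomial with constant coefficient `1` over a commutative ring which is a finitely generated
abelian group divides an integral polynomial with constant coefficient `1`. -/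
theorem exists_int_multiple {G : Type*} [CommRing G] [Module.Finite ℤ G] (p : G[X])
    (hp : p.coeff 0 = 1) :
    ∃ q : ℤ[X], q.coeff 0 = 1 ∧ p ∣ q.map (Int.castRingHom G) := by
  let _ : Algebra ℤ[X] G[X] := (mapRingHom (Int.castRingHom G)).toAlgebra
  have hsmul : ∀ (a : ℤ[X]) (x : G[X]), a • x = a.map (Int.castRingHom G) * x := fun _ _ => rfl
  have hfin : Module.Finite ℤ[X] G[X] := by
    obtain ⟨s, hs⟩ := Module.Finite.fg_top (R := ℤ) (M := G)
    classical
    refine ⟨s.image C, eq_top_iff.2 fun x hx => ?_⟩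
    clear hx
    induction x using Polynomial.induction_on' with
    | add x y hx hy => exact add_mem hx hy
    | monomial n a =>
      have ha : a ∈ Submodule.span ℤ (s : Set G) := hs ▸ Submodule.mem_top
      have hX : monomial n a = (X ^ n : ℤ[X]) • (C a : G[X]) := by
        rw [hsmul, Polynomial.map_pow, Polynomial.map_X, ← C_mul_X_pow_eq_monomial, mul_comm]
      rw [hX]
      clear hX
      refine Submodule.smul_mem _ _ ?_
      induction ha using Submodule.span_induction with
      | mem a ha => exact Submodule.subset_span (Finset.mem_coe.2 (Finset.mem_image_of_mem _ ha))
      | zero => rw [C_0]; exact zero_mem _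
      | add a b _ _ ha hb => rw [C_add]; exact add_mem ha hb
      | smul z a _ ha =>
        have : (C (z • a) : G[X]) = (C z : ℤ[X]) • (C a : G[X]) := by
          rw [hsmul, Polynomial.map_C, ← C_mul, eq_intCast, zsmul_eq_mul]
        rw [this]
        exact Submodule.smul_mem _ _ ha
  -- `G[X]` is finite over `ℤ[X]`, and `1 - p` maps it into `X G[X]`. Cayley–Hamilton gives a monic
  -- `P` over `ℤ[X]` annihilating `1 - p`, with all lower coefficients divisible by `X`.
  obtain ⟨P, hP, -, hPc, hPa⟩ :=
    LinearMap.exists_monic_and_natDegree_eq_and_coeff_mem_pow_and_aeval_eq_zero ℤ[X]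
      (LinearMap.mulLeft ℤ[X] (1 - p)) (Ideal.span {X}) <| by
        rintro _ ⟨x, rfl⟩
        obtain ⟨u, hu⟩ : X ∣ 1 - p := X_dvd_iff.2 (by simp [hp])
        rw [LinearMap.mulLeft_apply, hu]
        have : X * u * x = (X : ℤ[X]) • (u * x) := by
          rw [hsmul, Polynomial.map_X, mul_assoc]
        rw [this]
        exact Submodule.smul_mem_smul (Ideal.mem_span_singleton_self X) Submodule.mem_top
  have hPu : aeval (1 - p) P = 0 := by
    have h := congrArg (fun f : Module.End ℤ[X] G[X] => f 1) hPa
    have h2 : aeval (LinearMap.mulLeft ℤ[X] (1 - p)) P =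
        LinearMap.mulLeft ℤ[X] (aeval (1 - p) P) := by
      have := Polynomial.aeval_algHom_apply (Algebra.lmul ℤ[X] G[X]) (1 - p) P
      exact this
    rw [h2] at h
    simpa using h
  -- Modulo `X` only the leading coefficient contributes to `P(1)`, so its constant term is `1`; and
  -- `p = 1 - (1 - p)` divides `P(1) - P(1 - p) = P(1)`.
  refine ⟨P.eval 1, ?_, ?_⟩
  · rw [eval_eq_sum_range, Finset.sum_range_succ, hP.coeff_natDegree, coeff_add,
      finsetSum_coeff, Finset.sum_eq_zero fun i hi => ?_]
    · simp
    · have h1 := Ideal.pow_le_self (by have := Finset.mem_range.1 hi; omega) (hPc i)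
      rw [Ideal.mem_span_singleton, X_dvd_iff] at h1
      simpa using h1
  · have h1 : aeval (1 : G[X]) P = (P.eval 1).map (Int.castRingHom G) := by
      rw [aeval_def, eval₂_at_one]
      rfl
    have h2 : (1 : G[X]) - (1 - p) ∣ aeval (1 : G[X]) P - aeval (1 - p) P := by
      have e : ∀ x : G[X], aeval x P = (P.map (algebraMap ℤ[X] G[X])).eval x := fun x => by
        rw [aeval_def, Polynomial.eval_map]
      rw [e, e]
      exact sub_dvd_eval_sub (1 : G[X]) (1 - p) _
    rwa [hPu, sub_zero, sub_sub_cancel, h1] at h2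

end CayleyHamilton

/-! ### Simple modules and finite generation of the Grothendieck ring -/

section SimpleFactors

variable {A : Type*} [Ring A]

theorem compositionMultiplicity_pos {S X : Type*} [AddCommGroup S] [Module A S] [AddCommGroup X]
    [Module A X] [IsSimpleModule A X] (e : X ≃ₗ[A] S) :
    0 < compositionMultiplicity (A := A) S X := by
  let s : CompositionSeries (Submodule A X) :=
    { length := 1
      toFun := ![⊥, ⊤]
      step := fun i => by
        fin_cases i
        exact bot_covBy_top }
  rw [compositionMultiplicity_eq S s rfl rfl]
  have hne : Nonempty {i : Fin s.length //
      Nonempty ((s i.succ ⧸ (s i.castSucc).submoduleOf (s i.succ)) ≃ₗ[A] S)} := by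
    refine ⟨⟨(0 : Fin 1), ⟨?_⟩⟩⟩
    change ((⊤ : Submodule A X) ⧸ (⊥ : Submodule A X).submoduleOf ⊤) ≃ₗ[A] S
    exact ((Submodule.quotEquivOfEqBot _ (by
      rw [Submodule.submoduleOf, Submodule.comap_bot, Submodule.ker_subtype])).trans
      Submodule.topEquiv).trans e
  exact Nat.card_pos

/-- Every simple module is a factor of any composition series of the ring. -/
theorem exists_factor_of_isSimpleModule [IsNoetherian A A] [IsArtinian A A]
    (s : CompositionSeries (Submodule A A)) (hb : s.head = ⊥) (ht : s.last = ⊤) (S : Type*)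
    [AddCommGroup S] [Module A S] [IsSimpleModule A S] :
    ∃ i : Fin s.length,
      Nonempty ((s i.succ ⧸ (s i.castSucc).submoduleOf (s i.succ)) ≃ₗ[A] S) := by
  obtain ⟨I, hI, ⟨e⟩⟩ := (isSimpleModule_iff_quot_maximal (R := A) (M := S)).1 inferInstance
  have : IsSimpleModule A (A ⧸ I) := isSimpleModule_iff_quot_maximal.2 ⟨I, hI, ⟨.refl _ _⟩⟩
  -- `S` is `A / I` for a maximal left ideal `I`, so additivity along `I → A → A / I` gives it
  -- positive multiplicity in `A`.
  have h := compositionMultiplicity_eq_add S (Submodule.subtype I) (Submodule.mkQ I)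
    Subtype.val_injective (Submodule.mkQ_surjective I) (by
      rw [Submodule.range_subtype, Submodule.ker_mkQ])
  have hpos := compositionMultiplicity_pos e.symm
  have h' : 0 < factorCount S s := by
    rw [← compositionMultiplicity_eq S s hb ht]
    omega
  obtain ⟨⟨i, hi⟩⟩ := (Nat.card_pos_iff.1 h').1
  exact ⟨i, hi⟩

end SimpleFactors

section FiniteGeneration

variable {k Θ : Type u} [Field k] [Group Θ]

theorem repClass_of_linearEquiv {U V : Type u} [AddCommGroup U] [Module k U] [AddCommGroup V]
    [Module k V] [Module.Finite k V] {ρU : Representation k Θ U} {ρV : Representation k Θ V}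
    (e : ρU.asModule ≃ₗ[MonoidAlgebra k Θ] ρV.asModule) :
    repClass (Rep.of ρU) = repClass (Rep.of ρV) := by
  let f := (Representation.IntertwiningMap.equivLinearMapAsModule ρU ρV).symm e.toLinearMap
  exact repClass_congr f.toLinearMap (fun a u => Rep.hom_comm_apply (Rep.ofHom f) a u) e.bijective

/-- A representation that is neither zero nor simple splits in the Grothendieck ring as a proper
stable subspace plus its quotient, both of smaller dimension. -/
theorem mem_span_of_simple {t : Set (GrothendieckRing k Θ)}
    (ht : ∀ {V : Type u} [AddCommGroup V] [Module k V] [Module.Finite k V]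
      (ρ : Representation k Θ V), IsSimpleModule (MonoidAlgebra k Θ) ρ.asModule →
        repClass (Rep.of ρ) ∈ Submodule.span ℤ t) (n : ℕ) :
    ∀ {V : Type u} [AddCommGroup V] [Module k V] [Module.Finite k V] (ρ : Representation k Θ V),
      Module.finrank k V ≤ n → repClass (Rep.of ρ) ∈ Submodule.span ℤ t := by
  induction n with
  | zero =>
    intro V _ _ _ ρ hn
    have := Module.finrank_zero_iff.1 (Nat.le_zero.1 hn)
    rw [repClass_of_subsingleton]
    exact zero_mem _
  | succ n ih =>
    intro V _ _ _ ρ hn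
    by_cases hs : Subsingleton V
    · rw [repClass_of_subsingleton]
      exact zero_mem _
    rw [not_subsingleton_iff_nontrivial] at hs
    by_cases h : ∀ N : Submodule (MonoidAlgebra k Θ) ρ.asModule, N = ⊥ ∨ N = ⊤
    · have : Nontrivial ρ.asModule := hs
      exact ht ρ (@IsSimpleModule.mk _ _ _ _ _ ⟨h⟩)
    · push Not at h
      obtain ⟨N, hbot, htop⟩ := h
      let N' : Submodule k V :=
        { carrier := {v | ρ.asModuleEquiv.symm v ∈ N}
          add_mem' := fun {a b} ha hb => N.add_mem ha hb
          zero_mem' := N.zero_mem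
          smul_mem' := fun c v hv => by
            change ρ.asModuleEquiv.symm (c • v) ∈ N
            rw [ρ.asModuleEquiv_symm_map_smul]
            exact N.smul_mem _ hv }
      have hst : ∀ g, ∀ v ∈ N', ρ g v ∈ N' := by
        intro g v hv
        have h1 := N.smul_mem (MonoidAlgebra.of k Θ g) hv
        have h2 := ρ.asModuleEquiv_symm_map_rho g v
        exact h2 ▸ h1
      have hbot' : N' ≠ ⊥ := fun h => hbot (by
        rw [eq_bot_iff]
        intro v hv
        have : v ∈ N' := hv
        rw [h] at this
        exact this)
      have htop' : N' ≠ ⊤ := fun h => htop (by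
        rw [eq_top_iff]
        intro v _
        have : ρ.asModuleEquiv v ∈ N' := by
          rw [h]
          exact Submodule.mem_top
        exact this)
      have hst' : ∀ g, N' ≤ N'.comap (ρ g) := fun g v hv => hst g v hv
      have key : repClass (Rep.of ρ) = repClass (Rep.of (ρ.subrepresentation N' hst)) +
          repClass (Rep.of (ρ.quotient N' hst')) :=
        repClass_of_exact N'.subtype N'.mkQ (fun _ _ => rfl) (fun _ _ => rfl)
          Subtype.val_injective (fun v hv => ⟨⟨v, by simpa using hv⟩, rfl⟩)
          (fun u => by simp) N'.mkQ_surjective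
      have h1 := Submodule.finrank_lt htop'
      have h2 := Submodule.finrank_quotient_add_finrank N'
      have h3 : 0 < Module.finrank k N' := Nat.pos_of_ne_zero fun h => hbot' (Submodule.finrank_eq_zero.1 h)
      rw [key]
      exact add_mem (ih _ (by omega)) (ih _ (by omega))

/-- Every simple module is a factor of one fixed composition series of `k(Θ)`, so finitely many
classes span. -/
theorem finite_grothendieckRing [Finite Θ] : Module.Finite ℤ (GrothendieckRing k Θ) := by
  classical
  have hA : Module.Finite k (MonoidAlgebra k Θ) :=
    Module.Finite.equiv (MonoidAlgebra.coeffLinearEquiv (S := k) (M := Θ) k).symm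
  have : IsNoetherian (MonoidAlgebra k Θ) (MonoidAlgebra k Θ) := isNoetherian_of_tower k inferInstance
  have : IsArtinian (MonoidAlgebra k Θ) (MonoidAlgebra k Θ) := isArtinian_of_tower k inferInstance
  obtain ⟨s, hb, ht⟩ := exists_compositionSeries_of_isNoetherian_isArtinian (MonoidAlgebra k Θ)
    (MonoidAlgebra k Θ)
  let P : Fin s.length → FDRep k Θ → Prop := fun i V =>
    Nonempty ((s i.succ ⧸ (s i.castSucc).submoduleOf (s i.succ)) ≃ₗ[MonoidAlgebra k Θ]
      Representation.asModule V.ρ)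
  -- One class per factor; the value `0` for a factor without a representative is harmless, as only
  -- factors isomorphic to a given simple representation are used.
  let c : Fin s.length → GrothendieckRing k Θ := fun i =>
    if h : ∃ V, P i V then grothendieckClass h.choose else 0
  have hclass : ∀ V : FDRep k Θ, repClass (Rep.of (X := V) V.ρ) = grothendieckClass V := by
    intro V
    have h : Module.Finite k V := inferInstance
    rw [repClass, dif_pos h]
    rfl
  have hmem : ∀ V : FDRep k Θ, grothendieckClass V ∈ Submodule.span ℤ (Set.range c) := by
    intro V
    rw [← hclass]
    refine mem_span_of_simple (fun {W} _ _ _ ρ hρ => ?_) _ _ le_rfl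
    obtain ⟨i, hi⟩ := exists_factor_of_isSimpleModule s hb ht ρ.asModule
    have h : ∃ V, P i V := ⟨FDRep.of ρ, hi⟩
    refine Submodule.subset_span ⟨i, ?_⟩
    simp only [c, dif_pos h]
    rw [← hclass]
    obtain ⟨e⟩ := h.choose_spec
    obtain ⟨e'⟩ := hi
    exact repClass_of_linearEquiv (e.symm.trans e')
  refine ⟨Finset.univ.image c, eq_top_iff.2 fun x hx => ?_⟩
  clear hx
  rw [Finset.coe_image, Finset.coe_univ, Set.image_univ]
  obtain ⟨x, rfl⟩ := Ideal.Quotient.mk_surjective x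
  induction x using MonoidAlgebra.induction_linear with
  | zero => rw [map_zero]; exact zero_mem _
  | add a b ha hb => rw [map_add]; exact add_mem ha hb
  | single a n =>
    obtain ⟨W, rfl⟩ : ∃ W : FDRep k Θ, toSkeleton W = a := ⟨a.out, Quotient.out_eq a⟩
    have hn : (MonoidAlgebra.single (toSkeleton W) n : FreeRepRing k Θ) =
        n • FreeRepRing.gen W := by
      simp [FreeRepRing.gen]
    rw [hn, map_zsmul]
    exact Submodule.smul_mem _ n (hmem W)

end FiniteGeneration

/-! ### Rationality of the series and conclusion -/

namespace GradedSkewModule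

variable {k R : Type u} [Field k] [CommRing R] [Algebra k R] {𝒜 : ℕ → Submodule k R}
  {Θ : Type u} [Group Θ] [MulSemiringAction Θ R] [GradedAlgebra 𝒜] [SMulCommClass Θ k R]
  [GradedGroupAction 𝒜 Θ] [IsNoetherianRing R] [Nontrivial R]

theorem exists_isExpansionOf_series [Finite Θ] (hconnected : 𝒜 0 = 1) (M : GradedSkewModule 𝒜 Θ)
    (hM : Module.Finite R M) (m : GrothendieckRing k Θ →+ ℤ) :
    ∃ r : RatFunc ℚ, IsExpansionOf (coefficientSeries m M.series) r ∧
      (poleOrder r 1 : WithBot ℕ∞) ≤ ringKrullDim R := by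
  obtain ⟨d, y, e, hd, he, hy, hinv, D, hD⟩ := exists_invariant_parameters (Θ := Θ) hconnected
  obtain ⟨r, hr, hr'⟩ := exists_isExpansionOf_of_prod m he
    (series_mul_prod_mem_range (M := M) (fun n => finite_gr hconnected n) y e hy hinv hD)
  exact ⟨r, hr, le_trans (by exact_mod_cast hr') hd⟩

/-- Let `pM` and `pR` be the polynomials obtained from `[M]` and `[R]` by multiplying with the
common product of the `1 - t^{e_i}`. Then `torSeries * pR = pM`. The constant term of `pR` is `1`,
so some `q = pR * p'` is integral, and `torSeries * q = pM * p'` is a polynomial. -/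
theorem exists_isExpansionOf_torSeries [Finite Θ] (hconnected : 𝒜 0 = 1)
    (M : GradedSkewModule 𝒜 Θ) (hM : Module.Finite R M) (m : GrothendieckRing k Θ →+ ℤ) :
    ∃ r : RatFunc ℚ, IsExpansionOf (coefficientSeries m M.torSeries) r := by
  obtain ⟨d, y, e, hd, he, hy, hinv, D, hD⟩ := exists_invariant_parameters (Θ := Θ) hconnected
  have hR : Module.Finite R (self 𝒜 Θ) := inferInstanceAs (Module.Finite R R)
  obtain ⟨pM, hpM⟩ :=
    series_mul_prod_mem_range (M := M) (fun n => finite_gr hconnected n) y e hy hinv hD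
  obtain ⟨pR, hpR⟩ :=
    series_mul_prod_mem_range (M := self 𝒜 Θ) (fun n => finite_gr hconnected n) y e hy hinv hD
  rw [Polynomial.coeToPowerSeries.ringHom_apply] at hpM hpR
  have h0 : pR.coeff 0 = 1 := by
    rw [← Polynomial.coeff_coe, hpR, PowerSeries.coeff_zero_eq_constantCoeff_apply, map_mul,
      map_prod, ← PowerSeries.coeff_zero_eq_constantCoeff_apply, series, PowerSeries.coeff_mk,
      repClass_self_piece_zero hconnected, one_mul]
    exact Finset.prod_eq_one fun i _ => by simp [(he i).ne']
  have := finite_grothendieckRing (k := k) (Θ := Θ)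
  obtain ⟨q, hq, p', hp'⟩ := exists_int_multiple pR h0
  have hq0 : q ≠ 0 := by
    rintro rfl
    simp at hq
  obtain ⟨r, hr, -⟩ := exists_isExpansionOf m (f := M.torSeries) hq0 ⟨pM * p', by
    rw [hp', Polynomial.coeToPowerSeries.ringHom_apply, Polynomial.coe_mul, Polynomial.coe_mul,
      hpM, hpR, ← torSeries_mul_series hconnected M hM]
    ring⟩
  exact ⟨r, hr⟩

end GradedSkewModule
end

theorem mainTheorem6 {k R Θ : Type u} [Field k] [CommRing R] [Nontrivial R] [Algebra k R]
    [IsNoetherianRing R] (𝒜 : ℕ → Submodule k R) [GradedAlgebra 𝒜] (hconnected : 𝒜 0 = 1)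
    [Group Θ] [MulSemiringAction Θ R] [SMulCommClass Θ k R] [GradedGroupAction 𝒜 Θ]
    (M : GradedSkewModule 𝒜 Θ) (hM : Module.Finite R M) :
    -- existence of equivariant resolutions
    (∃ P : M.Resolution, P.IsFinite ∧ P.HasIncreasingMindeg) ∧
    -- all the series below are well defined
    (∀ d, Module.Finite k (𝒜 d)) ∧ (∀ d, Module.Finite k (M.gr d)) ∧
    (∀ i j, Module.Finite k (M.tor i j)) ∧
    (∀ j, {i | Nontrivial (M.tor i j)}.Finite) ∧
    -- minimal resolutions in the semisimple case
    ((Nat.card Θ : k) ≠ 0 →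
      ∃ P : M.Resolution, P.IsFinite ∧ P.HasIncreasingMindeg ∧ P.IsMinimal) ∧
    -- resolutions of length equal to the homological dimension
    (M.hd ≠ ⊤ →
      (∃ P : M.Resolution, P.IsFinite ∧ P.HasIncreasingMindeg ∧ P.length = M.hd) ∧
      ((Nat.card Θ : k) ≠ 0 →
        ∃ P : M.Resolution, P.IsFinite ∧ P.HasIncreasingMindeg ∧ P.IsMinimal ∧
          P.length = M.hd)) ∧
    -- the relation in the power series ring over the Grothendieck ring
    (∃ v : (PowerSeries (GrothendieckRing k Θ))ˣ,
      (v : PowerSeries (GrothendieckRing k Θ)) = (GradedSkewModule.self 𝒜 Θ).series ∧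
      M.torSeries = M.series * ((v⁻¹ : (PowerSeries (GrothendieckRing k Θ))ˣ) :
        PowerSeries (GrothendieckRing k Θ))) ∧
    -- rationality of multiplicities, and the order of their poles at `t = 1`
    (Finite Θ → ∀ (S : Type u) [AddCommGroup S] [Module (MonoidAlgebra k Θ) S]
        [IsSimpleModule (MonoidAlgebra k Θ) S],
      ∃ m : GrothendieckRing k Θ →+ ℤ, IsCompositionMultiplicity S m ∧
        (∃ r : RatFunc ℚ,
          IsExpansionOf (coefficientSeries m (GradedSkewModule.self 𝒜 Θ).series) r ∧
          (poleOrder r 1 : WithBot ℕ∞) ≤ ringKrullDim R) ∧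
        (∃ r : RatFunc ℚ,
          IsExpansionOf (coefficientSeries m M.series) r ∧
          (poleOrder r 1 : WithBot ℕ∞) ≤ ringKrullDim R) ∧
        (∃ r : RatFunc ℚ, IsExpansionOf (coefficientSeries m M.torSeries) r)) := by
  have hR : Module.Finite R (GradedSkewModule.self 𝒜 Θ) := inferInstanceAs (Module.Finite R R)
  -- A single resolution serves all the existence clauses: it is minimal whenever `|Θ|` is nonzero
  -- in `k`, and of length `hd` whenever `hd` is finite.
  let c := GradedSkewModule.coverChoice (Θ := Θ) hconnected
  let P := GradedSkewModule.coverResolution c M hM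
  have hfin : P.IsFinite := GradedSkewModule.coverResolution_isFinite c M hM
  have hdeg : P.HasIncreasingMindeg := GradedSkewModule.coverResolution_hasIncreasingMindeg c M hM
  have hmin : (Nat.card Θ : k) ≠ 0 → P.IsMinimal :=
    GradedSkewModule.coverResolution_isMinimal c M hM
  refine ⟨⟨P, hfin, hdeg⟩,
    fun d => GradedSkewModule.finite_gr (M := GradedSkewModule.self 𝒜 Θ) hconnected d,
    fun d => GradedSkewModule.finite_gr hconnected d,
    GradedSkewModule.finite_tor_of_finite hconnected M hM,
    GradedSkewModule.finite_setOf_nontrivial_tor hconnected M hM,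
    fun hcard => ⟨P, hfin, hdeg, hmin hcard⟩, fun hd => ?_, ?_, ?_⟩
  · have hlen : P.length = M.hd := GradedSkewModule.length_coverResolution hconnected M hM hd
    exact ⟨⟨P, hfin, hdeg, hlen⟩, fun hcard => ⟨P, hfin, hdeg, hmin hcard, hlen⟩⟩
  · obtain ⟨v, hv⟩ := GradedSkewModule.isUnit_series_self (Θ := Θ) hconnected
    refine ⟨v, hv, ?_⟩
    rw [← GradedSkewModule.torSeries_mul_series hconnected M hM, ← hv, mul_assoc, Units.mul_inv,
      mul_one]
  · intro hΘ S _ _ _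
    exact ⟨grothendieckMultiplicity S, isCompositionMultiplicity_grothendieckMultiplicity S,
      GradedSkewModule.exists_isExpansionOf_series hconnected _ hR _,
      GradedSkewModule.exists_isExpansionOf_series hconnected M hM _,
      GradedSkewModule.exists_isExpansionOf_torSeries hconnected M hM _⟩
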